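/- Let $\omega\in(0,1]$, $R\in(0,1/2]$ and $M_F\ge 1$. For $\rho>0$ put $\mathcal Q_\rho=\{(p,q)\in\mathbb C^2: |p|,|q|\le\rho\}$ and $\mathcal D_\rho=\mathcal Q_\rho\times\{\eta\in\mathbb C: |\operatorname{Im}\eta|\le\rho\}$. For $a>0$ consider the functions $F:\mathcal Q_R\times[0,\infty)\to\mathbb C$ such that, for every $t\ge 0$, $F(\cdot,\cdot,t)$ is continuous on $\mathcal Q_R$ and holomorphic in its interior, whose Taylor coefficients $f_\alpha(t)$ at $(p,q)=(0,0)$ ($\alpha\in\mathbb N^2$) are $C^1$ functions of $t\in[0,\infty)$ which vanish identically for $|\alpha|\le 2$, and which satisfy $$\sum_{\alpha}|f_\alpha(t)|\,R^{|\alpha|}\le M_F e^{-at}\qquad\text{for all } t\ge 0 .$$ Let $H(p,q,\eta,t)=\omega pq+\eta+F(p,q,t)$, where $\eta$ is the variable conjugate to $t$. Then there are functions $a\mapsto \hat R_0(a)$ and $a\mapsto\hat R_*(a)$, depending only on $\omega,R,M_F$, with $0<\hat R_*(a)<\hat R_0(a)\le R^4$ for all $a>0$, and with $\hat R_0(a)/a^4$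 and $\hat R_*(a)/a^4$ tending to positive limits as $a\to 0^+$, such that the following holds for every $a>0$ and every such $F$. There is a family of maps $\mathcal M_t:\mathcal D_{\hat R_*(a)}\to\mathcal D_{\hat R_0(a)}$, $(\hat p,\hat q,\hat\eta)\mapsto(p,q,\eta)$, $t\ge0$, each injective and analytic on $\mathcal D_{\hat R_*(a)}$, with $p$ and $q$ differentiable in $t$, which is canonical, i.e. the map $(\hat p,\hat q,\hat\eta,t)\mapsto(p,q,\eta,t)$ preserves the fundamental Poisson brackets of the extended phase space (with conjugate pairs $(q,p)$ and $(t,\eta)$), and which takes $H$ to the strong Moser normal form: $$H\bigl(\mathcal M_t(\hat p,\hat q,\hat\eta),t\bigr)=\omega\,\hat p\hat q+\hat\eta\qquad\text{for all }(\hat p,\hat q,\hat\eta)\in\mathcal D_{\hat R_*(a)},\ t\ge 0 .$$ If moreover $F$ is real-valued at real $(p,q)$, then every $\mathcal M_t$ maps real points to real points. -/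

import Mathlib

open Set Filter Topology
open scoped ENNReal Nat

namespace AperiodicMoser

/-- The closed polydisc `|p|, |q| ≤ R` in `ℂ²`. -/
def polydisc (R : ℝ) : Set (ℂ × ℂ) := {z | ‖z.1‖ ≤ R ∧ ‖z.2‖ ≤ R}

/-- The complex domain of the variables `(p, q, η)`: `|p|, |q| ≤ R` and `|Im η| ≤ R`. -/
def domain (R : ℝ) : Set (ℂ × ℂ × ℂ) :=
  {z | (z.1, z.2.1) ∈ polydisc R ∧ |z.2.2.im| ≤ R}

/-- The Taylor coefficient `f_α(t) = ∂_p^{α₁} ∂_q^{α₂} F(0, 0, t) / (α₁! α₂!)`. -/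
noncomputable def taylorCoeff (F : ℂ × ℂ → ℝ → ℂ) (α : ℕ × ℕ) (t : ℝ) : ℂ :=
  iteratedDeriv α.2 (fun q : ℂ => iteratedDeriv α.1 (fun p : ℂ => F (p, q) t) 0) 0
    / ((α.1 ! : ℂ) * (α.2 ! : ℂ))

/-- The time-dependent Taylor norm `∑_α |f_α(t)| R^{|α|}`, with values in `[0, ∞]`. -/
noncomputable def taylorNormAt (F : ℂ × ℂ → ℝ → ℂ) (R t : ℝ) : ℝ≥0∞ :=
  ∑' α : ℕ × ℕ, ‖taylorCoeff F α t‖ₑ * ENNReal.ofReal (R ^ (α.1 + α.2))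

/-- The standing assumptions on the perturbation: for every `t ≥ 0` it is continuous on the closed
polydisc and holomorphic in its interior, the Taylor coefficients are `C¹` functions on `[0, ∞)`,
and the Taylor expansion starts at degree three. -/
structure IsPerturbation (R : ℝ) (F : ℂ × ℂ → ℝ → ℂ) : Prop where
  continuousOn : ∀ t, 0 ≤ t → ContinuousOn (fun z => F z t) (polydisc R)
  holomorphic : ∀ t, 0 ≤ t → AnalyticOnNhd ℂ (fun z => F z t) (interior (polydisc R))
  coeff_contDiffOn : ∀ α, ContDiffOn ℝ 1 (taylorCoeff F α) (Ici 0)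
  coeff_eq_zero : ∀ α : ℕ × ℕ, α.1 + α.2 ≤ 2 → ∀ t, 0 ≤ t → taylorCoeff F α t = 0

/-- Slow decay: `‖F‖ ≤ M e^{-a t}` in the time-dependent Taylor norm of radius `R`. -/
def SlowDecay (R M a : ℝ) (F : ℂ × ℂ → ℝ → ℂ) : Prop :=
  ∀ t, 0 ≤ t → taylorNormAt F R t ≤ ENNReal.ofReal (M * Real.exp (-a * t))

/-- `F` takes real values at real `(p, q)` in the polydisc. -/
def IsRealPerturbation (R : ℝ) (F : ℂ × ℂ → ℝ → ℂ) : Prop :=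
  ∀ t, 0 ≤ t → ∀ p q : ℝ, ((p : ℂ), (q : ℂ)) ∈ polydisc R → (F ((p : ℂ), (q : ℂ)) t).im = 0

/-- The Hamiltonian `H(p, q, η, t) = ω p q + η + F(p, q, t)`. -/
def hamiltonian (ω : ℝ) (F : ℂ × ℂ → ℝ → ℂ) (z : ℂ × ℂ × ℂ) (t : ℝ) : ℂ :=
  (ω : ℂ) * z.1 * z.2.1 + z.2.2 + F (z.1, z.2.1) t

/-! Partial derivatives of a function `G` of `((p, q, η), t)`, `t ≥ 0` (one-sided at `t = 0`). -/

noncomputable def dp (G : ℂ × ℂ × ℂ → ℝ → ℂ) (z : ℂ × ℂ × ℂ) (t : ℝ) : ℂ :=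
  deriv (fun p => G (p, z.2.1, z.2.2) t) z.1

noncomputable def dq (G : ℂ × ℂ × ℂ → ℝ → ℂ) (z : ℂ × ℂ × ℂ) (t : ℝ) : ℂ :=
  deriv (fun q => G (z.1, q, z.2.2) t) z.2.1

noncomputable def deta (G : ℂ × ℂ × ℂ → ℝ → ℂ) (z : ℂ × ℂ × ℂ) (t : ℝ) : ℂ :=
  deriv (fun e => G (z.1, z.2.1, e) t) z.2.2

noncomputable def dt (G : ℂ × ℂ × ℂ → ℝ → ℂ) (z : ℂ × ℂ × ℂ) (t : ℝ) : ℂ :=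
  derivWithin (fun s => G z s) (Ici 0) t

/-- The Poisson bracket `{F, G} = F_q G_p + F_t G_η - F_p G_q - F_η G_t` on the extended phase
space, in which `p` is conjugate to `q` and `η` is conjugate to `t`. -/
noncomputable def poisson (F G : ℂ × ℂ × ℂ → ℝ → ℂ) (z : ℂ × ℂ × ℂ) (t : ℝ) : ℂ :=
  dq F z t * dp G z t + dt F z t * deta G z t - dp F z t * dq G z t - deta F z t * dt G z t

/-- Let `Φ t` be a family of maps `(p, q, η) ↦ (P, Q, E)`, parametrised by `t ≥ 0`. It is a family
of canonical changes of variables on `D` if every `Φ t` is holomorphic and injective on `D`, and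
the map `(p, q, η, t) ↦ (P, Q, E, T)` with `T = t` of the extended phase space preserves the
fundamental Poisson brackets.

Differentiability of `E` in `t` is not required (it can fail when `F` is merely continuous in `t`):
`E_t` enters the brackets below only multiplied by `P_η`, `Q_η` or a derivative of `T` that
vanishes, and `{P, T} = {Q, T} = 0` says that `P_η = Q_η = 0`. -/
structure IsCanonicalFamily (Φ : ℝ → ℂ × ℂ × ℂ → ℂ × ℂ × ℂ) (D : Set (ℂ × ℂ × ℂ)) : Prop where
  analytic : ∀ t, 0 ≤ t → AnalyticOnNhd ℂ (Φ t) D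
  injOn : ∀ t, 0 ≤ t → InjOn (Φ t) D
  differentiable_P : ∀ t, 0 ≤ t → ∀ z ∈ D,
    DifferentiableWithinAt ℝ (fun s => (Φ s z).1) (Ici 0) t
  differentiable_Q : ∀ t, 0 ≤ t → ∀ z ∈ D,
    DifferentiableWithinAt ℝ (fun s => (Φ s z).2.1) (Ici 0) t
  bracket_Q_P : ∀ t, 0 ≤ t → ∀ z ∈ D,
    poisson (fun w s => (Φ s w).2.1) (fun w s => (Φ s w).1) z t = 1
  bracket_T_E : ∀ t, 0 ≤ t → ∀ z ∈ D,
    poisson (fun _ s => (s : ℂ)) (fun w s => (Φ s w).2.2) z t = 1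
  bracket_P_T : ∀ t, 0 ≤ t → ∀ z ∈ D,
    poisson (fun w s => (Φ s w).1) (fun _ s => (s : ℂ)) z t = 0
  bracket_Q_T : ∀ t, 0 ≤ t → ∀ z ∈ D,
    poisson (fun w s => (Φ s w).2.1) (fun _ s => (s : ℂ)) z t = 0
  bracket_P_E : ∀ t, 0 ≤ t → ∀ z ∈ D,
    poisson (fun w s => (Φ s w).1) (fun w s => (Φ s w).2.2) z t = 0
  bracket_Q_E : ∀ t, 0 ≤ t → ∀ z ∈ D,
    poisson (fun w s => (Φ s w).2.1) (fun w s => (Φ s w).2.2) z t = 0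

/-- Every `Φ t`, `t ≥ 0`, maps the real points of `D` to real points. -/
def IsRealFamily (Φ : ℝ → ℂ × ℂ × ℂ → ℂ × ℂ × ℂ) (D : Set (ℂ × ℂ × ℂ)) : Prop :=
  ∀ t, 0 ≤ t → ∀ z ∈ D, z.1.im = 0 → z.2.1.im = 0 → z.2.2.im = 0 →
    (Φ t z).1.im = 0 ∧ (Φ t z).2.1.im = 0 ∧ (Φ t z).2.2.im = 0

end AperiodicMoser

/-! The canonical map is found in one step, as a conjugacy carrying the flow of the linear saddle
`p' = -ωp`, `q' = ωq` to the flow of the perturbed system. After rescaling `(p, q)` by a small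
radius `r`, its components must satisfy `∂_t P + ω(q∂_q - p∂_p)P = -ωP - F_q(P, Q, t)` and `∂_t Q +
ω(q∂_q - p∂_p)Q = ωQ + F_p(P, Q, t)`, where the rescaled `F` has size `O(r)` because it starts at
degree three.

Put `P = p + e^{-bt} W`, `Q = q + e^{-bt} V` with `b = min(a, ω/2)`. The exponential cancels, and
every Taylor coefficient of `W` and `V` solves a scalar equation `w' + μw = h` with `μ = ωn - b`,
`n` an integer. Since `|μ| ≥ b` (`le_abs_rate`), there are no small divisors: the decay in time
shifts even the resonant modes `n = 0` away from zero. The linear part is thus inverted with norm at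
most `1/b` on bounded functions of time, and for `r` small compared with `b` a contraction in the
Wiener algebra of power series with coefficients in `ℝ →ᵇ ℂ` produces `W` and `V`
(`exists_conjugacy`).

Area preservation comes from the choice among bounded solutions. The Jacobian `J` of a conjugacy
between two divergence-free fields is transported by the saddle, so each coefficient of `J - 1` is a
multiple of `e^{-ωnt}`, with `n` the difference of the `q` and `p` exponents. It tends to zero as `t
→ ∞`, which excludes `n ≤ 0`; starting the modes with `μ > 0` at zero makes `J - 1` free of modes `n
> 0` at time zero. Hence `J = 1` (`coeff_jac_eq`).

Finally `E = η + ω(pq - PQ) - F(P, Q, t)` makes the normal form an identity, and the brackets of `P`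
and `Q` with `E` vanish by the evolution equations together with `J = 1`
(`isCanonicalFamily_normalFormMap`). No `t`-derivative of `F` or `E` is used. -/

namespace AperiodicMoser

/-! ### The Wiener algebra of absolutely summable power series over a normed ring. -/

section Wiener

variable {σ C : Type*} [NormedCommRing C]

theorem summable_norm_coeff_mul {f g : MvPowerSeries σ C}
    (hf : Summable fun α => ‖MvPowerSeries.coeff α f‖)
    (hg : Summable fun α => ‖MvPowerSeries.coeff α g‖) :
    (Summable fun α => ‖MvPowerSeries.coeff α (f * g)‖) ∧
      ∑' α, ‖MvPowerSeries.coeff α (f * g)‖ ≤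
        (∑' α, ‖MvPowerSeries.coeff α f‖) * ∑' α, ‖MvPowerSeries.coeff α g‖ := by
  classical
  obtain ⟨a, ha⟩ : ∃ a : (σ →₀ ℕ) → ℝ, a = fun α => ‖MvPowerSeries.coeff α f‖ := ⟨_, rfl⟩
  obtain ⟨b, hb⟩ : ∃ b : (σ →₀ ℕ) → ℝ, b = fun α => ‖MvPowerSeries.coeff α g‖ := ⟨_, rfl⟩
  have ha0 : 0 ≤ a := fun α => by simp [ha]
  have hb0 : 0 ≤ b := fun α => by simp [hb]
  rw [← ha] at hf ⊢
  rw [← hb] at hg ⊢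
  have hprod := hf.mul_of_nonneg hg ha0 hb0
  have hsum := summable_sum_mul_antidiagonal_of_summable_mul hprod
  have hle : ∀ α, ‖MvPowerSeries.coeff α (f * g)‖ ≤
      ∑ kl ∈ Finset.HasAntidiagonal.antidiagonal α, a kl.1 * b kl.2 := fun α => by
    rw [MvPowerSeries.coeff_mul, ha, hb]
    exact (norm_sum_le _ _).trans (Finset.sum_le_sum fun _ _ => norm_mul_le _ _)
  have hs := hsum.of_nonneg_of_le (fun _ => norm_nonneg _) hle
  refine ⟨hs, ?_⟩
  rw [hf.tsum_mul_tsum_eq_tsum_sum_antidiagonal hg hprod]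
  exact Summable.tsum_le_tsum hle hs hsum

variable (σ C) in
/-- The power series with absolutely summable coefficients. -/
def summableSubring : Subring (MvPowerSeries σ C) where
  carrier := {f | Summable fun α => ‖MvPowerSeries.coeff α f‖}
  mul_mem' hf hg := (summable_norm_coeff_mul hf hg).1
  one_mem' := by
    classical
    refine summable_of_ne_finset_zero (s := {0}) fun α hα => ?_
    rw [MvPowerSeries.coeff_one, if_neg (by simpa using hα), norm_zero]
  add_mem' {f g} hf hg := by
    refine (Summable.add hf hg).of_nonneg_of_le (fun _ => norm_nonneg _) fun α => ?_
    rw [map_add]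
    exact norm_add_le _ _
  zero_mem' := by simp
  neg_mem' {f} hf := by simpa using hf

variable (σ C) in
/-- The Banach algebra of power series with absolutely summable coefficients. -/
def Wiener : Type _ := summableSubring σ C

namespace Wiener

noncomputable instance : CommRing (Wiener σ C) := inferInstanceAs (CommRing (summableSubring σ C))

/-- The underlying power series. -/
noncomputable def toSeries : Wiener σ C →+* MvPowerSeries σ C := (summableSubring σ C).subtype

theorem toSeries_injective : Function.Injective (toSeries : Wiener σ C → MvPowerSeries σ C) :=
  Subtype.val_injective

/-- The coefficients of an element of the Wiener algebra. -/
noncomputable def coeff (α : σ →₀ ℕ) : Wiener σ C →+ C :=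
  (MvPowerSeries.coeff α).toAddMonoidHom.comp (toSeries : Wiener σ C →+* _).toAddMonoidHom

theorem coeff_toSeries (f : Wiener σ C) (α : σ →₀ ℕ) :
    MvPowerSeries.coeff α (toSeries f) = coeff α f := rfl

theorem ext {f g : Wiener σ C} (h : ∀ α, coeff α f = coeff α g) : f = g :=
  toSeries_injective (MvPowerSeries.ext h)

theorem summable_norm (f : Wiener σ C) : Summable fun α => ‖coeff α f‖ := f.2

/-- The element with the given summable coefficients. -/
def mk (c : (σ →₀ ℕ) → C) (hc : Summable fun α => ‖c α‖) : Wiener σ C := ⟨c, hc⟩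

@[simp] theorem coeff_mk (c : (σ →₀ ℕ) → C) (hc) (α) : coeff α (mk c hc) = c α := rfl

/-- The coefficient sequence as an element of `ℓ¹`. -/
noncomputable def toLp : Wiener σ C →+ lp (fun _ : σ →₀ ℕ => C) 1 where
  toFun f := ⟨fun α => coeff α f, memℓp_gen (by simpa using f.summable_norm)⟩
  map_zero' := by
    apply lp.ext; funext α
    exact map_zero (coeff α)
  map_add' f g := by
    apply lp.ext; funext α
    exact map_add (coeff α) f g

theorem toLp_bijective : Function.Bijective (toLp : Wiener σ C → _) := by
  refine ⟨fun f g h => ext fun α => ?_, fun x => ⟨mk x ?_, ?_⟩⟩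
  · exact congrFun (congrArg Subtype.val h) α
  · simpa using (lp.memℓp x).summable (by simp)
  · rfl

noncomputable instance : NormedAddCommGroup (Wiener σ C) :=
  NormedAddCommGroup.induced _ _ toLp toLp_bijective.1

theorem isometry_toLp : Isometry (toLp : Wiener σ C → _) :=
  AddMonoidHomClass.isometry_of_norm _ fun _ => rfl

theorem norm_eq_tsum (f : Wiener σ C) : ‖f‖ = ∑' α, ‖coeff α f‖ := by
  change ‖toLp f‖ = _
  rw [lp.norm_eq_tsum_rpow (by simp)]
  simp [toLp]

noncomputable instance : NormedCommRing (Wiener σ C) where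
  dist_eq := NormedAddCommGroup.dist_eq
  norm_mul_le f g := by
    simp_rw [norm_eq_tsum]
    exact (summable_norm_coeff_mul f.summable_norm g.summable_norm).2
  mul_comm := mul_comm

instance [CompleteSpace C] : CompleteSpace (Wiener σ C) :=
  (IsometryEquiv.mk (Equiv.ofBijective _ toLp_bijective) isometry_toLp).completeSpace

theorem norm_coeff_le (f : Wiener σ C) (α : σ →₀ ℕ) : ‖coeff α f‖ ≤ ‖f‖ := by
  rw [norm_eq_tsum]
  exact f.summable_norm.le_tsum α fun _ _ => norm_nonneg _

theorem continuous_coeff (α : σ →₀ ℕ) : Continuous (coeff α : Wiener σ C → C) :=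
  AddMonoidHomClass.continuous_of_bound (coeff α) 1 fun f => by simpa using norm_coeff_le f α

/-- A monomial with a coefficient. -/
noncomputable def monomial (α : σ →₀ ℕ) (c : C) : Wiener σ C :=
  ⟨MvPowerSeries.monomial α c, by
    classical
    refine summable_of_ne_finset_zero (s := {α}) fun β hβ => ?_
    rw [MvPowerSeries.coeff_monomial, if_neg (by simpa using hβ), norm_zero]⟩

theorem norm_monomial (α : σ →₀ ℕ) (c : C) : ‖monomial α c‖ = ‖c‖ := by
  classical
  rw [norm_eq_tsum, tsum_eq_single α]
  · rw [← coeff_toSeries]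
    exact congrArg norm (MvPowerSeries.coeff_monomial_same α c)
  · intro β hβ
    rw [← coeff_toSeries]
    exact (congrArg norm (MvPowerSeries.coeff_monomial_ne hβ c)).trans norm_zero

/-- The constants in the Wiener algebra. -/
noncomputable def const : C →+* Wiener σ C where
  toFun c := monomial 0 c
  map_one' := rfl
  map_zero' := toSeries_injective (map_zero (MvPowerSeries.C (σ := σ) (R := C)))
  map_add' a b := toSeries_injective (map_add (MvPowerSeries.C (σ := σ) (R := C)) a b)
  map_mul' a b := toSeries_injective (map_mul (MvPowerSeries.C (σ := σ) (R := C)) a b)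

theorem toSeries_const (c : C) : toSeries (const c : Wiener σ C) = MvPowerSeries.C c := rfl

theorem norm_const (c : C) : ‖(const c : Wiener σ C)‖ = ‖c‖ := norm_monomial 0 c

/-- The variables in the Wiener algebra. -/
noncomputable def X (i : σ) : Wiener σ C := monomial (Finsupp.single i 1) 1

theorem toSeries_X (i : σ) : toSeries (X i : Wiener σ C) = MvPowerSeries.X i := rfl

instance [NormOneClass C] : NormOneClass (Wiener σ C) :=
  ⟨by rw [← map_one (const : C →+* Wiener σ C), norm_const, norm_one]⟩

theorem norm_X [NormOneClass C] (i : σ) : ‖(X i : Wiener σ C)‖ = 1 := by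
  rw [X, norm_monomial, norm_one]

/-- The diagonal operator which acts on the coefficients by uniformly bounded additive maps. -/
noncomputable def diag (T : (σ →₀ ℕ) → C →+ C) (B : ℝ) (hT : ∀ α c, ‖T α c‖ ≤ B * ‖c‖) :
    Wiener σ C →+ Wiener σ C where
  toFun f := mk (fun α => T α (coeff α f))
    ((f.summable_norm.mul_left B).of_nonneg_of_le (fun _ => norm_nonneg _) fun α => hT α _)
  map_zero' := ext fun α => by simp
  map_add' f g := ext fun α => by simp

@[simp] theorem coeff_diag (T : (σ →₀ ℕ) → C →+ C) (B : ℝ) (hT) (f : Wiener σ C) (α : σ →₀ ℕ) :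
    coeff α (diag T B hT f) = T α (coeff α f) := rfl

theorem norm_diag_le (T : (σ →₀ ℕ) → C →+ C) (B : ℝ) (hT) (f : Wiener σ C) :
    ‖diag T B hT f‖ ≤ B * ‖f‖ := by
  rw [norm_eq_tsum, norm_eq_tsum, ← tsum_mul_left]
  exact Summable.tsum_le_tsum (fun α => hT α _) (summable_norm _) (f.summable_norm.mul_left B)

end Wiener

end Wiener

/-! ### Substitution of Wiener series into a power series with geometrically small coefficients. -/

section Comp

/-- The family of coefficients `g` is bounded by a geometric sequence. -/
def GeomBound {C : Type*} [Norm C] (ε K : ℝ) (g : ℕ × ℕ → C) : Prop :=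
  ∀ β, ‖g β‖ ≤ ε * K ^ (β.1 + β.2)

/-- The coefficients of the first partial derivative. -/
def shiftFst {C : Type*} [Semiring C] (g : ℕ × ℕ → C) (β : ℕ × ℕ) : C :=
  (β.1 + 1 : ℕ) * g (β.1 + 1, β.2)

/-- The coefficients of the second partial derivative. -/
def shiftSnd {C : Type*} [Semiring C] (g : ℕ × ℕ → C) (β : ℕ × ℕ) : C :=
  (β.2 + 1 : ℕ) * g (β.1, β.2 + 1)

theorem norm_natCast_le_self {C : Type*} [NormedRing C] [NormOneClass C] (n : ℕ) :
    ‖(n : C)‖ ≤ n := by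
  simpa using Nat.norm_cast_le (α := C) n

/-- Differentiation costs a factor `n + 1 ≤ 2^n`, paid for by doubling the ratio; the amplitude `ε`
is unchanged, so derivatives of a small series remain small. -/
theorem GeomBound.shiftFst {C : Type*} [NormedRing C] [NormOneClass C] {ε K : ℝ} {g : ℕ × ℕ → C}
    (hg : GeomBound ε K g) (hε : 0 ≤ ε) (hK : 0 ≤ K) (hK1 : K ≤ 1) :
    GeomBound ε (2 * K) (shiftFst g) := fun β => by
  have h1 : ((β.1 + 1 : ℕ) : ℝ) ≤ 2 ^ (β.1 + β.2) := by
    have h2 : β.1 + 1 ≤ 2 ^ (β.1 + β.2) :=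
      (Nat.lt_two_pow_self (n := β.1)).trans_le (Nat.pow_le_pow_right (by norm_num) (by omega))
    exact_mod_cast h2
  have h2 : K ^ (β.1 + 1 + β.2) ≤ K ^ (β.1 + β.2) := pow_le_pow_of_le_one hK hK1 (by omega)
  calc ‖((β.1 + 1 : ℕ) : C) * g (β.1 + 1, β.2)‖
      ≤ (β.1 + 1 : ℕ) * (ε * K ^ (β.1 + 1 + β.2)) :=
        (norm_mul_le _ _).trans (mul_le_mul (norm_natCast_le_self _) (hg _) (norm_nonneg _)
          (Nat.cast_nonneg _))
    _ ≤ 2 ^ (β.1 + β.2) * (ε * K ^ (β.1 + β.2)) := by gcongr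
    _ = ε * (2 * K) ^ (β.1 + β.2) := by rw [mul_pow]; ring

theorem GeomBound.shiftSnd {C : Type*} [NormedRing C] [NormOneClass C] {ε K : ℝ} {g : ℕ × ℕ → C}
    (hg : GeomBound ε K g) (hε : 0 ≤ ε) (hK : 0 ≤ K) (hK1 : K ≤ 1) :
    GeomBound ε (2 * K) (shiftSnd g) := fun β => by
  have h1 : ((β.2 + 1 : ℕ) : ℝ) ≤ 2 ^ (β.1 + β.2) := by
    have h2 : β.2 + 1 ≤ 2 ^ (β.1 + β.2) :=
      (Nat.lt_two_pow_self (n := β.2)).trans_le (Nat.pow_le_pow_right (by norm_num) (by omega))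
    exact_mod_cast h2
  have h2 : K ^ (β.1 + (β.2 + 1)) ≤ K ^ (β.1 + β.2) := pow_le_pow_of_le_one hK hK1 (by omega)
  calc ‖((β.2 + 1 : ℕ) : C) * g (β.1, β.2 + 1)‖
      ≤ (β.2 + 1 : ℕ) * (ε * K ^ (β.1 + (β.2 + 1))) :=
        (norm_mul_le _ _).trans (mul_le_mul (norm_natCast_le_self _) (hg _) (norm_nonneg _)
          (Nat.cast_nonneg _))
    _ ≤ 2 ^ (β.1 + β.2) * (ε * K ^ (β.1 + β.2)) := by gcongr
    _ = ε * (2 * K) ^ (β.1 + β.2) := by rw [mul_pow]; ring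

theorem hasSum_geometric_prod {x : ℝ} (h0 : 0 ≤ x) (h1 : x < 1) :
    HasSum (fun β : ℕ × ℕ => x ^ (β.1 + β.2)) ((1 - x)⁻¹ * (1 - x)⁻¹) := by
  have h := hasSum_geometric_of_lt_one h0 h1
  have h2 := h.mul h (h.summable.mul_of_nonneg h.summable (fun _ => pow_nonneg h0 _)
    fun _ => pow_nonneg h0 _)
  simpa only [pow_add] using h2

variable {σ C : Type*} [NormedCommRing C] [NormOneClass C]

/-- The term `g_β P^β₁ Q^β₂` of a composition. -/
noncomputable def compTerm (g : ℕ × ℕ → C) (P Q : Wiener σ C) (β : ℕ × ℕ) : Wiener σ C :=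
  Wiener.const (g β) * (P ^ β.1 * Q ^ β.2)

/-- The composition `∑ g_β P^β₁ Q^β₂`. -/
noncomputable def comp (g : ℕ × ℕ → C) (P Q : Wiener σ C) : Wiener σ C := ∑' β, compTerm g P Q β

theorem norm_pow_mul_pow_le {A : Type*} [NormedCommRing A] [NormOneClass A] {P Q : A}
    (hP : ‖P‖ ≤ 2) (hQ : ‖Q‖ ≤ 2) (m n : ℕ) :
    ‖P ^ m * Q ^ n‖ ≤ 2 ^ (m + n) := by
  rw [pow_add]
  exact (norm_mul_le _ _).trans (mul_le_mul ((norm_pow_le _ _).trans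
    (pow_le_pow_left₀ (norm_nonneg _) hP _)) ((norm_pow_le _ _).trans
    (pow_le_pow_left₀ (norm_nonneg _) hQ _)) (norm_nonneg _) (by positivity))

theorem norm_pow_sub_pow_le {A : Type*} [NormedCommRing A] [NormOneClass A] {P P' : A}
    (hP : ‖P‖ ≤ 2) (hP' : ‖P'‖ ≤ 2) (m : ℕ) :
    ‖P ^ m - P' ^ m‖ ≤ m * 2 ^ m * ‖P - P'‖ := by
  induction m with
  | zero => simp
  | succ m ih =>
    have h1 : P ^ (m + 1) - P' ^ (m + 1) = P * (P ^ m - P' ^ m) + (P - P') * P' ^ m := by ring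
    have h2 : ‖P' ^ m‖ ≤ 2 ^ m :=
      (norm_pow_le _ _).trans (pow_le_pow_left₀ (norm_nonneg _) hP' _)
    have h3 : 0 ≤ (2 : ℝ) ^ m * ‖P - P'‖ := by positivity
    calc _ ≤ ‖P‖ * ‖P ^ m - P' ^ m‖ + ‖P - P'‖ * ‖P' ^ m‖ := by
          rw [h1]
          exact (norm_add_le _ _).trans (add_le_add (norm_mul_le _ _) (norm_mul_le _ _))
      _ ≤ 2 * (m * 2 ^ m * ‖P - P'‖) + ‖P - P'‖ * 2 ^ m := by gcongr
      _ ≤ _ := by push_cast; rw [pow_succ]; nlinarith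

theorem norm_monomial_sub_le {A : Type*} [NormedCommRing A] [NormOneClass A] {P P' Q Q' : A}
    {d : ℝ} (hP : ‖P‖ ≤ 2) (hP' : ‖P'‖ ≤ 2) (hQ : ‖Q‖ ≤ 2) (hQ' : ‖Q'‖ ≤ 2)
    (h1 : ‖P - P'‖ ≤ d) (h2 : ‖Q - Q'‖ ≤ d) (m n : ℕ) :
    ‖P ^ m * Q ^ n - P' ^ m * Q' ^ n‖ ≤ (m + n : ℕ) * 2 ^ (m + n) * d := by
  have hd : 0 ≤ d := (norm_nonneg _).trans h1
  have e : P ^ m * Q ^ n - P' ^ m * Q' ^ n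
      = (P ^ m - P' ^ m) * Q ^ n + P' ^ m * (Q ^ n - Q' ^ n) := by ring
  have h3 : ‖Q ^ n‖ ≤ 2 ^ n := (norm_pow_le _ _).trans (pow_le_pow_left₀ (norm_nonneg _) hQ _)
  have h4 : ‖P' ^ m‖ ≤ 2 ^ m := (norm_pow_le _ _).trans (pow_le_pow_left₀ (norm_nonneg _) hP' _)
  calc _ ≤ ‖P ^ m - P' ^ m‖ * ‖Q ^ n‖ + ‖P' ^ m‖ * ‖Q ^ n - Q' ^ n‖ := by
        rw [e]
        exact (norm_add_le _ _).trans (add_le_add (norm_mul_le _ _) (norm_mul_le _ _))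
    _ ≤ (m * 2 ^ m * d) * 2 ^ n + 2 ^ m * (n * 2 ^ n * d) := by
        gcongr
        · exact (norm_pow_sub_pow_le hP hP' m).trans (by gcongr)
        · exact (norm_pow_sub_pow_le hQ hQ' n).trans (by gcongr)
    _ = _ := by push_cast; ring

/-- The degree in the Lipschitz constant is absorbed by `n ≤ 2^n`. This is why Lipschitz bounds for
`comp` need `4 * K < 1`, whereas convergence needs only `2 * K < 1`. -/
theorem norm_monomial_sub_le_four_pow {A : Type*} [NormedCommRing A] [NormOneClass A]
    {P P' Q Q' : A} {d : ℝ} (hP : ‖P‖ ≤ 2) (hP' : ‖P'‖ ≤ 2) (hQ : ‖Q‖ ≤ 2) (hQ' : ‖Q'‖ ≤ 2)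
    (h1 : ‖P - P'‖ ≤ d) (h2 : ‖Q - Q'‖ ≤ d) (m n : ℕ) :
    ‖P ^ m * Q ^ n - P' ^ m * Q' ^ n‖ ≤ 4 ^ (m + n) * d := by
  have hd : 0 ≤ d := (norm_nonneg _).trans h1
  have h5 : ((m + n : ℕ) : ℝ) ≤ 2 ^ (m + n) := by
    exact_mod_cast (Nat.lt_two_pow_self (n := m + n)).le
  calc _ ≤ (m + n : ℕ) * 2 ^ (m + n) * d := norm_monomial_sub_le hP hP' hQ hQ' h1 h2 m n
    _ ≤ 2 ^ (m + n) * 2 ^ (m + n) * d := by gcongr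
    _ = _ := by rw [← mul_pow]; norm_num

variable {ε K : ℝ} {g : ℕ × ℕ → C} {P Q P' Q' : Wiener σ C}

theorem norm_compTerm_le (hg : GeomBound ε K g) (hP : ‖P‖ ≤ 2) (hQ : ‖Q‖ ≤ 2) (β : ℕ × ℕ) :
    ‖compTerm g P Q β‖ ≤ ε * (2 * K) ^ (β.1 + β.2) := by
  calc ‖compTerm g P Q β‖ ≤ ‖g β‖ * ‖P ^ β.1 * Q ^ β.2‖ := by
        rw [← Wiener.norm_const (σ := σ) (g β)]; exact norm_mul_le _ _
    _ ≤ (ε * K ^ (β.1 + β.2)) * 2 ^ (β.1 + β.2) :=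
        mul_le_mul (hg β) (norm_pow_mul_pow_le hP hQ _ _) (norm_nonneg _)
          ((norm_nonneg _).trans (hg β))
    _ = _ := by rw [mul_pow]; ring

theorem hasSum_comp [CompleteSpace C] (hg : GeomBound ε K g) (hK : 0 ≤ K) (hK1 : 2 * K < 1)
    (hP : ‖P‖ ≤ 2) (hQ : ‖Q‖ ≤ 2) : HasSum (compTerm g P Q) (comp g P Q) :=
  (Summable.of_norm_bounded
    ((hasSum_geometric_prod (by linarith) hK1).summable.mul_left ε)
    (norm_compTerm_le hg hP hQ)).hasSum

theorem norm_comp_le [CompleteSpace C] (hg : GeomBound ε K g) (hK : 0 ≤ K) (hK1 : 2 * K < 1)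
    (hP : ‖P‖ ≤ 2) (hQ : ‖Q‖ ≤ 2) :
    ‖comp g P Q‖ ≤ ε * ((1 - 2 * K)⁻¹ * (1 - 2 * K)⁻¹) :=
  tsum_of_norm_bounded ((hasSum_geometric_prod (by linarith) hK1).mul_left ε)
    (norm_compTerm_le hg hP hQ)

theorem norm_comp_sub_le [CompleteSpace C] (hg : GeomBound ε K g) (hK : 0 ≤ K)
    (hK1 : 4 * K < 1) (hP : ‖P‖ ≤ 2) (hP' : ‖P'‖ ≤ 2) (hQ : ‖Q‖ ≤ 2) (hQ' : ‖Q'‖ ≤ 2)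
    {d : ℝ} (h1 : ‖P - P'‖ ≤ d) (h2 : ‖Q - Q'‖ ≤ d) :
    ‖comp g P Q - comp g P' Q'‖ ≤ ε * ((1 - 4 * K)⁻¹ * (1 - 4 * K)⁻¹) * d := by
  have hs := (hasSum_comp hg hK (by linarith) hP hQ).sub (hasSum_comp hg hK (by linarith) hP' hQ')
  rw [← hs.tsum_eq]
  refine tsum_of_norm_bounded
    (((hasSum_geometric_prod (by linarith) hK1).mul_left ε).mul_right d) fun β => ?_
  have e : compTerm g P Q β - compTerm g P' Q' β
      = Wiener.const (g β) * (P ^ β.1 * Q ^ β.2 - P' ^ β.1 * Q' ^ β.2) := by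
    simp only [compTerm]; ring
  calc _ ≤ ‖g β‖ * ‖P ^ β.1 * Q ^ β.2 - P' ^ β.1 * Q' ^ β.2‖ := by
        rw [e, ← Wiener.norm_const (σ := σ) (g β)]; exact norm_mul_le _ _
    _ ≤ (ε * K ^ (β.1 + β.2)) * (4 ^ (β.1 + β.2) * d) :=
        mul_le_mul (hg β) (norm_monomial_sub_le_four_pow hP hP' hQ hQ' h1 h2 _ _) (norm_nonneg _)
          ((norm_nonneg _).trans (hg β))
    _ = _ := by rw [mul_pow]; ring

end Comp

/-! ### Bounded solutions of the scalar equation `w' + μw = h` on the half-line. -/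

section Relax

open MeasureTheory BoundedContinuousFunction

variable (μ : ℝ) (h : ℝ →ᵇ ℂ)

/-- The initial value of the bounded solution of `w' + μ w = h`; it is taken to be zero
when every solution is bounded. -/
noncomputable def relaxInit : ℂ :=
  if μ < 0 then -∫ s in Ioi (0 : ℝ), (Real.exp (μ * s) : ℂ) * h s else 0

/-- The bounded solution of `w' + μ w = h` with initial value `relaxInit μ h`. -/
noncomputable def relaxFun (t : ℝ) : ℂ :=
  (Real.exp (-μ * t) : ℂ) *
    (relaxInit μ h + ∫ s in (0 : ℝ)..t, (Real.exp (μ * s) : ℂ) * h s)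

theorem continuous_exp_mul : Continuous fun s : ℝ => (Real.exp (μ * s) : ℂ) * h s := by
  have := h.continuous
  fun_prop

theorem norm_exp_mul_le (s : ℝ) : ‖(Real.exp (μ * s) : ℂ) * h s‖ ≤ ‖h‖ * Real.exp (μ * s) := by
  rw [norm_mul, Complex.norm_real, Real.norm_eq_abs, Real.abs_exp, mul_comm]
  gcongr
  exact h.norm_coe_le_norm s

theorem integrableOn_exp_mul (hμ : μ < 0) (t : ℝ) :
    IntegrableOn (fun s : ℝ => (Real.exp (μ * s) : ℂ) * h s) (Ioi t) :=
  ((integrableOn_exp_mul_Ioi hμ t).const_mul ‖h‖).mono'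
    (continuous_exp_mul μ h).aestronglyMeasurable
    (Eventually.of_forall (norm_exp_mul_le μ h))

theorem hasDerivAt_relaxFun (t : ℝ) :
    HasDerivAt (relaxFun μ h) (h t - μ * relaxFun μ h t) t := by
  have h1 : HasDerivAt (fun t : ℝ => (Real.exp (-μ * t) : ℂ))
      ((Real.exp (-μ * t) * (-μ) : ℝ) : ℂ) t := by
    have := ((hasDerivAt_id t).const_mul (-μ)).exp
    simpa using this.ofReal_comp
  have h2 : HasDerivAt (fun t : ℝ => relaxInit μ h + ∫ s in (0 : ℝ)..t,
      (Real.exp (μ * s) : ℂ) * h s) ((Real.exp (μ * t) : ℂ) * h t) t :=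
    ((continuous_exp_mul μ h).integral_hasStrictDerivAt 0 t).hasDerivAt.const_add _
  have h3 : (Real.exp (-μ * t) : ℂ) * (Real.exp (μ * t) : ℂ) = 1 := by
    rw [← Complex.ofReal_mul, ← Real.exp_add]; simp
  refine (h1.mul h2).congr_deriv ?_
  rw [relaxFun]
  push_cast at h3 ⊢
  linear_combination (h t) * h3

/-- For `μ < 0` homogeneous solutions grow, and the prescribed initial value cancels the growing
part: what remains of the variation of constants formula is the integral over the future. -/
theorem relaxFun_of_neg (hμ : μ < 0) (t : ℝ) :
    relaxFun μ h t
      = -((Real.exp (-μ * t) : ℂ) * ∫ s in Ioi t, (Real.exp (μ * s) : ℂ) * h s) := by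
  have h1 : ∫ s in Ioi (0 : ℝ), (Real.exp (μ * s) : ℂ) * h s
      = (∫ s in (0 : ℝ)..t, (Real.exp (μ * s) : ℂ) * h s)
        + ∫ s in Ioi t, (Real.exp (μ * s) : ℂ) * h s :=
    (intervalIntegral.integral_interval_add_Ioi (integrableOn_exp_mul μ h hμ 0)
      (integrableOn_exp_mul μ h hμ t)).symm
  rw [relaxFun, relaxInit, if_pos hμ, h1]
  ring

/-- The kernel `e^{-μ(t-s)}` has integral at most `1/|μ|`, taken over the future `s > t` if `μ < 0`
and over the past `0 < s < t` if `μ > 0`. -/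
theorem norm_relaxFun_le (hμ : μ ≠ 0) {t : ℝ} (ht : 0 ≤ t) : ‖relaxFun μ h t‖ ≤ |μ|⁻¹ * ‖h‖ := by
  have hexp : Real.exp (-μ * t) * Real.exp (μ * t) = 1 := by rw [← Real.exp_add]; simp
  rcases lt_or_gt_of_ne hμ with hneg | hpos
  · have h1 : ‖∫ s in Ioi t, (Real.exp (μ * s) : ℂ) * h s‖ ≤ ‖h‖ * (-Real.exp (μ * t) / μ) := by
      rw [← integral_exp_mul_Ioi hneg t, ← integral_const_mul]
      exact norm_integral_le_of_norm_le ((integrableOn_exp_mul_Ioi hneg t).const_mul _)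
        (Eventually.of_forall (norm_exp_mul_le μ h))
    rw [relaxFun_of_neg μ h hneg t, norm_neg, norm_mul, Complex.norm_real, Real.norm_eq_abs,
      Real.abs_exp, abs_of_neg hneg]
    calc _ ≤ Real.exp (-μ * t) * (‖h‖ * (-Real.exp (μ * t) / μ)) := by gcongr
      _ = (Real.exp (-μ * t) * Real.exp (μ * t)) * (‖h‖ * (-μ)⁻¹) := by field_simp
      _ = _ := by rw [hexp]; ring
  · have h2 : ∫ s in (0 : ℝ)..t, Real.exp (μ * s) = (Real.exp (μ * t) - 1) / μ := by
      rw [intervalIntegral.integral_comp_mul_left _ hμ, integral_exp]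
      simp [div_eq_inv_mul]
    have h1 : ‖∫ s in (0 : ℝ)..t, (Real.exp (μ * s) : ℂ) * h s‖
        ≤ ‖h‖ * ((Real.exp (μ * t) - 1) / μ) := by
      rw [← h2, ← intervalIntegral.integral_const_mul]
      exact intervalIntegral.norm_integral_le_of_norm_le ht
        (Eventually.of_forall fun s _ => norm_exp_mul_le μ h s)
        (Continuous.intervalIntegrable (by fun_prop) _ _)
    rw [relaxFun, relaxInit, if_neg hpos.not_gt, zero_add, norm_mul, Complex.norm_real,
      Real.norm_eq_abs, Real.abs_exp, abs_of_pos hpos]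
    calc _ ≤ Real.exp (-μ * t) * (‖h‖ * ((Real.exp (μ * t) - 1) / μ)) := by gcongr
      _ ≤ Real.exp (-μ * t) * (‖h‖ * (Real.exp (μ * t) / μ)) := by gcongr; linarith
      _ = (Real.exp (-μ * t) * Real.exp (μ * t)) * (‖h‖ * μ⁻¹) := by ring
      _ = _ := by rw [hexp]; ring

theorem relaxFun_add (h' : ℝ →ᵇ ℂ) (t : ℝ) :
    relaxFun μ (h + h') t = relaxFun μ h t + relaxFun μ h' t := by
  have h1 : relaxInit μ (h + h') = relaxInit μ h + relaxInit μ h' := by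
    unfold relaxInit
    split_ifs with hμ
    · simp only [BoundedContinuousFunction.coe_add, Pi.add_apply, mul_add]
      rw [integral_add (integrableOn_exp_mul μ h hμ 0) (integrableOn_exp_mul μ h' hμ 0)]
      ring
    · simp
  have h2 : (∫ s in (0 : ℝ)..t, (Real.exp (μ * s) : ℂ) * (h + h') s)
      = (∫ s in (0 : ℝ)..t, (Real.exp (μ * s) : ℂ) * h s)
        + ∫ s in (0 : ℝ)..t, (Real.exp (μ * s) : ℂ) * h' s := by
    rw [← intervalIntegral.integral_add ((continuous_exp_mul μ h).intervalIntegrable _ _)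
      ((continuous_exp_mul μ h').intervalIntegrable _ _)]
    simp only [BoundedContinuousFunction.coe_add, Pi.add_apply, mul_add]
  rw [relaxFun, h1, h2, relaxFun, relaxFun]
  ring

theorem relaxFun_im {h : ℝ →ᵇ ℂ} (hh : ∀ t, (h t).im = 0) (t : ℝ) : (relaxFun μ h t).im = 0 := by
  have h0 : (fun s : ℝ => (Real.exp (μ * s) : ℂ) * h s)
      = fun s : ℝ => ((Real.exp (μ * s) * (h s).re : ℝ) : ℂ) := by
    funext s
    rw [Complex.ofReal_mul]
    congr 1
    exact Complex.ext rfl (by simpa using hh s)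
  rw [relaxFun, relaxInit, h0, intervalIntegral.integral_ofReal, integral_complex_ofReal]
  split_ifs
  · rw [← Complex.ofReal_neg, ← Complex.ofReal_add, ← Complex.ofReal_mul, Complex.ofReal_im]
  · rw [zero_add, ← Complex.ofReal_mul, Complex.ofReal_im]

/-- The operator which solves `w' + μ w = h` on `[0, ∞)` in bounded functions. -/
noncomputable def relax (hμ : μ ≠ 0) : (ℝ →ᵇ ℂ) →+ (ℝ →ᵇ ℂ) :=
  AddMonoidHom.mk' (fun h => BoundedContinuousFunction.ofNormedAddCommGroup
    -- Times before zero carry no information; freezing the value there yields a bounded function on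
    -- the whole line.
    (fun t => relaxFun μ h (max t 0))
    ((continuous_iff_continuousAt.2 fun t => (hasDerivAt_relaxFun μ h t).continuousAt).comp
      (continuous_id.max continuous_const))
    (|μ|⁻¹ * ‖h‖) fun t => norm_relaxFun_le μ h hμ (le_max_right t 0))
    fun h h' => BoundedContinuousFunction.ext fun t => relaxFun_add μ h h' (max t 0)

theorem relax_apply (hμ : μ ≠ 0) (t : ℝ) : relax μ hμ h t = relaxFun μ h (max t 0) := rfl

theorem norm_relax_le (hμ : μ ≠ 0) : ‖relax μ hμ h‖ ≤ |μ|⁻¹ * ‖h‖ :=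
  (BoundedContinuousFunction.norm_le (by positivity)).2 fun t =>
    norm_relaxFun_le μ h hμ (le_max_right t 0)

theorem hasDerivWithinAt_relax (hμ : μ ≠ 0) {t : ℝ} (ht : 0 ≤ t) :
    HasDerivWithinAt (relax μ hμ h) (h t - μ * relax μ hμ h t) (Ici 0) t := by
  rw [relax_apply, max_eq_left ht]
  refine (hasDerivAt_relaxFun μ h t).hasDerivWithinAt.congr (fun s hs => ?_) ?_
  · rw [relax_apply, max_eq_left (mem_Ici.1 hs)]
  · rw [relax_apply, max_eq_left ht]

/-- For `μ > 0` every initial value gives a bounded solution. Spending this freedom on the value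
zero is what later forces the conjugacy to preserve area. -/
theorem relax_zero_of_pos (hμ : 0 < μ) : relax μ hμ.ne' h 0 = 0 := by
  simp [relax_apply, relaxFun, relaxInit, hμ.not_gt]

end Relax

/-! ### The contraction that produces the conjugacy. -/

section FixedPoint

open BoundedContinuousFunction

/-- The power series whose coefficients are real functions of time. -/
def realSubring (σ : Type*) : Subring (Wiener σ (ℝ →ᵇ ℂ)) where
  carrier := {f | ∀ α t, (Wiener.coeff α f t).im = 0}
  mul_mem' {f g} hf hg α t := by
    classical
    rw [← Wiener.coeff_toSeries, map_mul, MvPowerSeries.coeff_mul,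
      BoundedContinuousFunction.coe_sum, Finset.sum_apply, Complex.im_sum]
    refine Finset.sum_eq_zero fun x _ => ?_
    rw [Wiener.coeff_toSeries, Wiener.coeff_toSeries, BoundedContinuousFunction.mul_apply,
      Complex.mul_im, hf, hg]
    simp
  one_mem' α t := by
    classical
    rw [← Wiener.coeff_toSeries, map_one, MvPowerSeries.coeff_one]
    split_ifs <;> simp
  add_mem' {f g} hf hg α t := by
    rw [map_add, BoundedContinuousFunction.add_apply, Complex.add_im, hf, hg, add_zero]
  zero_mem' α t := by simp
  neg_mem' {f} hf α t := by
    rw [map_neg, BoundedContinuousFunction.neg_apply, Complex.neg_im, hf, neg_zero]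

/-- Reality has to survive two limits: the infinite sum in `comp` and the fixed-point iteration. -/
theorem isClosed_realSubring (σ : Type*) : IsClosed (realSubring σ : Set (Wiener σ (ℝ →ᵇ ℂ))) := by
  have : (realSubring σ : Set (Wiener σ (ℝ →ᵇ ℂ)))
      = ⋂ α, ⋂ t, {f | (Wiener.coeff α f t).im = 0} := by
    ext f
    simp only [mem_iInter]
    rfl
  rw [this]
  refine isClosed_iInter fun α => isClosed_iInter fun t => isClosed_eq ?_ continuous_const
  exact Complex.continuous_im.comp
    ((continuous_eval_const t).comp (Wiener.continuous_coeff α))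

theorem monomial_mem_realSubring {σ : Type*} (α : σ →₀ ℕ) {c : ℝ →ᵇ ℂ} (hc : ∀ t, (c t).im = 0) :
    Wiener.monomial α c ∈ realSubring σ := fun β t => by
  classical
  rw [← Wiener.coeff_toSeries]
  change (MvPowerSeries.coeff β (MvPowerSeries.monomial α c) t).im = 0
  rw [MvPowerSeries.coeff_monomial]
  split_ifs
  · exact hc t
  · simp

theorem comp_mem_realSubring {σ : Type*} {ε K : ℝ} {g : ℕ × ℕ → ℝ →ᵇ ℂ}
    {P Q : Wiener σ (ℝ →ᵇ ℂ)} (hg : GeomBound ε K g) (hK : 0 ≤ K) (hK1 : 2 * K < 1)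
    (hP : ‖P‖ ≤ 2) (hQ : ‖Q‖ ≤ 2) (hgr : ∀ β t, (g β t).im = 0) (hPr : P ∈ realSubring σ)
    (hQr : Q ∈ realSubring σ) : comp g P Q ∈ realSubring σ :=
  (isClosed_realSubring σ).mem_of_tendsto (hasSum_comp hg hK hK1 hP hQ)
    (Eventually.of_forall fun _ => sum_mem fun β _ =>
      mul_mem (monomial_mem_realSubring 0 (hgr β)) (mul_mem (pow_mem hPr _) (pow_mem hQr _)))

/-- The rate of the mode `α` in the linear part of the conjugacy equation, shifted by `-a`. -/
noncomputable def rate (ω a : ℝ) (j : ℤ) (α : Fin 2 →₀ ℕ) : ℝ :=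
  ω * ((α 1 : ℤ) - (α 0 : ℤ) + j : ℤ) - a

/-- The rates lie in `ωℤ - a`, and `0 < a ≤ ω/2` makes zero the nearest multiple of `ω` to `a`. So
there are no small divisors, and the resonant modes are inverted with loss exactly `1/a`. -/
theorem le_abs_rate {ω a : ℝ} (ha : 0 < a) (haω : a ≤ ω / 2) (j : ℤ) (α : Fin 2 →₀ ℕ) :
    a ≤ |rate ω a j α| := by
  unfold rate
  generalize (α 1 : ℤ) - (α 0 : ℤ) + j = n
  rcases le_or_gt n 0 with hn | hn
  · have : (n : ℝ) ≤ 0 := by exact_mod_cast hn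
    exact le_abs.2 (Or.inr (by nlinarith))
  · have : (1 : ℝ) ≤ n := by exact_mod_cast hn
    exact le_abs.2 (Or.inl (by nlinarith))

theorem rate_ne_zero {ω a : ℝ} (ha : 0 < a) (haω : a ≤ ω / 2) (j : ℤ) (α : Fin 2 →₀ ℕ) :
    rate ω a j α ≠ 0 :=
  abs_pos.1 (ha.trans_le (le_abs_rate ha haω j α))

/-- The solution operator of the linear part of the conjugacy equation. -/
noncomputable def solve {ω a : ℝ} (ha : 0 < a) (haω : a ≤ ω / 2) (j : ℤ) :
    Wiener (Fin 2) (ℝ →ᵇ ℂ) →+ Wiener (Fin 2) (ℝ →ᵇ ℂ) :=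
  Wiener.diag (fun α => relax (rate ω a j α) (rate_ne_zero ha haω j α)) a⁻¹ fun α c =>
    (norm_relax_le _ _ _).trans (by gcongr; exact le_abs_rate ha haω j α)

theorem coeff_solve {ω a : ℝ} (ha : 0 < a) (haω : a ≤ ω / 2) (j : ℤ)
    (f : Wiener (Fin 2) (ℝ →ᵇ ℂ)) (α : Fin 2 →₀ ℕ) :
    Wiener.coeff α (solve ha haω j f)
      = relax (rate ω a j α) (rate_ne_zero ha haω j α) (Wiener.coeff α f) := rfl

theorem norm_solve_le {ω a : ℝ} (ha : 0 < a) (haω : a ≤ ω / 2) (j : ℤ)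
    (f : Wiener (Fin 2) (ℝ →ᵇ ℂ)) : ‖solve ha haω j f‖ ≤ a⁻¹ * ‖f‖ :=
  Wiener.norm_diag_le _ _ _ f

theorem solve_mem_realSubring {ω a : ℝ} (ha : 0 < a) (haω : a ≤ ω / 2) (j : ℤ)
    {f : Wiener (Fin 2) (ℝ →ᵇ ℂ)} (hf : f ∈ realSubring (Fin 2)) :
    solve ha haω j f ∈ realSubring (Fin 2) := fun α t => by
  rw [coeff_solve, relax_apply]
  exact relaxFun_im _ (hf α) _

/-- The near-identity component `Xᵢ + e W` of the conjugacy. -/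
noncomputable def nearX (e : ℝ →ᵇ ℂ) (i : Fin 2) (W : Wiener (Fin 2) (ℝ →ᵇ ℂ)) :
    Wiener (Fin 2) (ℝ →ᵇ ℂ) := Wiener.X i + Wiener.const e * W

theorem norm_const_mul_le {e : ℝ →ᵇ ℂ} (he : ‖e‖ ≤ 1) (W : Wiener (Fin 2) (ℝ →ᵇ ℂ)) :
    ‖Wiener.const e * W‖ ≤ ‖W‖ :=
  (norm_mul_le _ _).trans (by
    rw [Wiener.norm_const]; exact mul_le_of_le_one_left (norm_nonneg _) he)

theorem norm_nearX_le {e : ℝ →ᵇ ℂ} (he : ‖e‖ ≤ 1) (i : Fin 2) {W : Wiener (Fin 2) (ℝ →ᵇ ℂ)}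
    (hW : ‖W‖ ≤ 1 / 4) : ‖nearX e i W‖ ≤ 2 := by
  refine (norm_add_le _ _).trans ?_
  rw [Wiener.norm_X]
  linarith [norm_const_mul_le he W]

theorem norm_nearX_sub_le {e : ℝ →ᵇ ℂ} (he : ‖e‖ ≤ 1) (i : Fin 2)
    (W W' : Wiener (Fin 2) (ℝ →ᵇ ℂ)) : ‖nearX e i W - nearX e i W'‖ ≤ ‖W - W'‖ := by
  have : nearX e i W - nearX e i W' = Wiener.const e * (W - W') := by unfold nearX; ring
  rw [this]
  exact norm_const_mul_le he _

theorem nearX_mem_realSubring {e : ℝ →ᵇ ℂ} (her : ∀ t, (e t).im = 0) (i : Fin 2)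
    {W : Wiener (Fin 2) (ℝ →ᵇ ℂ)} (hW : W ∈ realSubring (Fin 2)) :
    nearX e i W ∈ realSubring (Fin 2) :=
  add_mem (monomial_mem_realSubring _ fun t => by simp)
    (mul_mem (monomial_mem_realSubring 0 her) hW)

/-- When `e` is the weight `e^{-at}`, substituting `P = X₀ + eW`, `Q = X₁ + eV` in the conjugacy
equations and cancelling `e` gives the two fixed-point equations for `(W, V)`. The indices `1` and
`-1` come from the terms `ωP` and `-ωQ` on the left-hand side. -/
theorem exists_conjugacy {ω a ε : ℝ} (ha : 0 < a) (haω : a ≤ ω / 2) (hε : 0 ≤ ε)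
    (hεa : ε ≤ a / 8) {f : ℕ × ℕ → ℝ →ᵇ ℂ} (hf : GeomBound ε (1 / 16) f) {e : ℝ →ᵇ ℂ}
    (he : ‖e‖ ≤ 1) (her : ∀ t, (e t).im = 0) :
    ∃ W V : Wiener (Fin 2) (ℝ →ᵇ ℂ), ‖W‖ ≤ 1 / 4 ∧ ‖V‖ ≤ 1 / 4 ∧
      solve ha haω 1 (-comp (shiftSnd f) (nearX e 0 W) (nearX e 1 V)) = W ∧
      solve ha haω (-1) (comp (shiftFst f) (nearX e 0 W) (nearX e 1 V)) = V ∧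
      ((∀ β t, (f β t).im = 0) → W ∈ realSubring (Fin 2) ∧ V ∈ realSubring (Fin 2)) := by
  have hf1 : GeomBound ε (1 / 8) (shiftFst f) := by
    have h := hf.shiftFst hε (by norm_num) (by norm_num)
    rwa [show (2 * (1 / 16) : ℝ) = 1 / 8 by norm_num] at h
  have hf2 : GeomBound ε (1 / 8) (shiftSnd f) := by
    have h := hf.shiftSnd hε (by norm_num) (by norm_num)
    rwa [show (2 * (1 / 16) : ℝ) = 1 / 8 by norm_num] at h
  let N : Wiener (Fin 2) (ℝ →ᵇ ℂ) × Wiener (Fin 2) (ℝ →ᵇ ℂ) →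
      Wiener (Fin 2) (ℝ →ᵇ ℂ) × Wiener (Fin 2) (ℝ →ᵇ ℂ) := fun w =>
    (solve ha haω 1 (-comp (shiftSnd f) (nearX e 0 w.1) (nearX e 1 w.2)),
      solve ha haω (-1) (comp (shiftFst f) (nearX e 0 w.1) (nearX e 1 w.2)))
  -- Reality is built into the domain as a conditional clause, so the same fixed point serves the
  -- complex and the real statements.
  let s : Set (Wiener (Fin 2) (ℝ →ᵇ ℂ) × Wiener (Fin 2) (ℝ →ᵇ ℂ)) :=
    {w | (‖w.1‖ ≤ 1 / 4 ∧ ‖w.2‖ ≤ 1 / 4) ∧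
      ((∀ β t, (f β t).im = 0) → w.1 ∈ realSubring (Fin 2) ∧ w.2 ∈ realSubring (Fin 2))}
  have hs : IsClosed s := by
    refine IsClosed.inter ((isClosed_le continuous_fst.norm continuous_const).inter
      (isClosed_le continuous_snd.norm continuous_const)) ?_
    by_cases hr : ∀ β t, (f β t).im = 0
    · have : {w : Wiener (Fin 2) (ℝ →ᵇ ℂ) × Wiener (Fin 2) (ℝ →ᵇ ℂ) |
          (∀ β t, (f β t).im = 0) → w.1 ∈ realSubring (Fin 2) ∧ w.2 ∈ realSubring (Fin 2)}
          = {w | w.1 ∈ realSubring (Fin 2) ∧ w.2 ∈ realSubring (Fin 2)} := by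
        ext w; exact ⟨fun h => h hr, fun h _ => h⟩
      change IsClosed {w : Wiener (Fin 2) (ℝ →ᵇ ℂ) × Wiener (Fin 2) (ℝ →ᵇ ℂ) |
          (∀ β t, (f β t).im = 0) → w.1 ∈ realSubring (Fin 2) ∧ w.2 ∈ realSubring (Fin 2)}
      rw [this]
      exact ((isClosed_realSubring _).preimage continuous_fst).inter
        ((isClosed_realSubring _).preimage continuous_snd)
    · have : {w : Wiener (Fin 2) (ℝ →ᵇ ℂ) × Wiener (Fin 2) (ℝ →ᵇ ℂ) |
          (∀ β t, (f β t).im = 0) → w.1 ∈ realSubring (Fin 2) ∧ w.2 ∈ realSubring (Fin 2)}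
          = univ := by
        ext w; exact ⟨fun _ => trivial, fun _ h => absurd h hr⟩
      change IsClosed {w : Wiener (Fin 2) (ℝ →ᵇ ℂ) × Wiener (Fin 2) (ℝ →ᵇ ℂ) |
          (∀ β t, (f β t).im = 0) → w.1 ∈ realSubring (Fin 2) ∧ w.2 ∈ realSubring (Fin 2)}
      rw [this]
      exact isClosed_univ
  -- Budget at ratio `K = 1/8`: the bound `(1 - 2K)⁻² = 16/9 ≤ 2` keeps the ball of radius `1/8 * 2
  -- = 1/4` invariant, and `(1 - 4K)⁻² = 4` gives the Lipschitz constant `1/8 * 4 = 1/2`.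
  have ha' : a⁻¹ * (a / 8) = 1 / 8 := by field_simp
  have hmaps : MapsTo N s s := by
    rintro ⟨W, V⟩ ⟨⟨hW, hV⟩, hr⟩
    have hP := norm_nearX_le he 0 hW
    have hQ := norm_nearX_le he 1 hV
    have key : ∀ {g}, GeomBound ε (1 / 8) g →
        a⁻¹ * ‖comp g (nearX e 0 W) (nearX e 1 V)‖ ≤ 1 / 4 := fun {g} hg => by
      have h1 := norm_comp_le hg (by norm_num) (by norm_num) hP hQ
      calc _ ≤ a⁻¹ * (a / 8 * 2) := by
            gcongr
            refine h1.trans ?_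
            gcongr
            norm_num
        _ ≤ 1 / 4 := by rw [← mul_assoc, ha']; norm_num
    refine ⟨⟨?_, ?_⟩, fun h => ?_⟩
    · refine (norm_solve_le _ _ _ _).trans ?_
      rw [norm_neg]
      exact key hf2
    · exact (norm_solve_le _ _ _ _).trans (key hf1)
    · have hPr := nearX_mem_realSubring her 0 (hr h).1
      have hQr := nearX_mem_realSubring her 1 (hr h).2
      refine ⟨solve_mem_realSubring _ _ _ (neg_mem ?_), solve_mem_realSubring _ _ _ ?_⟩
      · refine comp_mem_realSubring hf2 (by norm_num) (by norm_num) hP hQ (fun β t => ?_) hPr hQr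
        simp [shiftSnd, h, Complex.mul_im]
      · refine comp_mem_realSubring hf1 (by norm_num) (by norm_num) hP hQ (fun β t => ?_) hPr hQr
        simp [shiftFst, h, Complex.mul_im]
  have hlip : ∀ w ∈ s, ∀ w' ∈ s, ‖N w - N w'‖ ≤ 1 / 2 * ‖w - w'‖ := by
    rintro ⟨W, V⟩ ⟨⟨hW, hV⟩, -⟩ ⟨W', V'⟩ ⟨⟨hW', hV'⟩, -⟩
    have key : ∀ {g}, GeomBound ε (1 / 8) g →
        a⁻¹ * ‖comp g (nearX e 0 W) (nearX e 1 V) - comp g (nearX e 0 W') (nearX e 1 V')‖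
          ≤ 1 / 2 * ‖((W, V) : _ × _) - (W', V')‖ := fun {g} hg => by
      have h1 := norm_comp_sub_le hg (by norm_num) (by norm_num) (norm_nearX_le he 0 hW)
        (norm_nearX_le he 0 hW') (norm_nearX_le he 1 hV) (norm_nearX_le he 1 hV')
        ((norm_nearX_sub_le he 0 W W').trans (norm_fst_le (((W, V) : _ × _) - (W', V'))))
        ((norm_nearX_sub_le he 1 V V').trans (norm_snd_le (((W, V) : _ × _) - (W', V'))))
      calc _ ≤ a⁻¹ * (a / 8 * 4 * ‖((W, V) : _ × _) - (W', V')‖) := by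
            gcongr
            refine h1.trans ?_
            gcongr
            norm_num
        _ = a⁻¹ * (a / 8) * (4 * ‖((W, V) : _ × _) - (W', V')‖) := by ring
        _ = _ := by rw [ha']; ring
    refine max_le ?_ ?_
    · change ‖solve ha haω 1 _ - solve ha haω 1 _‖ ≤ _
      rw [← map_sub]
      refine (norm_solve_le _ _ _ _).trans ?_
      rw [neg_sub_neg, norm_sub_rev]
      exact key hf2
    · change ‖solve ha haω (-1) _ - solve ha haω (-1) _‖ ≤ _
      rw [← map_sub]
      exact (norm_solve_le _ _ _ _).trans (key hf1)
  have hcontr : ContractingWith (1 / 2) (hmaps.restrict N s s) := by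
    refine ⟨by rw [← NNReal.coe_lt_coe]; norm_num, LipschitzWith.of_dist_le_mul fun x y => ?_⟩
    rw [Subtype.dist_eq, Subtype.dist_eq, dist_eq_norm, dist_eq_norm]
    simpa using hlip x x.2 y y.2
  have h0 : (0 : Wiener (Fin 2) (ℝ →ᵇ ℂ) × Wiener (Fin 2) (ℝ →ᵇ ℂ)) ∈ s :=
    ⟨by simp, fun _ => ⟨zero_mem _, zero_mem _⟩⟩
  obtain ⟨⟨W, V⟩, ⟨⟨hW, hV⟩, hr⟩, hfix, -⟩ :=
    hcontr.exists_fixedPoint' hs.isComplete hmaps h0 (edist_ne_top _ _)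
  exact ⟨W, V, hW, hV, congrArg Prod.fst hfix, congrArg Prod.snd hfix, hr⟩

end FixedPoint

/-! ### The chain rule for formal derivatives of compositions. -/

section ChainRule

open scoped MvPowerSeries.WithPiTopology

variable {σ C : Type*} [NormedCommRing C]

/-- Differentiation is not bounded in the Wiener norm, but in the coefficientwise topology each
output coefficient depends on only one input coefficient. Convergent series can therefore be
differentiated termwise after passing to that weaker topology. -/
theorem continuous_pderiv (i : σ) :
    Continuous (MvPowerSeries.pderiv C i : MvPowerSeries σ C → MvPowerSeries σ C) := by
  refine continuous_pi fun α => ?_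
  have : Continuous fun f : MvPowerSeries σ C =>
      MvPowerSeries.coeff (α + Finsupp.single i 1) f * ((α i : C) + 1) :=
    (MvPowerSeries.WithPiTopology.continuous_coeff C _).mul continuous_const
  exact this.congr fun f => (MvPowerSeries.coeff_pderiv f α).symm

theorem Wiener.continuous_toSeries :
    Continuous (Wiener.toSeries : Wiener σ C → MvPowerSeries σ C) :=
  continuous_pi fun α => Wiener.continuous_coeff α

variable [NormOneClass C] [CompleteSpace C] {ε K : ℝ} {g : ℕ × ℕ → C} {P Q : Wiener σ C}

theorem hasSum_toSeries_comp (hg : GeomBound ε K g) (hK : 0 ≤ K) (hK1 : 2 * K < 1)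
    (hP : ‖P‖ ≤ 2) (hQ : ‖Q‖ ≤ 2) :
    HasSum (fun β : ℕ × ℕ => MvPowerSeries.C (g β) * (P.toSeries ^ β.1 * Q.toSeries ^ β.2))
      (comp g P Q).toSeries := by
  have h := (hasSum_comp hg hK hK1 hP hQ).map Wiener.toSeries Wiener.continuous_toSeries
  refine h.congr_fun fun β => ?_
  simp [compTerm, Wiener.toSeries_const]

theorem pderiv_comp (hε : 0 ≤ ε) (hg : GeomBound ε K g) (hK : 0 ≤ K) (hK1 : 4 * K < 1)
    (hP : ‖P‖ ≤ 2) (hQ : ‖Q‖ ≤ 2) (i : σ) :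
    MvPowerSeries.pderiv C i (comp g P Q).toSeries
      = (comp (shiftFst g) P Q).toSeries * MvPowerSeries.pderiv C i P.toSeries
        + (comp (shiftSnd g) P Q).toSeries * MvPowerSeries.pderiv C i Q.toSeries := by
  have h0 := (hasSum_toSeries_comp hg hK (by linarith) hP hQ).map (MvPowerSeries.pderiv C i)
    (continuous_pderiv i)
  -- The truncated exponent `β.1 - 1` is harmless: at `β.1 = 0` the factor `β.1` kills the term, so
  -- the sum may be reindexed by the shift `β.1 + 1`.
  have h1 : HasSum (fun β : ℕ × ℕ => MvPowerSeries.C (g β) *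
      ((β.1 : MvPowerSeries σ C) * P.toSeries ^ (β.1 - 1) * Q.toSeries ^ β.2))
      (comp (shiftFst g) P Q).toSeries := by
    have h := hasSum_toSeries_comp (hg.shiftFst hε hK (by linarith)) (by linarith)
      (by linarith) hP hQ
    have hinj : Function.Injective fun β : ℕ × ℕ => (β.1 + 1, β.2) := fun x y hxy => by
      simp only [Prod.mk.injEq, add_left_inj] at hxy
      exact Prod.ext hxy.1 hxy.2
    refine (hinj.hasSum_iff fun β hβ => ?_).1 (h.congr_fun fun β => ?_)
    · rcases β with ⟨_ | m, n⟩
      · simp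
      · exact absurd ⟨(m, n), rfl⟩ hβ
    · simp only [shiftFst, map_mul, map_natCast, Function.comp, add_tsub_cancel_right]
      ring
  have h2 : HasSum (fun β : ℕ × ℕ => MvPowerSeries.C (g β) *
      ((β.2 : MvPowerSeries σ C) * Q.toSeries ^ (β.2 - 1) * P.toSeries ^ β.1))
      (comp (shiftSnd g) P Q).toSeries := by
    have h := hasSum_toSeries_comp (hg.shiftSnd hε hK (by linarith)) (by linarith)
      (by linarith) hP hQ
    have hinj : Function.Injective fun β : ℕ × ℕ => (β.1, β.2 + 1) := fun x y hxy => by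
      simp only [Prod.mk.injEq, add_left_inj] at hxy
      exact Prod.ext hxy.1 hxy.2
    refine (hinj.hasSum_iff fun β hβ => ?_).1 (h.congr_fun fun β => ?_)
    · rcases β with ⟨m, _ | n⟩
      · simp
      · exact absurd ⟨(m, n), rfl⟩ hβ
    · simp only [shiftSnd, map_mul, map_natCast, Function.comp, add_tsub_cancel_right]
      ring
  refine h0.unique (((h1.mul_right _).add (h2.mul_right _)).congr_fun fun β => ?_)
  simp only [Function.comp, Derivation.leibniz, Derivation.leibniz_pow, smul_eq_mul,
    MvPowerSeries.pderiv_C, nsmul_eq_mul]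
  ring

end ChainRule

/-- The mixed derivative `F_pq` has to be one and the same series in the equations for `P` and for
`Q`: this is the trace-zero property behind area preservation. -/
theorem shiftSnd_shiftFst {C : Type*} [CommRing C] (g : ℕ × ℕ → C) :
    shiftSnd (shiftFst g) = shiftFst (shiftSnd g) := by
  funext β
  simp only [shiftFst, shiftSnd]
  ring

theorem pderiv_comm {σ C : Type*} [CommRing C] (i j : σ) (f : MvPowerSeries σ C) :
    MvPowerSeries.pderiv C i (MvPowerSeries.pderiv C j f)
      = MvPowerSeries.pderiv C j (MvPowerSeries.pderiv C i f) := by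
  classical
  ext α
  simp only [MvPowerSeries.coeff_pderiv, Finsupp.add_apply, Finsupp.single_apply]
  rw [add_right_comm]
  by_cases h : i = j
  · subst h; rfl
  · rw [if_neg h, if_neg (Ne.symm h)]
    push_cast
    ring

/-! ### Formal series in time, and transport of the Jacobian along the saddle. -/

section Transport

/-- Power series in two variables whose coefficients are bounded functions of time. -/
abbrev TimeSeries : Type := MvPowerSeries (Fin 2) (BoundedContinuousFunction ℝ ℂ)

namespace TimeSeries

open BoundedContinuousFunction

/-- The coefficients of `g` are the derivatives of the coefficients of `f` on `[0, ∞)`. -/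
def HasTimeDeriv (f g : TimeSeries) : Prop :=
  ∀ α, ∀ t, 0 ≤ t →
    HasDerivWithinAt (fun s => MvPowerSeries.coeff α f s) (MvPowerSeries.coeff α g t) (Ici 0) t

/-- The formal partial derivatives. -/
noncomputable abbrev D (i : Fin 2) :
    Derivation (ℝ →ᵇ ℂ) TimeSeries TimeSeries := MvPowerSeries.pderiv (ℝ →ᵇ ℂ) i

/-- The derivative along the linear saddle `q ∂_q - p ∂_p`. -/
noncomputable def saddle (f : TimeSeries) : TimeSeries :=
  MvPowerSeries.X 1 * D 1 f - MvPowerSeries.X 0 * D 0 f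

variable {f g f' g' : TimeSeries}

theorem coeff_D (i : Fin 2) (f : TimeSeries) (α : Fin 2 →₀ ℕ) (t : ℝ) :
    MvPowerSeries.coeff α (D i f) t
      = MvPowerSeries.coeff (α + Finsupp.single i 1) f t * ((α i : ℂ) + 1) := by
  rw [D, MvPowerSeries.coeff_pderiv]
  simp

theorem coeff_mul_apply (f g : TimeSeries) (α : Fin 2 →₀ ℕ) (t : ℝ) :
    MvPowerSeries.coeff α (f * g) t = ∑ x ∈ Finset.HasAntidiagonal.antidiagonal α,
      MvPowerSeries.coeff x.1 f t * MvPowerSeries.coeff x.2 g t := by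
  classical
  rw [MvPowerSeries.coeff_mul, BoundedContinuousFunction.coe_sum, Finset.sum_apply]
  rfl

theorem coeff_X_mul_D (i : Fin 2) (f : TimeSeries) (α : Fin 2 →₀ ℕ) :
    MvPowerSeries.coeff α (MvPowerSeries.X i * D i f) = (α i : ℕ) * MvPowerSeries.coeff α f := by
  classical
  rw [MvPowerSeries.X, MvPowerSeries.coeff_monomial_mul]
  split_ifs with h
  · have h1 : 1 ≤ α i := by simpa using h i
    rw [one_mul, D, MvPowerSeries.coeff_pderiv, tsub_add_cancel_of_le h, mul_comm]
    congr 1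
    rw [Finsupp.tsub_apply, Finsupp.single_eq_same, Nat.cast_sub h1]
    simp
  · have h1 : α i = 0 := by
      by_contra h2
      exact h (Finsupp.single_le_iff.2 (Nat.one_le_iff_ne_zero.2 h2))
    simp [h1]

/-- Monomials are eigenvectors of the saddle, with eigenvalue the `q` exponent minus the `p`
exponent. This decouples the linear equations into scalar ones and gives the grading used in
`InitDegreeLE`. -/
theorem coeff_saddle (f : TimeSeries) (α : Fin 2 →₀ ℕ) (t : ℝ) :
    MvPowerSeries.coeff α (saddle f) t
      = ((α 1 : ℂ) - (α 0 : ℂ)) * MvPowerSeries.coeff α f t := by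
  rw [saddle, map_sub, coeff_X_mul_D, coeff_X_mul_D]
  simp [sub_mul]

theorem HasTimeDeriv.add (hf : HasTimeDeriv f f') (hg : HasTimeDeriv g g') :
    HasTimeDeriv (f + g) (f' + g') := fun α t ht => by
  rw [map_add, map_add]
  exact (hf α t ht).add (hg α t ht)

theorem HasTimeDeriv.sub (hf : HasTimeDeriv f f') (hg : HasTimeDeriv g g') :
    HasTimeDeriv (f - g) (f' - g') := fun α t ht => by
  rw [map_sub, map_sub]
  exact (hf α t ht).sub (hg α t ht)

theorem HasTimeDeriv.mul (hf : HasTimeDeriv f f') (hg : HasTimeDeriv g g') :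
    HasTimeDeriv (f * g) (f' * g + f * g') := fun α t ht => by
  have h : HasDerivWithinAt (fun s => ∑ x ∈ Finset.HasAntidiagonal.antidiagonal α,
      MvPowerSeries.coeff x.1 f s * MvPowerSeries.coeff x.2 g s)
      (∑ x ∈ Finset.HasAntidiagonal.antidiagonal α,
        (MvPowerSeries.coeff x.1 f' t * MvPowerSeries.coeff x.2 g t
          + MvPowerSeries.coeff x.1 f t * MvPowerSeries.coeff x.2 g' t)) (Ici 0) t :=
    HasDerivWithinAt.fun_sum fun x _ => (hf x.1 t ht).mul (hg x.2 t ht)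
  rw [map_add, BoundedContinuousFunction.add_apply, coeff_mul_apply, coeff_mul_apply,
    ← Finset.sum_add_distrib]
  exact h.congr (fun s _ => coeff_mul_apply f g α s) (coeff_mul_apply f g α t)

theorem HasTimeDeriv.D (i : Fin 2) (hf : HasTimeDeriv f f') :
    HasTimeDeriv (D i f) (D i f') := fun α t ht => by
  rw [coeff_D]
  exact ((hf _ t ht).mul_const ((α i : ℂ) + 1)).congr (fun s _ => coeff_D i f α s)
    (coeff_D i f α t)

theorem hasTimeDeriv_monomial_one (β : Fin 2 →₀ ℕ) :
    HasTimeDeriv (MvPowerSeries.monomial β 1) 0 := fun α t ht => by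
  classical
  rw [MvPowerSeries.coeff_monomial]
  split_ifs
  · exact hasDerivWithinAt_const t _ (1 : ℂ)
  · exact hasDerivWithinAt_const t _ (0 : ℂ)

/-- The coefficients tend to zero as time goes to infinity. -/
def Decays (f : TimeSeries) : Prop :=
  ∀ α, Tendsto (fun s => MvPowerSeries.coeff α f s) atTop (𝓝 0)

theorem Decays.add (hf : Decays f) (hg : Decays g) : Decays (f + g) := fun α => by
  rw [map_add]
  simpa using (hf α).add (hg α)

theorem Decays.sub (hf : Decays f) (hg : Decays g) : Decays (f - g) := fun α => by
  rw [map_sub]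
  simpa using (hf α).sub (hg α)

theorem Decays.mul_right (hf : Decays f) (g : TimeSeries) : Decays (f * g) := fun α => by
  have h : Tendsto (fun s => ∑ x ∈ Finset.HasAntidiagonal.antidiagonal α,
      MvPowerSeries.coeff x.1 f s * MvPowerSeries.coeff x.2 g s) atTop
      (𝓝 (∑ x ∈ Finset.HasAntidiagonal.antidiagonal α, 0)) := by
    refine tendsto_finsetSum _ fun x _ => ?_
    refine (hf x.1).zero_mul_isBoundedUnder_le
      ⟨‖MvPowerSeries.coeff x.2 g‖, eventually_map.2 (Eventually.of_forall fun s => ?_)⟩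
    exact BoundedContinuousFunction.norm_coe_le_norm _ s
  rw [Finset.sum_const_zero] at h
  exact h.congr fun s => (coeff_mul_apply f g α s).symm

theorem Decays.D (i : Fin 2) (hf : Decays f) : Decays (D i f) := fun α => by
  have h := (hf (α + Finsupp.single i 1)).mul_const ((α i : ℂ) + 1)
  rw [zero_mul] at h
  exact h.congr fun s => (coeff_D i f α s).symm

/-- At time zero, only monomials `p^i q^j` with `j - i ≤ k` occur. -/
def InitDegreeLE (k : ℤ) (f : TimeSeries) : Prop :=
  ∀ α : Fin 2 →₀ ℕ, k < (α 1 : ℤ) - α 0 → MvPowerSeries.coeff α f 0 = 0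

theorem InitDegreeLE.add {k : ℤ} (hf : InitDegreeLE k f) (hg : InitDegreeLE k g) :
    InitDegreeLE k (f + g) := fun α hα => by
  rw [map_add, BoundedContinuousFunction.add_apply, hf α hα, hg α hα, add_zero]

theorem InitDegreeLE.sub {k : ℤ} (hf : InitDegreeLE k f) (hg : InitDegreeLE k g) :
    InitDegreeLE k (f - g) := fun α hα => by
  rw [map_sub, BoundedContinuousFunction.sub_apply, hf α hα, hg α hα, sub_zero]

theorem InitDegreeLE.mul {k l : ℤ} (hf : InitDegreeLE k f) (hg : InitDegreeLE l g) :
    InitDegreeLE (k + l) (f * g) := fun α hα => by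
  rw [coeff_mul_apply]
  refine Finset.sum_eq_zero fun x hx => ?_
  have hx' := Finset.HasAntidiagonal.mem_antidiagonal.1 hx
  have h0 := DFunLike.congr_fun hx' 0
  have h1 := DFunLike.congr_fun hx' 1
  simp only [Finsupp.add_apply] at h0 h1
  by_cases hk : k < (x.1 1 : ℤ) - x.1 0
  · rw [hf _ hk, zero_mul]
  · rw [hg _ (by omega), mul_zero]

theorem InitDegreeLE.D_zero {k : ℤ} (hf : InitDegreeLE k f) : InitDegreeLE (k + 1) (D 0 f) :=
  fun α hα => by
    rw [coeff_D, hf, zero_mul]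
    simp
    omega

theorem InitDegreeLE.D_one {k : ℤ} (hf : InitDegreeLE k f) : InitDegreeLE (k - 1) (D 1 f) :=
  fun α hα => by
    rw [coeff_D, hf, zero_mul]
    simp
    omega

theorem eq_mul_exp_of_hasDerivWithinAt {c : ℝ} {y : ℝ → ℂ}
    (hy : ∀ t, 0 ≤ t → HasDerivWithinAt y (-(c * y t)) (Ici 0) t) {t : ℝ} (ht : 0 ≤ t) :
    y 0 = Real.exp (c * t) * y t := by
  have hexp : ∀ s : ℝ, HasDerivAt (fun s : ℝ => (Real.exp (c * s) : ℂ))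
      ((Real.exp (c * s) * c : ℝ) : ℂ) s := fun s => by
    have := ((hasDerivAt_id s).const_mul c).exp
    simpa using this.ofReal_comp
  have hz : ∀ s, 0 ≤ s →
      HasDerivWithinAt (fun s => (Real.exp (c * s) : ℂ) * y s) 0 (Ici 0) s := fun s hs => by
    refine ((hexp s).hasDerivWithinAt.mul (hy s hs)).congr_deriv ?_
    push_cast
    ring
  have h := constant_of_has_deriv_right_zero (a := 0) (b := t)
    (f := fun s => (Real.exp (c * s) : ℂ) * y s)
    (fun s hs => ((hz s hs.1).continuousWithinAt).mono fun x hx => hx.1)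
    (fun s hs => (hz s hs.1).mono fun x hx => hs.1.trans hx) t ⟨ht, le_rfl⟩
  simpa using h.symm

/-- A solution of the linear transport equation along the saddle which decays in time and starts
with modes of nonpositive degree vanishes. -/
theorem eq_zero_of_hasTimeDeriv_saddle {ω : ℝ} (hω : 0 < ω)
    (hf : HasTimeDeriv f (-(MvPowerSeries.C (BoundedContinuousFunction.const ℝ (ω : ℂ)) *
      saddle f))) (hdec : Decays f) (hinit : InitDegreeLE 0 f) {α : Fin 2 →₀ ℕ} {t : ℝ}
    (ht : 0 ≤ t) : MvPowerSeries.coeff α f t = 0 := by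
  have hode : ∀ s, 0 ≤ s → HasDerivWithinAt (fun s => MvPowerSeries.coeff α f s)
      (-((ω * ((α 1 : ℝ) - α 0) : ℝ) * MvPowerSeries.coeff α f s)) (Ici 0) s := fun s hs => by
    refine (hf α s hs).congr_deriv ?_
    rw [map_neg, MvPowerSeries.coeff_C_mul, BoundedContinuousFunction.neg_apply,
      BoundedContinuousFunction.mul_apply, coeff_saddle, BoundedContinuousFunction.const_apply]
    push_cast
    ring
  have h0 : MvPowerSeries.coeff α f 0 = 0 := by
    -- The mode is a multiple of `e^{-ωκt}` with `κ = α 1 - α 0`. For `κ > 0` it starts at zero; for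
    -- `κ ≤ 0` its modulus never drops below the initial one, so decay forces it to be zero.
    by_cases hα : (0 : ℤ) < (α 1 : ℤ) - α 0
    · exact hinit α hα
    · have hκ : (α 1 : ℝ) - α 0 ≤ 0 := by
        have : (α 1 : ℤ) ≤ α 0 := by omega
        have : (α 1 : ℝ) ≤ α 0 := by exact_mod_cast this
        linarith
      have hle : ∀ s, 0 ≤ s →
          ‖MvPowerSeries.coeff α f 0‖ ≤ ‖MvPowerSeries.coeff α f s‖ := fun s hs => by
        rw [eq_mul_exp_of_hasDerivWithinAt hode hs, norm_mul, Complex.norm_real,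
          Real.norm_eq_abs, Real.abs_exp]
        refine mul_le_of_le_one_left (norm_nonneg _) (Real.exp_le_one_iff.2 ?_)
        exact mul_nonpos_of_nonpos_of_nonneg (mul_nonpos_of_nonneg_of_nonpos hω.le hκ) hs
      have hlim := (hdec α).norm
      rw [norm_zero] at hlim
      exact norm_le_zero_iff.1 (ge_of_tendsto hlim ((eventually_ge_atTop 0).mono hle))
  have h1 := eq_mul_exp_of_hasDerivWithinAt hode ht
  rw [h0] at h1
  exact (mul_eq_zero.1 h1.symm).resolve_left
    (Complex.ofReal_ne_zero.2 (Real.exp_pos _).ne')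

/-- The Jacobian determinant. -/
noncomputable def jac (P Q : TimeSeries) : TimeSeries := D 0 P * D 1 Q - D 1 P * D 0 Q

/-- The Jacobian of a conjugacy between Hamiltonian vector fields is transported
along the saddle. -/
theorem hasTimeDeriv_jac {P Q A B App Apq Bqq : TimeSeries} {w : ℝ →ᵇ ℂ}
    (hP : HasTimeDeriv P (-(MvPowerSeries.C w * saddle P) - MvPowerSeries.C w * P - B))
    (hQ : HasTimeDeriv Q (-(MvPowerSeries.C w * saddle Q) + MvPowerSeries.C w * Q + A))
    (hA : ∀ i, D i A = App * D i P + Apq * D i Q)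
    (hB : ∀ i, D i B = Apq * D i P + Bqq * D i Q) :
    HasTimeDeriv (jac P Q) (-(MvPowerSeries.C w * saddle (jac P Q))) := by
  have h := ((hP.D 0).mul (hQ.D 1)).sub ((hP.D 1).mul (hQ.D 0))
  convert! h using 1
  have hX10 : D 1 (MvPowerSeries.X 0) = 0 := MvPowerSeries.pderiv_X_of_ne (by decide)
  have hX01 : D 0 (MvPowerSeries.X 1) = 0 := MvPowerSeries.pderiv_X_of_ne (by decide)
  have hX00 : D 0 (MvPowerSeries.X 0) = 1 := MvPowerSeries.pderiv_X_self
  have hX11 : D 1 (MvPowerSeries.X 1) = 1 := MvPowerSeries.pderiv_X_self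
  have hC : ∀ i, D i (MvPowerSeries.C w) = 0 := fun i => MvPowerSeries.pderiv_C
  have hc : ∀ f : TimeSeries, D 1 (D 0 f) = D 0 (D 1 f) := fun f => pderiv_comm 1 0 f
  -- The commutators of `D 0` and `D 1` with the saddle cancel the terms `-wP` and `wQ`. The Hessian
  -- terms cancel because their matrix has trace `-Apq + Apq = 0`.
  simp only [jac, saddle, map_sub, map_add, map_neg, Derivation.leibniz, smul_eq_mul, hA, hB,
    hX10, hX01, hX00, hX11, hC, hc]
  ring

theorem saddle_sub (f g : TimeSeries) : saddle (f - g) = saddle f - saddle g := by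
  simp only [saddle, map_sub]
  ring

theorem saddle_one : saddle 1 = 0 := by simp [saddle]

/-- A conjugacy between Hamiltonian vector fields which is tangent to the identity at infinity,
with suitable initial modes, preserves the area. -/
theorem coeff_jac_eq {U V A B App Apq Bqq : TimeSeries} {ω : ℝ} (hω : 0 < ω)
    (hP : HasTimeDeriv (MvPowerSeries.X 0 + U)
      (-(MvPowerSeries.C (BoundedContinuousFunction.const ℝ (ω : ℂ)) *
          saddle (MvPowerSeries.X 0 + U))
        - MvPowerSeries.C (BoundedContinuousFunction.const ℝ (ω : ℂ)) * (MvPowerSeries.X 0 + U)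
        - B))
    (hQ : HasTimeDeriv (MvPowerSeries.X 1 + V)
      (-(MvPowerSeries.C (BoundedContinuousFunction.const ℝ (ω : ℂ)) *
          saddle (MvPowerSeries.X 1 + V))
        + MvPowerSeries.C (BoundedContinuousFunction.const ℝ (ω : ℂ)) * (MvPowerSeries.X 1 + V)
        + A))
    (hA : ∀ i, D i A = App * D i (MvPowerSeries.X 0 + U) + Apq * D i (MvPowerSeries.X 1 + V))
    (hB : ∀ i, D i B = Apq * D i (MvPowerSeries.X 0 + U) + Bqq * D i (MvPowerSeries.X 1 + V))
    (hU : Decays U) (hV : Decays V) (hU0 : InitDegreeLE (-1) U) (hV0 : InitDegreeLE 1 V)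
    (α : Fin 2 →₀ ℕ) {t : ℝ} (ht : 0 ≤ t) :
    MvPowerSeries.coeff α (jac (MvPowerSeries.X 0 + U) (MvPowerSeries.X 1 + V)) t
      = MvPowerSeries.coeff α (1 : TimeSeries) t := by
  have hX10 : D 1 (MvPowerSeries.X 0) = 0 := MvPowerSeries.pderiv_X_of_ne (by decide)
  have hX01 : D 0 (MvPowerSeries.X 1) = 0 := MvPowerSeries.pderiv_X_of_ne (by decide)
  have hX00 : D 0 (MvPowerSeries.X 0) = 1 := MvPowerSeries.pderiv_X_self
  have hX11 : D 1 (MvPowerSeries.X 1) = 1 := MvPowerSeries.pderiv_X_self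
  have hδ : jac (MvPowerSeries.X 0 + U) (MvPowerSeries.X 1 + V) - 1
      = D 0 U + D 1 V + D 0 U * D 1 V - D 1 U * D 0 V := by
    simp only [jac, map_add, hX10, hX01, hX00, hX11]
    ring
  have hderiv := (hasTimeDeriv_jac hP hQ hA hB).sub (hasTimeDeriv_monomial_one 0)
  have hone : (MvPowerSeries.monomial 0 1 : TimeSeries) = 1 := rfl
  rw [hone, sub_zero, ← sub_zero (saddle _), ← saddle_one, ← saddle_sub] at hderiv
  have hz := eq_zero_of_hasTimeDeriv_saddle hω hderiv ?_ ?_ (α := α) ht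
  · rwa [map_sub, BoundedContinuousFunction.sub_apply, sub_eq_zero] at hz
  · rw [hδ]
    exact (((hU.D 0).add (hV.D 1)).add ((hU.D 0).mul_right _)).sub ((hU.D 1).mul_right _)
  -- `D 0` raises the degree bound by one and `D 1` lowers it by one, so the bounds `-1` for `U` and
  -- `1` for `V` put all four terms of `J - 1` in degree at most zero.
  · rw [hδ]
    have h1 : InitDegreeLE 0 (D 0 U) := hU0.D_zero
    have h2 : InitDegreeLE 0 (D 1 V) := hV0.D_one
    have h3 : InitDegreeLE 0 (D 0 U * D 1 V) := h1.mul h2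
    have h4 : InitDegreeLE 0 (D 1 U * D 0 V) := hU0.D_one.mul hV0.D_zero
    exact ((h1.add h2).add h3).sub h4

end TimeSeries

end Transport

/-! ### Evaluation of series at points: convergence, derivatives, analyticity. -/

namespace TimeSeries

open BoundedContinuousFunction

variable {f g : TimeSeries}

/-- The monomial `p^α₀ q^α₁`. -/
def mono (p q : ℂ) (α : Fin 2 →₀ ℕ) : ℂ := p ^ α 0 * q ^ α 1

theorem norm_mono_le {p q : ℂ} {ρ : ℝ} (hp : ‖p‖ ≤ ρ) (hq : ‖q‖ ≤ ρ) (α : Fin 2 →₀ ℕ) :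
    ‖mono p q α‖ ≤ ρ ^ (α 0 + α 1) := by
  rw [mono, norm_mul, norm_pow, norm_pow, pow_add]
  have hρ : 0 ≤ ρ := (norm_nonneg _).trans hp
  gcongr

theorem mono_add (p q : ℂ) (α β : Fin 2 →₀ ℕ) :
    mono p q (α + β) = mono p q α * mono p q β := by
  simp only [mono, Finsupp.add_apply, pow_add]
  ring

/-- The series converges on the open unit polydisc, uniformly in time. -/
def Converges (f : TimeSeries) : Prop :=
  ∀ ρ : ℝ, 0 ≤ ρ → ρ < 1 → Summable fun α : Fin 2 →₀ ℕ =>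
    ‖MvPowerSeries.coeff α f‖ * ρ ^ (α 0 + α 1)

/-- The value of the series at the point `(p, q)` and the time `t`. -/
noncomputable def eval (p q : ℂ) (t : ℝ) (f : TimeSeries) : ℂ :=
  ∑' α, MvPowerSeries.coeff α f t * mono p q α

theorem norm_coeff_mul_mono_le (f : TimeSeries) {p q : ℂ} {ρ : ℝ} (hp : ‖p‖ ≤ ρ) (hq : ‖q‖ ≤ ρ)
    (t : ℝ) (α : Fin 2 →₀ ℕ) : ‖MvPowerSeries.coeff α f t * mono p q α‖
      ≤ ‖MvPowerSeries.coeff α f‖ * ρ ^ (α 0 + α 1) := by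
  rw [norm_mul]
  exact mul_le_mul (BoundedContinuousFunction.norm_coe_le_norm _ t) (norm_mono_le hp hq α)
    (norm_nonneg _) (norm_nonneg _)

theorem Converges.summable_norm (hf : Converges f) {p q : ℂ} (hp : ‖p‖ < 1) (hq : ‖q‖ < 1)
    (t : ℝ) : Summable fun α => ‖MvPowerSeries.coeff α f t * mono p q α‖ :=
  (hf (max ‖p‖ ‖q‖) (le_max_of_le_left (norm_nonneg _)) (max_lt hp hq)).of_nonneg_of_le
    (fun _ => norm_nonneg _)
    (norm_coeff_mul_mono_le f (le_max_left _ _) (le_max_right _ _) t)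

theorem Converges.hasSum (hf : Converges f) {p q : ℂ} (hp : ‖p‖ < 1) (hq : ‖q‖ < 1)
    (t : ℝ) : HasSum (fun α => MvPowerSeries.coeff α f t * mono p q α) (eval p q t f) :=
  (hf.summable_norm hp hq t).of_norm.hasSum

theorem Converges.add (hf : Converges f) (hg : Converges g) : Converges (f + g) :=
  fun ρ h0 h1 => ((hf ρ h0 h1).add (hg ρ h0 h1)).of_nonneg_of_le (fun _ => by positivity)
    fun α => by
      rw [map_add, ← add_mul]
      gcongr
      exact norm_add_le _ _

theorem Converges.neg (hf : Converges f) : Converges (-f) :=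
  fun ρ h0 h1 => by simpa using hf ρ h0 h1

theorem Converges.sub (hf : Converges f) (hg : Converges g) : Converges (f - g) :=
  sub_eq_add_neg f g ▸ hf.add hg.neg

theorem Converges.mul (hf : Converges f) (hg : Converges g) : Converges (f * g) :=
  fun ρ h0 h1 => by
    classical
    obtain ⟨a, ha⟩ : ∃ a : (Fin 2 →₀ ℕ) → ℝ,
      a = fun α => ‖MvPowerSeries.coeff α f‖ * ρ ^ (α 0 + α 1) := ⟨_, rfl⟩
    obtain ⟨b, hb⟩ : ∃ b : (Fin 2 →₀ ℕ) → ℝ,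
      b = fun α => ‖MvPowerSeries.coeff α g‖ * ρ ^ (α 0 + α 1) := ⟨_, rfl⟩
    have ha0 : 0 ≤ a := fun α => by rw [ha]; exact mul_nonneg (norm_nonneg _) (pow_nonneg h0 _)
    have hb0 : 0 ≤ b := fun α => by rw [hb]; exact mul_nonneg (norm_nonneg _) (pow_nonneg h0 _)
    have hfa : Summable a := ha ▸ hf ρ h0 h1
    have hgb : Summable b := hb ▸ hg ρ h0 h1
    refine (summable_sum_mul_antidiagonal_of_summable_mul
      (hfa.mul_of_nonneg hgb ha0 hb0)).of_nonneg_of_le (fun _ => by positivity) fun α => ?_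
    rw [MvPowerSeries.coeff_mul]
    refine (mul_le_mul_of_nonneg_right ((norm_sum_le _ _).trans
      (Finset.sum_le_sum fun _ _ => norm_mul_le _ _)) (pow_nonneg h0 _)).trans ?_
    rw [Finset.sum_mul]
    refine (Finset.sum_congr rfl fun x hx => ?_).le
    have hx' := Finset.HasAntidiagonal.mem_antidiagonal.1 hx
    rw [ha, hb, ← hx']
    simp only [Finsupp.add_apply, pow_add]
    ring

/-- The factor `n + 1` lost in a derivative is recovered on a slightly larger radius, the midpoint
of `ρ` and `1`. The power `n + 1` on the right matches the shifted coefficient. -/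
theorem exists_succ_mul_pow_le {ρ : ℝ} (h0 : 0 ≤ ρ) (h1 : ρ < 1) :
    ∃ ρ' K : ℝ, 0 ≤ ρ' ∧ ρ' < 1 ∧ 0 ≤ K ∧ ∀ n : ℕ, ((n : ℝ) + 1) * ρ ^ n ≤ K * ρ' ^ (n + 1) := by
  have hρ' : 0 < (1 + ρ) / 2 := by linarith
  have hr0 : 0 ≤ ρ / ((1 + ρ) / 2) := by positivity
  have hr1 : ρ / ((1 + ρ) / 2) < 1 := by rw [div_lt_one hρ']; linarith
  have ht := (tendsto_self_mul_const_pow_of_lt_one hr0 hr1).add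
    (tendsto_pow_atTop_nhds_zero_of_lt_one hr0 hr1)
  obtain ⟨K, hK⟩ := ht.bddAbove_range
  have hK0 : 0 ≤ K := le_trans (by positivity) (hK ⟨0, rfl⟩)
  refine ⟨(1 + ρ) / 2, K / ((1 + ρ) / 2), hρ'.le, by linarith, by positivity, fun n => ?_⟩
  have hn : (n : ℝ) * (ρ / ((1 + ρ) / 2)) ^ n + (ρ / ((1 + ρ) / 2)) ^ n ≤ K := hK ⟨n, rfl⟩
  generalize (1 + ρ) / 2 = s at *
  calc ((n : ℝ) + 1) * ρ ^ n = (n * (ρ / s) ^ n + (ρ / s) ^ n) * s ^ n := by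
        rw [div_pow]; field_simp
    _ ≤ K * s ^ n := by gcongr
    _ = _ := by rw [pow_succ]; field_simp

/-- Derivatives may leave the Wiener algebra; convergence on the open polydisc is the weaker
property that they preserve. -/
theorem Converges.D (i : Fin 2) (hf : Converges f) : Converges (D i f) := fun ρ h0 h1 => by
  obtain ⟨ρ', K, h0', h1', hK0, hK⟩ := exists_succ_mul_pow_le h0 h1
  have hinj : Function.Injective fun α : Fin 2 →₀ ℕ => α + Finsupp.single i 1 :=
    add_left_injective _
  refine (((hf ρ' h0' h1').comp_injective hinj).mul_left K).of_nonneg_of_le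
    (fun _ => by positivity) fun α => ?_
  have hdeg : (α + Finsupp.single i 1 : Fin 2 →₀ ℕ) 0 + (α + Finsupp.single i 1 : Fin 2 →₀ ℕ) 1
      = α 0 + α 1 + 1 := by
    fin_cases i <;> simp <;> ring
  have hle : ((α i : ℝ) + 1) ≤ ((α 0 + α 1 : ℕ) : ℝ) + 1 := by
    have : α i ≤ α 0 + α 1 := by fin_cases i <;> simp
    exact_mod_cast Nat.succ_le_succ this
  have hc : ‖((α i : ℝ →ᵇ ℂ) + 1)‖ ≤ (α i : ℝ) + 1 := by
    have := norm_natCast_le_self (C := ℝ →ᵇ ℂ) (α i + 1)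
    push_cast at this
    exact this
  simp only [Function.comp, hdeg]
  rw [TimeSeries.D, MvPowerSeries.coeff_pderiv]
  calc _ ≤ (‖MvPowerSeries.coeff (α + Finsupp.single i 1) f‖ * ((α i : ℝ) + 1))
        * ρ ^ (α 0 + α 1) := by
        gcongr
        exact (norm_mul_le _ _).trans (by gcongr)
    _ ≤ (‖MvPowerSeries.coeff (α + Finsupp.single i 1) f‖ * (((α 0 + α 1 : ℕ) : ℝ) + 1))
        * ρ ^ (α 0 + α 1) := by gcongr
    _ = ‖MvPowerSeries.coeff (α + Finsupp.single i 1) f‖ * ((((α 0 + α 1 : ℕ) : ℝ) + 1)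
        * ρ ^ (α 0 + α 1)) := by ring
    _ ≤ ‖MvPowerSeries.coeff (α + Finsupp.single i 1) f‖ * (K * ρ' ^ (α 0 + α 1 + 1)) :=
        mul_le_mul_of_nonneg_left (hK _) (norm_nonneg _)
    _ = _ := by ring

theorem converges_toSeries (W : Wiener (Fin 2) (ℝ →ᵇ ℂ)) : Converges W.toSeries :=
  fun ρ h0 h1 => W.summable_norm.of_nonneg_of_le (fun _ => by positivity) fun α =>
    mul_le_of_le_one_right (norm_nonneg _) (pow_le_one₀ h0 h1.le)

theorem converges_X (i : Fin 2) : Converges (MvPowerSeries.X i) :=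
  converges_toSeries (Wiener.X i)

theorem converges_C (c : ℝ →ᵇ ℂ) : Converges (MvPowerSeries.C c) :=
  converges_toSeries (Wiener.const c)

theorem eval_add {p q : ℂ} (hp : ‖p‖ < 1) (hq : ‖q‖ < 1) (t : ℝ) (hf : Converges f)
    (hg : Converges g) :
    eval p q t (f + g) = eval p q t f + eval p q t g := by
  rw [← ((hf.hasSum hp hq t).add (hg.hasSum hp hq t)).tsum_eq]
  refine tsum_congr fun α => ?_
  rw [map_add, BoundedContinuousFunction.add_apply, add_mul]

theorem eval_mul {p q : ℂ} (hp : ‖p‖ < 1) (hq : ‖q‖ < 1) (t : ℝ) (hf : Converges f)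
    (hg : Converges g) :
    eval p q t (f * g) = eval p q t f * eval p q t g := by
  have hF := hf.summable_norm hp hq t
  have hG := hg.summable_norm hp hq t
  obtain ⟨a, ha⟩ : ∃ a : (Fin 2 →₀ ℕ) → ℂ,
    a = fun α => MvPowerSeries.coeff α f t * mono p q α := ⟨_, rfl⟩
  obtain ⟨b, hb⟩ : ∃ b : (Fin 2 →₀ ℕ) → ℂ,
    b = fun α => MvPowerSeries.coeff α g t * mono p q α := ⟨_, rfl⟩
  have hF' : Summable fun α => ‖a α‖ := ha ▸ hF
  have hG' : Summable fun α => ‖b α‖ := hb ▸ hG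
  have h := hF'.of_norm.tsum_mul_tsum_eq_tsum_sum_antidiagonal hG'.of_norm
    (summable_mul_of_summable_norm hF' hG')
  have ef : eval p q t f = ∑' α, a α := by rw [ha, eval]
  have eg : eval p q t g = ∑' α, b α := by rw [hb, eval]
  rw [ef, eg, h, eval]
  refine tsum_congr fun α => ?_
  rw [coeff_mul_apply, Finset.sum_mul]
  refine Finset.sum_congr rfl fun x hx => ?_
  rw [ha, hb, ← Finset.HasAntidiagonal.mem_antidiagonal.1 hx, mono_add]
  ring

theorem eval_neg (p q : ℂ) (t : ℝ) (f : TimeSeries) : eval p q t (-f) = -eval p q t f := by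
  rw [eval, eval, ← tsum_neg]
  refine tsum_congr fun α => ?_
  rw [map_neg, BoundedContinuousFunction.neg_apply, neg_mul]

theorem eval_sub {p q : ℂ} (hp : ‖p‖ < 1) (hq : ‖q‖ < 1) (t : ℝ) (hf : Converges f)
    (hg : Converges g) : eval p q t (f - g) = eval p q t f - eval p q t g := by
  rw [sub_eq_add_neg, eval_add hp hq t hf hg.neg, eval_neg, sub_eq_add_neg]

theorem eval_monomial (p q : ℂ) (t : ℝ) (β : Fin 2 →₀ ℕ) (c : ℝ →ᵇ ℂ) :
    eval p q t (MvPowerSeries.monomial β c) = c t * mono p q β := by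
  classical
  rw [eval, tsum_eq_single β]
  · rw [MvPowerSeries.coeff_monomial_same]
  · intro α hα
    rw [MvPowerSeries.coeff_monomial_ne hα]
    simp

theorem eval_C (p q : ℂ) (t : ℝ) (c : ℝ →ᵇ ℂ) : eval p q t (MvPowerSeries.C c) = c t := by
  rw [← MvPowerSeries.monomial_zero_eq_C_apply, eval_monomial]
  simp [mono]

theorem eval_one (p q : ℂ) (t : ℝ) : eval p q t 1 = 1 := by
  rw [← map_one MvPowerSeries.C, eval_C]
  rfl

theorem eval_X_zero (p q : ℂ) (t : ℝ) : eval p q t (MvPowerSeries.X 0) = p := by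
  rw [MvPowerSeries.X, eval_monomial]
  simp [mono]

theorem eval_X_one (p q : ℂ) (t : ℝ) : eval p q t (MvPowerSeries.X 1) = q := by
  rw [MvPowerSeries.X, eval_monomial]
  simp [mono]

theorem norm_eval_toSeries_le {p q : ℂ} (hp : ‖p‖ ≤ 1) (hq : ‖q‖ ≤ 1) (t : ℝ)
    (W : Wiener (Fin 2) (ℝ →ᵇ ℂ)) : ‖eval p q t W.toSeries‖ ≤ ‖W‖ := by
  rw [Wiener.norm_eq_tsum]
  refine tsum_of_norm_bounded W.summable_norm.hasSum fun α => ?_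
  have h := norm_coeff_mul_mono_le W.toSeries hp hq t α
  rwa [one_pow, mul_one] at h

theorem eval_im_eq_zero {W : Wiener (Fin 2) (ℝ →ᵇ ℂ)} (hW : W ∈ realSubring (Fin 2)) {p q : ℂ}
    (hp : ‖p‖ < 1) (hq : ‖q‖ < 1) (hp0 : p.im = 0) (hq0 : q.im = 0) (t : ℝ) :
    (eval p q t W.toSeries).im = 0 := by
  have h := Complex.hasSum_im ((converges_toSeries W).hasSum hp hq t)
  refine h.unique ?_
  convert! hasSum_zero using 2 with α
  have h1 : p = (p.re : ℂ) := Complex.ext rfl (by simpa using hp0)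
  have h2 : q = (q.re : ℂ) := Complex.ext rfl (by simpa using hq0)
  have h3 : (mono p q α).im = 0 := by
    rw [mono, h1, h2, ← Complex.ofReal_pow, ← Complex.ofReal_pow, ← Complex.ofReal_mul,
      Complex.ofReal_im]
  rw [Complex.mul_im, h3, Wiener.coeff_toSeries, hW α t]
  simp

/-- Scaling by 4 sends the half-polydisc to radius 2, where `norm_monomial_sub_le` applies. In
degree `n` this gives the factor `(2n / 2^n) * 2d`, and `2n ≤ 2^n`. -/
theorem norm_eval_sub_le {p q p' q' : ℂ} {d : ℝ} (hp : ‖p‖ ≤ 1 / 2) (hq : ‖q‖ ≤ 1 / 2)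
    (hp' : ‖p'‖ ≤ 1 / 2) (hq' : ‖q'‖ ≤ 1 / 2) (h1 : ‖p - p'‖ ≤ d) (h2 : ‖q - q'‖ ≤ d) (t : ℝ)
    (W : Wiener (Fin 2) (ℝ →ᵇ ℂ)) :
    ‖eval p q t W.toSeries - eval p' q' t W.toSeries‖ ≤ ‖W‖ * (2 * d) := by
  have hd : 0 ≤ d := (norm_nonneg _).trans h1
  have hs := ((converges_toSeries W).hasSum (p := p) (by linarith)
    (by linarith : ‖q‖ < 1) t).sub
    ((converges_toSeries W).hasSum (p := p') (by linarith)
      (by linarith : ‖q'‖ < 1) t)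
  rw [← hs.tsum_eq, Wiener.norm_eq_tsum]
  refine tsum_of_norm_bounded (W.summable_norm.hasSum.mul_right (2 * d)) fun α => ?_
  have hscale : ∀ {z : ℂ}, ‖z‖ ≤ 1 / 2 → ‖4 * z‖ ≤ 2 := fun {z} hz => by
    rw [norm_mul]; norm_num; linarith
  have hsub : ∀ {z z' : ℂ}, ‖z - z'‖ ≤ d → ‖4 * z - 4 * z'‖ ≤ 4 * d := fun {z z'} hz => by
    rw [← mul_sub, norm_mul]; norm_num; linarith
  have h := norm_monomial_sub_le (hscale hp) (hscale hp') (hscale hq) (hscale hq') (hsub h1)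
    (hsub h2) (α 0) (α 1)
  have e : (4 * p) ^ α 0 * (4 * q) ^ α 1 - (4 * p') ^ α 0 * (4 * q') ^ α 1
      = 4 ^ (α 0 + α 1) * (mono p q α - mono p' q' α) := by
    simp only [mono, mul_pow, pow_add]; ring
  have h3 : 2 * (α 0 + α 1) ≤ 2 ^ (α 0 + α 1) := by
    generalize α 0 + α 1 = n
    cases n with
    | zero => simp
    | succ n =>
      rw [pow_succ']
      exact Nat.mul_le_mul_left 2 Nat.lt_two_pow_self
  have h3' : 2 * ((α 0 + α 1 : ℕ) : ℝ) ≤ 2 ^ (α 0 + α 1) := by exact_mod_cast h3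
  have h4 : (4 : ℝ) ^ (α 0 + α 1) = 2 ^ (α 0 + α 1) * 2 ^ (α 0 + α 1) := by
    rw [← mul_pow]; norm_num
  rw [e, norm_mul, norm_pow, show ‖(4 : ℂ)‖ = 4 by norm_num, h4] at h
  have h5 : (0 : ℝ) < 2 ^ (α 0 + α 1) := by positivity
  have h6 : ‖mono p q α - mono p' q' α‖ ≤ 2 * d := by
    have h7 : 2 ^ (α 0 + α 1) * (2 ^ (α 0 + α 1) * ‖mono p q α - mono p' q' α‖)
        ≤ 2 ^ (α 0 + α 1) * (2 ^ (α 0 + α 1) * (2 * d)) := by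
      calc _ ≤ ((α 0 + α 1 : ℕ) : ℝ) * 2 ^ (α 0 + α 1) * (4 * d) := by
            rw [← mul_assoc]; exact h
        _ = (2 * ((α 0 + α 1 : ℕ) : ℝ)) * (2 ^ (α 0 + α 1) * (2 * d)) := by ring
        _ ≤ _ := by gcongr
    exact le_of_mul_le_mul_left (le_of_mul_le_mul_left h7 h5) h5
  rw [← mul_sub, norm_mul]
  exact mul_le_mul (BoundedContinuousFunction.norm_coe_le_norm _ t) h6 (norm_nonneg _)
    (norm_nonneg _)

theorem tsum_shift (i : Fin 2) {u : (Fin 2 →₀ ℕ) → ℂ} (hu : ∀ α, α i = 0 → u α = 0) :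
    ∑' α, u (α + Finsupp.single i 1) = ∑' α, u α := by
  have hinj : Function.Injective fun α : Fin 2 →₀ ℕ => α + Finsupp.single i 1 :=
    add_left_injective _
  refine hinj.tsum_eq fun α hα => ?_
  have h : α i ≠ 0 := fun h => hα (hu α h)
  exact ⟨α - Finsupp.single i 1,
    tsub_add_cancel_of_le (Finsupp.single_le_iff.2 (Nat.one_le_iff_ne_zero.2 h))⟩

theorem hasDerivAt_eval_fst (hf : Converges f) {p q : ℂ} (hp : ‖p‖ < 1) (hq : ‖q‖ < 1) (t : ℝ) :
    HasDerivAt (fun p => eval p q t f) (eval p q t (D 0 f)) p := by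
  obtain ⟨ρ, hρ, hρ1⟩ := exists_between (max_lt hp hq)
  have hρ0 : 0 ≤ ρ := (norm_nonneg p).trans ((le_max_left _ _).trans hρ.le)
  obtain ⟨ρ', K, h0', h1', hK0, hK⟩ := exists_succ_mul_pow_le hρ0 hρ1
  have hpρ : p ∈ Metric.ball (0 : ℂ) ρ := by simpa using (le_max_left _ _).trans_lt hρ
  have hqρ : ‖q‖ ≤ ρ := (le_max_right _ _).trans hρ.le
  have key := hasDerivAt_tsum_of_isPreconnected (𝕜 := ℂ) ((hf ρ' h0' h1').mul_left K)
    (g := fun α p => MvPowerSeries.coeff α f t * mono p q α)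
    (g' := fun α p => MvPowerSeries.coeff α f t * ((α 0 : ℂ) * p ^ (α 0 - 1) * q ^ α 1))
    Metric.isOpen_ball (convex_ball (0 : ℂ) ρ).isPreconnected
    (fun α y _ => ((hasDerivAt_pow (α 0) y).mul_const (q ^ α 1)).const_mul _)
    (fun α y hy => ?_) hpρ (hf.summable_norm hp hq t).of_norm hpρ
  · refine key.congr_deriv ?_
    rw [eval, ← tsum_shift 0 fun α hα => by simp [hα]]
    refine tsum_congr fun α => ?_
    rw [coeff_D]
    simp [mono]
    ring
  · have hy' : ‖y‖ ≤ ρ := by simpa using (Metric.mem_ball.1 hy).le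
    rw [norm_mul, norm_mul, norm_mul, norm_pow, norm_pow, Complex.norm_natCast]
    have hb : (α 0 : ℝ) * ‖y‖ ^ (α 0 - 1) * ‖q‖ ^ α 1 ≤ K * ρ' ^ (α 0 + α 1) := by
      rcases Nat.eq_zero_or_pos (α 0) with h | h
      · rw [h]; simp; positivity
      · obtain ⟨m, hm⟩ : ∃ m, α 0 = m + 1 := ⟨α 0 - 1, by omega⟩
        rw [hm, Nat.add_sub_cancel]
        calc _ ≤ ((m + 1 : ℕ) : ℝ) * ρ ^ m * ρ ^ α 1 := by gcongr
          _ = ((m : ℝ) + 1) * ρ ^ (m + α 1) := by rw [pow_add]; push_cast; ring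
          _ ≤ (((m + α 1 : ℕ) : ℝ) + 1) * ρ ^ (m + α 1) := by gcongr; omega
          _ ≤ K * ρ' ^ (m + α 1 + 1) := hK _
          _ = _ := by congr 2; ring
    calc _ ≤ ‖MvPowerSeries.coeff α f‖ * (K * ρ' ^ (α 0 + α 1)) := by
          gcongr
          exact BoundedContinuousFunction.norm_coe_le_norm _ t
      _ = _ := by ring

theorem hasDerivAt_eval_snd (hf : Converges f) {p q : ℂ} (hp : ‖p‖ < 1) (hq : ‖q‖ < 1) (t : ℝ) :
    HasDerivAt (fun q => eval p q t f) (eval p q t (D 1 f)) q := by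
  obtain ⟨ρ, hρ, hρ1⟩ := exists_between (max_lt hp hq)
  have hρ0 : 0 ≤ ρ := (norm_nonneg p).trans ((le_max_left _ _).trans hρ.le)
  obtain ⟨ρ', K, h0', h1', hK0, hK⟩ := exists_succ_mul_pow_le hρ0 hρ1
  have hqρ : q ∈ Metric.ball (0 : ℂ) ρ := by simpa using (le_max_right _ _).trans_lt hρ
  have hpρ : ‖p‖ ≤ ρ := (le_max_left _ _).trans hρ.le
  have key := hasDerivAt_tsum_of_isPreconnected (𝕜 := ℂ) ((hf ρ' h0' h1').mul_left K)
    (g := fun α q => MvPowerSeries.coeff α f t * mono p q α)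
    (g' := fun α q => MvPowerSeries.coeff α f t * (p ^ α 0 * ((α 1 : ℂ) * q ^ (α 1 - 1))))
    Metric.isOpen_ball (convex_ball (0 : ℂ) ρ).isPreconnected
    (fun α y _ => ((hasDerivAt_pow (α 1) y).const_mul (p ^ α 0)).const_mul _)
    (fun α y hy => ?_) hqρ (hf.summable_norm hp hq t).of_norm hqρ
  · refine key.congr_deriv ?_
    rw [eval, ← tsum_shift 1 fun α hα => by simp [hα]]
    refine tsum_congr fun α => ?_
    rw [coeff_D]
    simp [mono]
    ring
  · have hy' : ‖y‖ ≤ ρ := by simpa using (Metric.mem_ball.1 hy).le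
    rw [norm_mul, norm_mul, norm_mul, norm_pow, norm_pow, Complex.norm_natCast]
    have hb : ‖p‖ ^ α 0 * ((α 1 : ℝ) * ‖y‖ ^ (α 1 - 1)) ≤ K * ρ' ^ (α 0 + α 1) := by
      rcases Nat.eq_zero_or_pos (α 1) with h | h
      · rw [h]; simp; positivity
      · obtain ⟨m, hm⟩ : ∃ m, α 1 = m + 1 := ⟨α 1 - 1, by omega⟩
        rw [hm, Nat.add_sub_cancel]
        calc _ ≤ ρ ^ α 0 * (((m + 1 : ℕ) : ℝ) * ρ ^ m) := by gcongr
          _ = ((m : ℝ) + 1) * ρ ^ (α 0 + m) := by rw [pow_add]; push_cast; ring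
          _ ≤ (((α 0 + m : ℕ) : ℝ) + 1) * ρ ^ (α 0 + m) := by gcongr; omega
          _ ≤ K * ρ' ^ (α 0 + m + 1) := hK _
          _ = _ := by congr 2
    calc _ ≤ ‖MvPowerSeries.coeff α f‖ * (K * ρ' ^ (α 0 + α 1)) := by
          gcongr
          exact BoundedContinuousFunction.norm_coe_le_norm _ t
      _ = _ := by ring

theorem HasTimeDeriv.coeff_eq (h : HasTimeDeriv f g) (α : Fin 2 →₀ ℕ) {t : ℝ} (ht : 0 ≤ t) :
    MvPowerSeries.coeff α f t = MvPowerSeries.coeff α f 0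
      + ∫ s in (0 : ℝ)..t, MvPowerSeries.coeff α g (max s 0) := by
  have hc : Continuous fun s : ℝ => MvPowerSeries.coeff α g (max s 0) :=
    (MvPowerSeries.coeff α g).continuous.comp (continuous_id.max continuous_const)
  rw [intervalIntegral.integral_eq_sub_of_hasDeriv_right_of_le ht
    (f := fun s => MvPowerSeries.coeff α f s) (fun s hs =>
      ((h α s hs.1).continuousWithinAt).mono fun x hx => hx.1) (fun s hs => ?_)
    (hc.intervalIntegrable _ _)]
  · ring
  · rw [max_eq_left hs.1.le]
    exact (h α s hs.1.le).mono fun x hx => hs.1.le.trans (le_of_lt hx)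

/-- Termwise differentiation is applied to two-sided derivatives on the whole line. Each coefficient
is therefore replaced by its initial value plus the integral of its derivative, frozen at negative
times; the two agree for `t ≥ 0`. -/
theorem HasTimeDeriv.eval (h : HasTimeDeriv f g) (hf : Converges f) (hg : Converges g) {p q : ℂ}
    (hp : ‖p‖ < 1) (hq : ‖q‖ < 1) {t : ℝ} (ht : 0 ≤ t) :
    HasDerivWithinAt (fun t => eval p q t f) (eval p q t g) (Ici 0) t := by
  have hc : ∀ α, Continuous fun s : ℝ => MvPowerSeries.coeff α g (max s 0) := fun α =>
    (MvPowerSeries.coeff α g).continuous.comp (continuous_id.max continuous_const)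
  have key := hasDerivAt_tsum (𝕜 := ℝ)
    (hg (max ‖p‖ ‖q‖) (le_max_of_le_left (norm_nonneg _)) (max_lt hp hq))
    (g := fun α s => (MvPowerSeries.coeff α f 0
      + ∫ s in (0 : ℝ)..s, MvPowerSeries.coeff α g (max s 0)) * mono p q α)
    (g' := fun α s => MvPowerSeries.coeff α g (max s 0) * mono p q α) (y₀ := 0)
    (fun α s => (((hc α).integral_hasStrictDerivAt 0 s).hasDerivAt.const_add _).mul_const _)
    (fun α s => norm_coeff_mul_mono_le g (le_max_left _ _) (le_max_right _ _) _ α)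
    (by simpa using (hf.summable_norm hp hq 0).of_norm) t
  rw [max_eq_left ht] at key
  have heq : ∀ s ∈ Ici (0 : ℝ), TimeSeries.eval p q s f = ∑' α, (MvPowerSeries.coeff α f 0
      + ∫ s in (0 : ℝ)..s, MvPowerSeries.coeff α g (max s 0)) * mono p q α := fun s hs =>
    tsum_congr fun α => by rw [h.coeff_eq α hs]
  exact key.hasDerivWithinAt.congr heq (heq t ht)

/-- The multilinear map with diagonal `(p, q) ↦ p^m q^(n-m)`. -/
noncomputable def monoMultilinear (n m : ℕ) :
    ContinuousMultilinearMap ℂ (fun _ : Fin n => ℂ × ℂ) ℂ :=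
  (ContinuousMultilinearMap.mkPiAlgebraFin ℂ n ℂ).compContinuousLinearMap
    fun i => if (i : ℕ) < m then ContinuousLinearMap.fst ℂ ℂ ℂ else ContinuousLinearMap.snd ℂ ℂ ℂ

theorem norm_monoMultilinear_le (n m : ℕ) : ‖monoMultilinear n m‖ ≤ 1 := by
  refine (ContinuousMultilinearMap.norm_compContinuousLinearMap_le _ _).trans ?_
  rw [ContinuousMultilinearMap.norm_mkPiAlgebraFin, one_mul]
  refine Finset.prod_le_one (fun _ _ => norm_nonneg _) fun i _ => ?_
  split_ifs
  · exact ContinuousLinearMap.norm_fst_le ℂ ℂ ℂ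
  · exact ContinuousLinearMap.norm_snd_le ℂ ℂ ℂ

theorem monoMultilinear_apply (m k : ℕ) (z : ℂ × ℂ) :
    monoMultilinear (m + k) m (fun _ => z) = z.1 ^ m * z.2 ^ k := by
  rw [monoMultilinear, ContinuousMultilinearMap.compContinuousLinearMap_apply,
    ContinuousMultilinearMap.mkPiAlgebraFin_apply, List.prod_ofFn, Fin.prod_univ_add]
  simp

/-- The exponents in two variables as pairs of natural numbers. -/
noncomputable def exponentEquiv : (Fin 2 →₀ ℕ) ≃ ℕ × ℕ :=
  Finsupp.equivFunOnFinite.trans (finTwoArrowEquiv ℕ)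

/-- The Taylor series of `(p, q) ↦ eval p q t f`. -/
noncomputable def evalSeries (f : TimeSeries) (t : ℝ) : FormalMultilinearSeries ℂ (ℂ × ℂ) ℂ :=
  fun n => ∑ x ∈ Finset.HasAntidiagonal.antidiagonal n,
    MvPowerSeries.coeff (exponentEquiv.symm x) f t • monoMultilinear n x.1

/-- Joint analyticity comes from grouping the absolutely convergent double series by total degree.
With the maximum norm on `ℂ × ℂ` the unit ball is the polydisc, so no radius is lost. -/
theorem hasFPowerSeriesOnBall_eval (hf : Converges f) (t : ℝ) :
    HasFPowerSeriesOnBall (fun z : ℂ × ℂ => eval z.1 z.2 t f) (evalSeries f t) 0 1 where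
  r_le := by
    refine ENNReal.le_of_forall_nnreal_lt fun r hr => ?_
    have hr1 : (r : ℝ) < 1 := by exact_mod_cast hr
    have hs := (exponentEquiv.symm.summable_iff).2 (hf r r.2 hr1)
    refine FormalMultilinearSeries.le_radius_of_bound _
      (∑' x : ℕ × ℕ, ‖MvPowerSeries.coeff (exponentEquiv.symm x) f‖ * (r : ℝ) ^ (x.1 + x.2))
      fun n => ?_
    have hs' : Summable fun x : ℕ × ℕ =>
        ‖MvPowerSeries.coeff (exponentEquiv.symm x) f‖ * (r : ℝ) ^ (x.1 + x.2) := hs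
    refine le_trans ?_ (hs'.sum_le_tsum (Finset.HasAntidiagonal.antidiagonal n) fun _ _ => by positivity)
    rw [evalSeries]
    refine (mul_le_mul_of_nonneg_right (norm_sum_le _ _) (by positivity)).trans ?_
    rw [Finset.sum_mul]
    refine Finset.sum_le_sum fun x hx => ?_
    rw [Finset.HasAntidiagonal.mem_antidiagonal.1 hx]
    gcongr
    rw [norm_smul]
    exact (mul_le_of_le_one_right (norm_nonneg _) (norm_monoMultilinear_le _ _)).trans
      (BoundedContinuousFunction.norm_coe_le_norm _ t)
  r_pos := one_pos
  hasSum {y} hy := by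
    have hy' : ‖y‖ < 1 := by
      rw [Metric.mem_eball, edist_zero_right] at hy
      rwa [← ofReal_norm, ENNReal.ofReal_lt_one] at hy
    have h1 : ‖y.1‖ < 1 := (norm_fst_le y).trans_lt hy'
    have h2 : ‖y.2‖ < 1 := (norm_snd_le y).trans_lt hy'
    have hs := (exponentEquiv.symm.hasSum_iff).2 (hf.hasSum h1 h2 t)
    have hs2 := (Finset.HasAntidiagonal.sigmaAntidiagonalEquivProd.hasSum_iff).2 hs
    have hs3 := hs2.sigma fun n => hasSum_fintype _
    rw [zero_add]
    refine hs3.congr_fun fun n => ?_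
    rw [evalSeries, _root_.sum_apply, ← Finset.sum_coe_sort]
    refine Finset.sum_congr rfl fun x _ => ?_
    obtain ⟨⟨m, k⟩, hx⟩ := x
    obtain rfl := Finset.HasAntidiagonal.mem_antidiagonal.1 hx
    rw [_root_.smul_apply, monoMultilinear_apply]
    rfl

theorem analyticAt_eval (hf : Converges f) (t : ℝ) {z : ℂ × ℂ} (h1 : ‖z.1‖ < 1)
    (h2 : ‖z.2‖ < 1) : AnalyticAt ℂ (fun z : ℂ × ℂ => eval z.1 z.2 t f) z := by
  refine (hasFPowerSeriesOnBall_eval hf t).analyticAt_of_mem ?_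
  rw [Metric.mem_eball, edist_zero_right, ← ofReal_norm, ENNReal.ofReal_lt_one]
  exact max_lt h1 h2

end TimeSeries

/-! ### Taylor expansion of the perturbation in two complex variables. -/

section Taylor

theorem polydisc_eq_closedBall (R : ℝ) : polydisc R = Metric.closedBall (0 : ℂ × ℂ) R := by
  ext z
  rw [mem_closedBall_zero_iff, Prod.norm_def, max_le_iff]
  rfl

theorem interior_polydisc {R : ℝ} (hR : 0 < R) :
    interior (polydisc R) = Metric.ball (0 : ℂ × ℂ) R := by
  rw [polydisc_eq_closedBall, interior_closedBall _ hR.ne']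

theorem mem_ball_prod_iff {R : ℝ} {p q : ℂ} :
    (p, q) ∈ Metric.ball (0 : ℂ × ℂ) R ↔ ‖p‖ < R ∧ ‖q‖ < R := by
  rw [mem_ball_zero_iff, Prod.norm_def, max_lt_iff]

variable {R : ℝ} {G : ℂ × ℂ → ℂ}

theorem analyticOnNhd_fst_slice (hG : AnalyticOnNhd ℂ G (Metric.ball 0 R)) {q : ℂ}
    (hq : ‖q‖ < R) : AnalyticOnNhd ℂ (fun p => G (p, q)) (Metric.ball 0 R) := fun p hp =>
  (hG (p, q) (mem_ball_prod_iff.2 ⟨by simpa using hp, hq⟩)).comp₂ analyticAt_id analyticAt_const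

theorem analyticOnNhd_snd_slice (hG : AnalyticOnNhd ℂ G (Metric.ball 0 R)) {p : ℂ}
    (hp : ‖p‖ < R) : AnalyticOnNhd ℂ (fun q => G (p, q)) (Metric.ball 0 R) := fun q hq =>
  (hG (p, q) (mem_ball_prod_iff.2 ⟨hp, by simpa using hq⟩)).comp₂ analyticAt_const analyticAt_id

/-- Joint analyticity is carried through the induction by writing the partial derivative as the
total derivative in direction `(1, 0)`; the outer Taylor expansion in `q` depends on it. -/
theorem analyticOnNhd_iteratedDeriv_fst (hG : AnalyticOnNhd ℂ G (Metric.ball 0 R)) (m : ℕ) :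
    AnalyticOnNhd ℂ (fun z : ℂ × ℂ => iteratedDeriv m (fun p => G (p, z.2)) z.1)
      (Metric.ball 0 R) := by
  induction m with
  | zero => simpa using hG
  | succ m ih =>
    have h : AnalyticOnNhd ℂ (fun z : ℂ × ℂ =>
        fderiv ℂ (fun z : ℂ × ℂ => iteratedDeriv m (fun p => G (p, z.2)) z.1) z (1, 0))
        (Metric.ball 0 R) :=
      ((ContinuousLinearMap.apply ℂ ℂ ((1, 0) : ℂ × ℂ)).analyticOnNhd univ).comp ih.fderiv
        (mapsTo_univ _ _)
    refine h.congr Metric.isOpen_ball fun z hz => ?_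
    have h1 := (ih z hz).differentiableAt.hasFDerivAt
    have h2 : HasDerivAt (fun p : ℂ => (p, z.2)) ((1, 0) : ℂ × ℂ) z.1 :=
      (hasDerivAt_id z.1).prodMk (hasDerivAt_const z.1 z.2)
    rw [iteratedDeriv_succ]
    exact (HasFDerivAt.comp_hasDerivAt z.1 h1 h2).deriv.symm

/-- One-variable Taylor expansion in `p` at fixed `q`, then of each `p`-coefficient in `q`, gives an
iterated sum; absolute summability identifies it with the double sum. -/
theorem hasSum_iteratedDeriv_of_analyticOnNhd (hG : AnalyticOnNhd ℂ G (Metric.ball 0 R))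
    (hs : Summable fun β : ℕ × ℕ =>
      ‖iteratedDeriv β.2 (fun q => iteratedDeriv β.1 (fun p => G (p, q)) 0) 0
        / ((β.1 ! : ℂ) * (β.2 ! : ℂ))‖ * R ^ (β.1 + β.2))
    {p q : ℂ} (hp : ‖p‖ < R) (hq : ‖q‖ < R) :
    HasSum (fun β : ℕ × ℕ =>
      iteratedDeriv β.2 (fun q => iteratedDeriv β.1 (fun p => G (p, q)) 0) 0
        / ((β.1 ! : ℂ) * (β.2 ! : ℂ)) * (p ^ β.1 * q ^ β.2)) (G (p, q)) := by
  have hR : 0 < R := (norm_nonneg p).trans_lt hp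
  have hsum : Summable fun β : ℕ × ℕ =>
      iteratedDeriv β.2 (fun q => iteratedDeriv β.1 (fun p => G (p, q)) 0) 0
        / ((β.1 ! : ℂ) * (β.2 ! : ℂ)) * (p ^ β.1 * q ^ β.2) := by
    refine Summable.of_norm_bounded hs fun β => ?_
    rw [norm_mul, norm_mul, norm_pow, norm_pow, pow_add]
    gcongr
  have h1 := Complex.hasSum_taylorSeries_on_ball
    (analyticOnNhd_fst_slice hG hq).differentiableOn (z := p) (by simpa using hp)
  have h2 : ∀ m : ℕ, HasSum (fun n : ℕ =>
      iteratedDeriv n (fun q => iteratedDeriv m (fun p => G (p, q)) 0) 0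
        / ((m ! : ℂ) * (n ! : ℂ)) * (p ^ m * q ^ n))
      ((m ! : ℂ)⁻¹ • (p - 0) ^ m • iteratedDeriv m (fun p => G (p, q)) 0) := fun m => by
    have hm := analyticOnNhd_snd_slice (analyticOnNhd_iteratedDeriv_fst hG m) (p := 0)
      (by simpa using hR)
    have h3 := (Complex.hasSum_taylorSeries_on_ball hm.differentiableOn (z := q)
      (by simpa using hq)).mul_left ((m ! : ℂ)⁻¹ * p ^ m)
    rw [smul_eq_mul, smul_eq_mul, sub_zero, ← mul_assoc]
    refine h3.congr_fun fun n => ?_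
    simp only [smul_eq_mul, sub_zero, div_eq_mul_inv, mul_inv]
    ring
  have h3 := hsum.hasSum.prod_fiberwise h2
  rw [h1.unique h3]
  exact hsum.hasSum

theorem im_deriv_eq_zero {g : ℂ → ℂ} {x : ℝ} (hg : DifferentiableAt ℂ g x)
    (hr : ∀ᶠ y : ℝ in 𝓝 x, (g y).im = 0) : (deriv g x).im = 0 := by
  have h1 : HasDerivAt (fun y : ℝ => (g y).im) (deriv g x).im x :=
    Complex.imCLM.hasFDerivAt.comp_hasDerivAt x hg.hasDerivAt.comp_ofReal
  exact h1.unique ((hasDerivAt_const x (0 : ℝ)).congr_of_eventuallyEq hr)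

theorem im_iteratedDeriv_eq_zero {g : ℂ → ℂ} (hg : AnalyticOnNhd ℂ g (Metric.ball 0 R))
    (hr : ∀ x : ℝ, |x| < R → (g x).im = 0) (m : ℕ) {x : ℝ} (hx : |x| < R) :
    (iteratedDeriv m g x).im = 0 := by
  induction m generalizing x with
  | zero => simpa using hr x hx
  | succ m ih =>
    rw [iteratedDeriv_succ]
    refine im_deriv_eq_zero ?_ ?_
    · rw [iteratedDeriv_eq_iterate]
      exact (hg.iterated_deriv m x (by simpa using hx)).differentiableAt
    · exact (continuous_abs.continuousAt.eventually_lt continuousAt_const hx).mono fun y hy => ih hy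

variable {F : ℂ × ℂ → ℝ → ℂ} {M a : ℝ}

theorem IsPerturbation.analyticOnNhd_ball (hF : IsPerturbation R F) (hR : 0 < R) {t : ℝ}
    (ht : 0 ≤ t) : AnalyticOnNhd ℂ (fun z => F z t) (Metric.ball 0 R) :=
  interior_polydisc hR ▸ hF.holomorphic t ht

theorem SlowDecay.summable (hF : SlowDecay R M a F) (hR : 0 ≤ R) {t : ℝ} (ht : 0 ≤ t) :
    Summable fun β : ℕ × ℕ => ‖taylorCoeff F β t‖ * R ^ (β.1 + β.2) := by
  have h : ∑' β : ℕ × ℕ, ENNReal.ofReal (‖taylorCoeff F β t‖ * R ^ (β.1 + β.2)) ≠ ∞ := by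
    refine ne_top_of_le_ne_top ENNReal.ofReal_ne_top (le_trans (le_of_eq ?_) (hF t ht))
    refine tsum_congr fun β => ?_
    rw [ENNReal.ofReal_mul (norm_nonneg _), ofReal_norm]
  have h2 := ENNReal.summable_toReal h
  refine h2.congr fun β => ENNReal.toReal_ofReal (by positivity)

theorem SlowDecay.norm_taylorCoeff_le (hF : SlowDecay R M a F) (hR : 0 < R) (hM : 0 ≤ M) {t : ℝ}
    (ht : 0 ≤ t) (β : ℕ × ℕ) :
    ‖taylorCoeff F β t‖ * R ^ (β.1 + β.2) ≤ M * Real.exp (-a * t) := by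
  rw [← ENNReal.ofReal_le_ofReal_iff (by positivity)]
  refine le_trans (le_of_eq ?_) ((ENNReal.le_tsum β).trans (hF t ht))
  rw [ENNReal.ofReal_mul (norm_nonneg _), ofReal_norm]

theorem hasSum_taylorCoeff (hF : IsPerturbation R F) (hFd : SlowDecay R M a F) (hR : 0 < R)
    {t : ℝ} (ht : 0 ≤ t) {p q : ℂ} (hp : ‖p‖ < R) (hq : ‖q‖ < R) :
    HasSum (fun β : ℕ × ℕ => taylorCoeff F β t * (p ^ β.1 * q ^ β.2)) (F (p, q) t) :=
  hasSum_iteratedDeriv_of_analyticOnNhd (hF.analyticOnNhd_ball hR ht) (hFd.summable hR.le ht) hp hq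

theorem IsRealPerturbation.taylorCoeff_im (hr : IsRealPerturbation R F) (hF : IsPerturbation R F)
    (hR : 0 < R) {t : ℝ} (ht : 0 ≤ t) (β : ℕ × ℕ) : (taylorCoeff F β t).im = 0 := by
  have hG := hF.analyticOnNhd_ball hR ht
  have h1 : ∀ x : ℝ, |x| < R →
      (iteratedDeriv β.1 (fun p => F (p, (x : ℂ)) t) 0).im = 0 := fun x hx => by
    have h := im_iteratedDeriv_eq_zero (analyticOnNhd_fst_slice hG (q := (x : ℂ)) (by simpa using hx))
      (fun y hy => hr t ht y x ⟨by simpa using hy.le, by simpa using hx.le⟩) β.1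
      (x := 0) (by simpa using hR)
    rwa [Complex.ofReal_zero] at h
  have h2 := im_iteratedDeriv_eq_zero
    (analyticOnNhd_snd_slice (analyticOnNhd_iteratedDeriv_fst hG β.1) (p := 0) (by simpa using hR))
    h1 β.2 (x := 0) (by simpa using hR)
  rw [Complex.ofReal_zero] at h2
  have h3 : ((β.1 ! : ℂ) * (β.2 ! : ℂ)) = (((β.1 ! * β.2 ! : ℕ) : ℝ) : ℂ) := by push_cast; ring
  rw [taylorCoeff, h3, Complex.div_ofReal_im, h2, zero_div]

end Taylor

/-! ### Rescaling the perturbation and splitting off its exponential decay. -/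

section Scaled

open BoundedContinuousFunction

/-- The exponentially decaying weight. -/
noncomputable def decay (a : ℝ) (ha : 0 < a) : ℝ →ᵇ ℂ :=
  BoundedContinuousFunction.ofNormedAddCommGroup
    (fun t => (Real.exp (-a * max t 0) : ℂ)) (by fun_prop) 1 fun t => by
      rw [Complex.norm_real, Real.norm_eq_abs, Real.abs_exp, Real.exp_le_one_iff]
      nlinarith [le_max_right t 0]

theorem decay_apply {a : ℝ} (ha : 0 < a) {t : ℝ} (ht : 0 ≤ t) :
    decay a ha t = (Real.exp (-a * t) : ℂ) := by
  change (Real.exp (-a * max t 0) : ℂ) = _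
  rw [max_eq_left ht]

theorem norm_decay_le {a : ℝ} (ha : 0 < a) : ‖decay a ha‖ ≤ 1 :=
  (BoundedContinuousFunction.norm_le zero_le_one).2 fun t => by
    change ‖(Real.exp (-a * max t 0) : ℂ)‖ ≤ 1
    rw [Complex.norm_real, Real.norm_eq_abs, Real.abs_exp, Real.exp_le_one_iff]
    nlinarith [le_max_right t 0]

theorem decay_im {a : ℝ} (ha : 0 < a) (t : ℝ) : (decay a ha t).im = 0 := Complex.ofReal_im _

theorem hasDerivWithinAt_decay {a : ℝ} (ha : 0 < a) {t : ℝ} (ht : 0 ≤ t) :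
    HasDerivWithinAt (decay a ha) (-(a * decay a ha t)) (Ici 0) t := by
  have h : HasDerivAt (fun t : ℝ => (Real.exp (-a * t) : ℂ))
      ((Real.exp (-a * t) * (-a) : ℝ) : ℂ) t := by
    have := ((hasDerivAt_id t).const_mul (-a)).exp
    simpa using this.ofReal_comp
  refine (h.hasDerivWithinAt.congr_deriv ?_).congr (fun s hs => decay_apply ha hs)
    (decay_apply ha ht)
  rw [decay_apply ha ht]
  push_cast
  ring

theorem tendsto_decay {a : ℝ} (ha : 0 < a) : Tendsto (fun t => decay a ha t) atTop (𝓝 0) := by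
  have h : Tendsto (fun t : ℝ => Real.exp (-a * t)) atTop (𝓝 0) :=
    Real.tendsto_exp_atBot.comp (tendsto_id.const_mul_atTop_of_neg (neg_lt_zero.2 ha))
  have h2 := (Complex.continuous_ofReal.tendsto 0).comp h
  rw [Complex.ofReal_zero] at h2
  exact h2.congr' ((eventually_ge_atTop 0).mono fun t ht => (decay_apply ha ht).symm)

/-- The scaled Taylor coefficients of a perturbation, without their exponential decay. -/
theorem exists_scaledCoeff {R M a b r : ℝ} {F : ℂ × ℂ → ℝ → ℂ} (hF : IsPerturbation R F)
    (hFd : SlowDecay R M a F) (hR : 0 < R) (hM : 0 ≤ M) (hb : 0 < b) (hba : b ≤ a) (hr : 0 < r)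
    (hrR : r / R ≤ 1 / 16) :
    ∃ f : ℕ × ℕ → ℝ →ᵇ ℂ, GeomBound (4096 * M * r / R ^ 3) (1 / 16) f ∧
      (∀ β, ∀ t, 0 ≤ t → (r : ℂ) ^ (β.1 + β.2) * taylorCoeff F β t
        = r ^ 2 * (decay b hb t * f β t)) ∧
      (IsRealPerturbation R F → ∀ β t, (f β t).im = 0) := by
  -- Since `|β| = k + 3`, three powers of `r/R` against `r²` leave the small factor `r / R³`. Only
  -- `(r/R)^k` is traded for `(1/16)^k`, and restoring the exponent `k + 3` costs `16³ = 4096`. The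
  -- weight `e^{bt}` is absorbed because `b ≤ a`.
  have hbound : ∀ (β : ℕ × ℕ) (t : ℝ), ‖((Real.exp (b * max t 0) * r ^ (β.1 + β.2) / r ^ 2 : ℝ) : ℂ)
      * taylorCoeff F β (max t 0)‖ ≤ 4096 * M * r / R ^ 3 * (1 / 16) ^ (β.1 + β.2) := fun β t => by
    have ht : 0 ≤ max t 0 := le_max_right t 0
    generalize max t 0 = s at ht
    by_cases hβ : β.1 + β.2 ≤ 2
    · rw [hF.coeff_eq_zero β hβ s ht, mul_zero, norm_zero]
      positivity
    · obtain ⟨k, hk⟩ : ∃ k, β.1 + β.2 = k + 3 := ⟨β.1 + β.2 - 3, by omega⟩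
      have h1 := hFd.norm_taylorCoeff_le hR hM ht β
      have h2 : Real.exp (b * s) * Real.exp (-a * s) ≤ 1 := by
        rw [← Real.exp_add, Real.exp_le_one_iff]
        nlinarith
      rw [norm_mul, Complex.norm_real, Real.norm_eq_abs, abs_of_nonneg (by positivity)]
      rw [hk] at h1 ⊢
      calc _ = (Real.exp (b * s) * (r / R) ^ (k + 3) / r ^ 2)
            * (‖taylorCoeff F β s‖ * R ^ (k + 3)) := by rw [div_pow]; field_simp
        _ ≤ (Real.exp (b * s) * (r / R) ^ (k + 3) / r ^ 2) * (M * Real.exp (-a * s)) := by gcongr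
        _ = (Real.exp (b * s) * Real.exp (-a * s)) * ((r / R) ^ k * (r / R) ^ 3 / r ^ 2 * M) := by
            rw [pow_add]; ring
        _ ≤ 1 * ((1 / 16) ^ k * (r / R) ^ 3 / r ^ 2 * M) := by gcongr
        _ = _ := by rw [pow_add]; field_simp; ring
  have hcont : ∀ β : ℕ × ℕ, Continuous fun t : ℝ =>
      ((Real.exp (b * max t 0) * r ^ (β.1 + β.2) / r ^ 2 : ℝ) : ℂ)
        * taylorCoeff F β (max t 0) := fun β => by
    have h1 : Continuous fun t : ℝ => taylorCoeff F β (max t 0) :=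
      (hF.coeff_contDiffOn β).continuousOn.comp_continuous (by fun_prop) fun t => le_max_right t 0
    refine Continuous.mul ?_ h1
    fun_prop
  refine ⟨fun β => BoundedContinuousFunction.ofNormedAddCommGroup _ (hcont β) _ (hbound β),
    fun β => ?_, fun β t ht => ?_, fun h β t => ?_⟩
  · exact (BoundedContinuousFunction.norm_le (by positivity)).2 (hbound β)
  · change _ = (r : ℂ) ^ 2 * (decay b hb t * (((Real.exp (b * max t 0) * r ^ (β.1 + β.2) / r ^ 2 : ℝ)
      : ℂ) * taylorCoeff F β (max t 0)))
    have h1 : (Real.exp (-b * t) : ℂ) * (Real.exp (b * t) : ℂ) = 1 := by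
      rw [← Complex.ofReal_mul, ← Real.exp_add]; simp
    have hr' : (r : ℂ) ≠ 0 := Complex.ofReal_ne_zero.2 hr.ne'
    rw [decay_apply hb ht, max_eq_left ht, Complex.ofReal_div, Complex.ofReal_mul,
      Complex.ofReal_pow, Complex.ofReal_pow]
    generalize (Real.exp (-b * t) : ℂ) = x at *
    generalize (Real.exp (b * t) : ℂ) = y at *
    field_simp
    linear_combination -(taylorCoeff F β t) * h1
  · change (((Real.exp (b * max t 0) * r ^ (β.1 + β.2) / r ^ 2 : ℝ) : ℂ)
      * taylorCoeff F β (max t 0)).im = 0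
    rw [Complex.im_ofReal_mul, h.taylorCoeff_im hF hR (le_max_right t 0), mul_zero]

end Scaled

/-! ### The symplectic conjugacy at the level of formal series. -/

open BoundedContinuousFunction TimeSeries

namespace TimeSeries

/-- The constant series with value `c`. -/
noncomputable def scalar (c : ℂ) : TimeSeries := MvPowerSeries.C (BoundedContinuousFunction.const ℝ c)

theorem coeff_scalar_mul (c : ℂ) (f : TimeSeries) (α : Fin 2 →₀ ℕ) (t : ℝ) :
    MvPowerSeries.coeff α (scalar c * f) t = c * MvPowerSeries.coeff α f t := by
  rw [scalar, MvPowerSeries.coeff_C_mul]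
  rfl

theorem saddle_X_zero : saddle (MvPowerSeries.X 0) = -MvPowerSeries.X 0 := by
  have h1 : D 1 (MvPowerSeries.X 0) = 0 := MvPowerSeries.pderiv_X_of_ne (by decide)
  have h2 : D 0 (MvPowerSeries.X 0) = 1 := MvPowerSeries.pderiv_X_self
  rw [saddle, h1, h2]
  ring

theorem saddle_X_one : saddle (MvPowerSeries.X 1) = MvPowerSeries.X 1 := by
  have h1 : D 0 (MvPowerSeries.X 1) = 0 := MvPowerSeries.pderiv_X_of_ne (by decide)
  have h2 : D 1 (MvPowerSeries.X 1) = 1 := MvPowerSeries.pderiv_X_self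
  rw [saddle, h1, h2]
  ring

theorem saddle_add (f g : TimeSeries) : saddle (f + g) = saddle f + saddle g := by
  simp only [saddle, map_add]
  ring

variable {ω a : ℝ} (ha : 0 < a) (haω : a ≤ ω / 2) (j : ℤ) (h : Wiener (Fin 2) (ℝ →ᵇ ℂ))

/-- The solution of the inhomogeneous equation, with its exponential decay. -/
noncomputable def decaySolve : TimeSeries :=
  MvPowerSeries.C (decay a ha) * (solve ha haω j h).toSeries

theorem coeff_decaySolve (α : Fin 2 →₀ ℕ) (t : ℝ) :
    MvPowerSeries.coeff α (decaySolve ha haω j h) t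
      = decay a ha t * relax (rate ω a j α) (rate_ne_zero ha haω j α) (Wiener.coeff α h) t := by
  rw [decaySolve, MvPowerSeries.coeff_C_mul]
  rfl

/-- The shift `-a` in `rate` cancels the derivative of the weight, so the weighted solution
satisfies the original, unshifted equation. -/
theorem hasTimeDeriv_decaySolve :
    HasTimeDeriv (decaySolve ha haω j h)
      (-(scalar ω * saddle (decaySolve ha haω j h)) - scalar (j * ω) * decaySolve ha haω j h
        + MvPowerSeries.C (decay a ha) * h.toSeries) := fun α t ht => by
  have h1 := (hasDerivWithinAt_decay ha ht).mul
    (hasDerivWithinAt_relax (rate ω a j α) (Wiener.coeff α h) (rate_ne_zero ha haω j α) ht)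
  refine (h1.congr_deriv ?_).congr (fun s _ => coeff_decaySolve ha haω j h α s)
    (coeff_decaySolve ha haω j h α t)
  rw [map_add, map_sub, map_neg, BoundedContinuousFunction.add_apply,
    BoundedContinuousFunction.sub_apply, BoundedContinuousFunction.neg_apply, coeff_scalar_mul,
    coeff_scalar_mul, coeff_saddle, coeff_decaySolve, MvPowerSeries.coeff_C_mul,
    BoundedContinuousFunction.mul_apply, Wiener.coeff_toSeries]
  have hr : ((rate ω a j α : ℝ) : ℂ) = ω * ((α 1 : ℂ) - α 0 + j) - a := by
    simp [rate]
  rw [hr]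
  ring

theorem decays_decaySolve : Decays (decaySolve ha haω j h) := by
  have h0 : Decays (MvPowerSeries.C (decay a ha)) := fun α => by
    classical
    rw [MvPowerSeries.coeff_C]
    split_ifs
    · exact tendsto_decay ha
    · exact tendsto_const_nhds
  exact h0.mul_right _

/-- Modes with `α 1 - α 0 + j ≥ 1` have rate at least `ω - a > 0` and so start at zero. -/
theorem initDegreeLE_decaySolve : InitDegreeLE (-j) (decaySolve ha haω j h) := fun α hα => by
  have hpos : 0 < rate ω a j α := by
    have h1 : (1 : ℤ) ≤ (α 1 : ℤ) - (α 0 : ℤ) + j := by omega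
    have h2 : (1 : ℝ) ≤ (((α 1 : ℤ) - (α 0 : ℤ) + j : ℤ) : ℝ) := by exact_mod_cast h1
    unfold rate
    nlinarith
  rw [coeff_decaySolve, relax_zero_of_pos _ _ hpos, mul_zero]

end TimeSeries

/-- The symplectic conjugacy between the scaled perturbed saddle and the linear saddle. -/
theorem exists_symplectic_conjugacy {ω a ε : ℝ} (ha : 0 < a) (haω : a ≤ ω / 2) (hε : 0 ≤ ε)
    (hεa : ε ≤ a / 8) {f : ℕ × ℕ → ℝ →ᵇ ℂ} (hf : GeomBound ε (1 / 16) f) :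
    ∃ P Q : Wiener (Fin 2) (ℝ →ᵇ ℂ),
      (‖P - Wiener.X 0‖ ≤ 1 / 4 ∧ ‖Q - Wiener.X 1‖ ≤ 1 / 4 ∧ ‖P‖ ≤ 2 ∧ ‖Q‖ ≤ 2) ∧
      HasTimeDeriv P.toSeries (-(scalar ω * saddle P.toSeries) - scalar ω * P.toSeries
        - (Wiener.const (decay a ha) * comp (shiftSnd f) P Q).toSeries) ∧
      HasTimeDeriv Q.toSeries (-(scalar ω * saddle Q.toSeries) + scalar ω * Q.toSeries
        + (Wiener.const (decay a ha) * comp (shiftFst f) P Q).toSeries) ∧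
      (∀ α t, 0 ≤ t → MvPowerSeries.coeff α (jac P.toSeries Q.toSeries) t
        = MvPowerSeries.coeff α (1 : TimeSeries) t) ∧
      (∀ i, D i (Wiener.const (decay a ha) * comp f P Q).toSeries
        = (Wiener.const (decay a ha) * comp (shiftFst f) P Q).toSeries * D i P.toSeries
          + (Wiener.const (decay a ha) * comp (shiftSnd f) P Q).toSeries * D i Q.toSeries) ∧
      ((∀ β t, (f β t).im = 0) → P ∈ realSubring (Fin 2) ∧ Q ∈ realSubring (Fin 2)) := by
  have hω : 0 < ω := by linarith
  have hf1 : GeomBound ε (1 / 8) (shiftFst f) := by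
    have h := hf.shiftFst hε (by norm_num) (by norm_num)
    rwa [show (2 * (1 / 16) : ℝ) = 1 / 8 by norm_num] at h
  have hf2 : GeomBound ε (1 / 8) (shiftSnd f) := by
    have h := hf.shiftSnd hε (by norm_num) (by norm_num)
    rwa [show (2 * (1 / 16) : ℝ) = 1 / 8 by norm_num] at h
  obtain ⟨W, V, hW, hV, hWe, hVe, hr⟩ := exists_conjugacy ha haω hε hεa hf (norm_decay_le ha)
    (decay_im ha)
  obtain ⟨P, hPdef⟩ : ∃ P, P = nearX (decay a ha) 0 W := ⟨_, rfl⟩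
  obtain ⟨Q, hQdef⟩ : ∃ Q, Q = nearX (decay a ha) 1 V := ⟨_, rfl⟩
  rw [← hPdef, ← hQdef] at hWe hVe
  have hP2 : ‖P‖ ≤ 2 := hPdef ▸ norm_nearX_le (norm_decay_le ha) 0 hW
  have hQ2 : ‖Q‖ ≤ 2 := hQdef ▸ norm_nearX_le (norm_decay_le ha) 1 hV
  -- By the fixed-point equation the correction to the identity is itself a `decaySolve`, which
  -- supplies its evolution equation, its decay and its initial modes.
  have hPs : P.toSeries = MvPowerSeries.X 0
      + decaySolve ha haω 1 (-comp (shiftSnd f) P Q) := by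
    rw [decaySolve, hWe, hPdef, nearX, map_add, map_mul]
    rfl
  have hQs : Q.toSeries = MvPowerSeries.X 1
      + decaySolve ha haω (-1) (comp (shiftFst f) P Q) := by
    rw [decaySolve, hVe, hQdef, nearX, map_add, map_mul]
    rfl
  have hPt : HasTimeDeriv P.toSeries (-(scalar ω * saddle P.toSeries) - scalar ω * P.toSeries
      - (Wiener.const (decay a ha) * comp (shiftSnd f) P Q).toSeries) := by
    have h := (hasTimeDeriv_monomial_one (Finsupp.single 0 1)).add
      (hasTimeDeriv_decaySolve ha haω 1 (-comp (shiftSnd f) P Q))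
    have e : (MvPowerSeries.monomial (Finsupp.single 0 1) 1 : TimeSeries) = MvPowerSeries.X 0 := rfl
    rw [e, ← hPs] at h
    convert! h using 1
    rw [hPs, saddle_add, saddle_X_zero, map_neg, map_mul, Wiener.toSeries_const]
    push_cast
    rw [one_mul]
    ring
  have hQt : HasTimeDeriv Q.toSeries (-(scalar ω * saddle Q.toSeries) + scalar ω * Q.toSeries
      + (Wiener.const (decay a ha) * comp (shiftFst f) P Q).toSeries) := by
    have h := (hasTimeDeriv_monomial_one (Finsupp.single 1 1)).add
      (hasTimeDeriv_decaySolve ha haω (-1) (comp (shiftFst f) P Q))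
    have e : (MvPowerSeries.monomial (Finsupp.single 1 1) 1 : TimeSeries) = MvPowerSeries.X 1 := rfl
    have e2 : scalar (((-1 : ℤ) : ℂ) * ω) = -scalar ω := by
      rw [scalar, scalar, ← map_neg]
      congr 1
      ext t
      simp
    rw [e, ← hQs, e2] at h
    convert! h using 1
    rw [hQs, saddle_add, saddle_X_one, map_mul, Wiener.toSeries_const]
    ring
  have hD : ∀ {g : ℕ × ℕ → ℝ →ᵇ ℂ} {K : ℝ}, GeomBound ε K g → 0 ≤ K → 4 * K < 1 → ∀ i,
      D i (Wiener.const (decay a ha) * comp g P Q).toSeries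
        = (Wiener.const (decay a ha) * comp (shiftFst g) P Q).toSeries * D i P.toSeries
          + (Wiener.const (decay a ha) * comp (shiftSnd g) P Q).toSeries * D i Q.toSeries :=
    fun {g K} hg hK hK1 i => by
      simp only [map_mul, Wiener.toSeries_const, Derivation.leibniz, smul_eq_mul,
        MvPowerSeries.pderiv_C, pderiv_comp hε hg hK hK1 hP2 hQ2]
      ring
  refine ⟨P, Q, ⟨?_, ?_, hP2, hQ2⟩, hPt, hQt, fun α t ht => ?_,
    hD hf (by norm_num) (by norm_num), fun h => ?_⟩
  · rw [hPdef, nearX, add_sub_cancel_left]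
    exact (norm_const_mul_le (norm_decay_le ha) W).trans hW
  · rw [hQdef, nearX, add_sub_cancel_left]
    exact (norm_const_mul_le (norm_decay_le ha) V).trans hV
  · have hA := hD hf1 (by norm_num) (by norm_num)
    have hB := hD hf2 (by norm_num) (by norm_num)
    rw [shiftSnd_shiftFst] at hA
    rw [hPs] at hPt hA hB ⊢
    rw [hQs] at hQt hA hB ⊢
    exact coeff_jac_eq hω hPt hQt hA hB (decays_decaySolve _ _ _ _) (decays_decaySolve _ _ _ _)
      (initDegreeLE_decaySolve ha haω 1 _) (neg_neg (1 : ℤ) ▸ initDegreeLE_decaySolve ha haω (-1) _) α ht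
  · rw [hPdef, hQdef]
    exact ⟨nearX_mem_realSubring (decay_im ha) 0 (hr h).1,
      nearX_mem_realSubring (decay_im ha) 1 (hr h).2⟩

/-- Evaluation is a ring homomorphism of norm at most one on the Wiener algebra, so it passes
through the infinite sum defining `comp`. -/
theorem TimeSeries.eval_comp {ε K : ℝ} {g : ℕ × ℕ → ℝ →ᵇ ℂ} {P Q : Wiener (Fin 2) (ℝ →ᵇ ℂ)}
    (hg : GeomBound ε K g) (hK : 0 ≤ K) (hK1 : 2 * K < 1) (hP : ‖P‖ ≤ 2) (hQ : ‖Q‖ ≤ 2) {p q : ℂ}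
    (hp : ‖p‖ < 1) (hq : ‖q‖ < 1) (t : ℝ) :
    HasSum (fun β : ℕ × ℕ => g β t * (eval p q t P.toSeries ^ β.1 * eval p q t Q.toSeries ^ β.2))
      (eval p q t (comp g P Q).toSeries) := by
  let E : Wiener (Fin 2) (ℝ →ᵇ ℂ) →+* ℂ :=
    { toFun := fun W => eval p q t W.toSeries
      map_one' := by rw [map_one, eval_one]
      map_zero' := by simp [eval]
      map_add' := fun x y => by
        rw [map_add]
        exact eval_add hp hq t (converges_toSeries x) (converges_toSeries y)
      map_mul' := fun x y => by
        rw [map_mul]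
        exact eval_mul hp hq t (converges_toSeries x) (converges_toSeries y) }
  have hE : Continuous E := AddMonoidHomClass.continuous_of_bound E 1 fun W => by
    rw [one_mul]
    exact norm_eval_toSeries_le hp.le hq.le t W
  refine ((hasSum_comp hg hK hK1 hP hQ).map E hE).congr_fun fun β => ?_
  have hc : E (Wiener.const (g β)) = g β t := eval_C p q t (g β)
  simp only [Function.comp, compTerm, map_mul, map_pow, hc]
  rfl

/-! ### The change of variables and its Poisson brackets. -/

section NormalForm

/-- The change of variables `(p, q, η) ↦ (P, Q, E)` built from scaled series. -/
noncomputable def normalFormMap (ω r : ℝ) (P Q G : TimeSeries) (t : ℝ) (z : ℂ × ℂ × ℂ) :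
    ℂ × ℂ × ℂ :=
  (r * eval (z.1 / r) (z.2.1 / r) t P, r * eval (z.1 / r) (z.2.1 / r) t Q,
    z.2.2 + ω * (z.1 * z.2.1
      - (r * eval (z.1 / r) (z.2.1 / r) t P) * (r * eval (z.1 / r) (z.2.1 / r) t Q))
      - r ^ 2 * eval (z.1 / r) (z.2.1 / r) t G)

variable {ω r : ℝ} {P Q G A B f : TimeSeries}

theorem norm_div_le_half (hr : 0 < r) {p : ℂ} (hp : ‖p‖ ≤ r / 2) : ‖p / r‖ ≤ 1 / 2 := by
  rw [norm_div, Complex.norm_real, Real.norm_eq_abs, abs_of_pos hr, div_le_iff₀ hr]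
  linarith

theorem hasDerivAt_scaled_fst (hf : Converges f) (hr : 0 < r) {p q : ℂ} (hp : ‖p‖ ≤ r / 2)
    (hq : ‖q‖ ≤ r / 2) (t : ℝ) :
    HasDerivAt (fun p => eval (p / r) (q / r) t f) (eval (p / r) (q / r) t (D 0 f) / r) p := by
  have h := hasDerivAt_eval_fst hf ((norm_div_le_half hr hp).trans_lt (by norm_num))
    ((norm_div_le_half hr hq).trans_lt (by norm_num)) t
  have h2 : HasDerivAt (fun p => eval (p / r) (q / r) t f)
      (eval (p / r) (q / r) t (D 0 f) * (1 / r)) p :=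
    HasDerivAt.comp (h₂ := fun x => eval x (q / r) t f) (h := fun p => p / (r : ℂ)) p h
      ((hasDerivAt_id p).div_const (r : ℂ))
  rwa [mul_one_div] at h2

theorem hasDerivAt_scaled_snd (hf : Converges f) (hr : 0 < r) {p q : ℂ} (hp : ‖p‖ ≤ r / 2)
    (hq : ‖q‖ ≤ r / 2) (t : ℝ) :
    HasDerivAt (fun q => eval (p / r) (q / r) t f) (eval (p / r) (q / r) t (D 1 f) / r) q := by
  have h := hasDerivAt_eval_snd hf ((norm_div_le_half hr hp).trans_lt (by norm_num))
    ((norm_div_le_half hr hq).trans_lt (by norm_num)) t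
  have h2 : HasDerivAt (fun q => eval (p / r) (q / r) t f)
      (eval (p / r) (q / r) t (D 1 f) * (1 / r)) q :=
    HasDerivAt.comp (h₂ := fun x => eval (p / r) x t f) (h := fun q => q / (r : ℂ)) q h
      ((hasDerivAt_id q).div_const (r : ℂ))
  rwa [mul_one_div] at h2

theorem analyticAt_scaled (hf : Converges f) (hr : 0 < r) {z : ℂ × ℂ × ℂ} (hz : z ∈ domain (r / 2))
    (t : ℝ) : AnalyticAt ℂ (fun z : ℂ × ℂ × ℂ => eval (z.1 / r) (z.2.1 / r) t f) z := by
  have h1 := (norm_div_le_half hr hz.1.1).trans_lt (by norm_num : (1 / 2 : ℝ) < 1)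
  have h2 := (norm_div_le_half hr hz.1.2).trans_lt (by norm_num : (1 / 2 : ℝ) < 1)
  have hr' : (r : ℂ) ≠ 0 := Complex.ofReal_ne_zero.2 hr.ne'
  have e1 : AnalyticAt ℂ (fun z : ℂ × ℂ × ℂ => z.1) z := analyticAt_fst
  have e2 : AnalyticAt ℂ (fun z : ℂ × ℂ × ℂ => z.2.1) z :=
    (analyticAt_fst (𝕜 := ℂ) (E := ℂ) (F := ℂ)).comp analyticAt_snd
  have h := analyticAt_eval hf t (z := (z.1 / (r : ℂ), z.2.1 / (r : ℂ))) h1 h2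
  generalize hg : (fun z : ℂ × ℂ => eval z.1 z.2 t f) = g at h
  have hg' : ∀ x y, eval x y t f = g (x, y) := fun x y => by rw [← hg]
  simp only [hg']
  have e3 : AnalyticAt ℂ (fun z : ℂ × ℂ × ℂ => z.1 / (r : ℂ)) z := e1.div analyticAt_const hr'
  have e4 : AnalyticAt ℂ (fun z : ℂ × ℂ × ℂ => z.2.1 / (r : ℂ)) z := e2.div analyticAt_const hr'
  exact AnalyticAt.comp₂ (f := fun z : ℂ × ℂ × ℂ => z.1 / (r : ℂ))
    (g := fun z : ℂ × ℂ × ℂ => z.2.1 / (r : ℂ)) (x := z) h e3 e4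

theorem analyticOnNhd_normalFormMap (hP : Converges P) (hQ : Converges Q) (hG : Converges G)
    (hr : 0 < r) (t : ℝ) : AnalyticOnNhd ℂ (normalFormMap ω r P Q G t) (domain (r / 2)) :=
  fun z hz => by
    have e1 : AnalyticAt ℂ (fun z : ℂ × ℂ × ℂ => z.1) z := analyticAt_fst
    have e2 : AnalyticAt ℂ (fun z : ℂ × ℂ × ℂ => z.2.1) z :=
      (analyticAt_fst (𝕜 := ℂ) (E := ℂ) (F := ℂ)).comp analyticAt_snd
    have e3 : AnalyticAt ℂ (fun z : ℂ × ℂ × ℂ => z.2.2) z :=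
      (analyticAt_snd (𝕜 := ℂ) (E := ℂ) (F := ℂ)).comp analyticAt_snd
    have hp := (analyticAt_const (v := (r : ℂ))).mul (analyticAt_scaled hP hr hz t)
    have hq := (analyticAt_const (v := (r : ℂ))).mul (analyticAt_scaled hQ hr hz t)
    have hg := (analyticAt_const (v := (r : ℂ) ^ 2)).mul (analyticAt_scaled hG hr hz t)
    exact hp.prod (hq.prod ((e3.add ((analyticAt_const (v := (ω : ℂ))).mul
      ((e1.mul e2).sub (hp.mul hq)))).sub hg))

/-- In scaled variables the `(p, q)` part is the identity plus a map of Lipschitz constant at most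
`1/4 * 2 = 1/2` on the half-polydisc, hence injective; for fixed `(p, q)` the last component is a
translation in `η`. -/
theorem injOn_normalFormMap {P Q : Wiener (Fin 2) (ℝ →ᵇ ℂ)} (hP : ‖P - Wiener.X 0‖ ≤ 1 / 4)
    (hQ : ‖Q - Wiener.X 1‖ ≤ 1 / 4) (hr : 0 < r) (t : ℝ) :
    InjOn (normalFormMap ω r P.toSeries Q.toSeries G t) (domain (r / 2)) := by
  rintro ⟨p, q, η⟩ hz ⟨p', q', η'⟩ hz' heq
  have hr' : (r : ℂ) ≠ 0 := Complex.ofReal_ne_zero.2 hr.ne'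
  have n1 := norm_div_le_half hr hz.1.1
  have n2 := norm_div_le_half hr hz.1.2
  have n1' := norm_div_le_half hr hz'.1.1
  have n2' := norm_div_le_half hr hz'.1.2
  simp only at n1 n2 n1' n2'
  simp only [normalFormMap, Prod.mk.injEq] at heq
  obtain ⟨h1, h2, h3⟩ := heq
  have h1 := mul_left_cancel₀ hr' h1
  have h2 := mul_left_cancel₀ hr' h2
  have key : p / (r : ℂ) = p' / r ∧ q / (r : ℂ) = q' / r := by
    generalize p / (r : ℂ) = x at *
    generalize q / (r : ℂ) = y at *
    generalize p' / (r : ℂ) = x' at *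
    generalize q' / (r : ℂ) = y' at *
    have hsub : ∀ (W : Wiener (Fin 2) (ℝ →ᵇ ℂ)) (i : Fin 2) {x y : ℂ}, ‖x‖ ≤ 1 / 2 →
        ‖y‖ ≤ 1 / 2 → eval x y t (W - Wiener.X i).toSeries
          = eval x y t W.toSeries - eval x y t (MvPowerSeries.X i) := fun W i x y hx hy => by
      rw [map_sub, Wiener.toSeries_X, eval_sub (by linarith) (by linarith) t
        (converges_toSeries W) (converges_X i)]
    have k1 := norm_eval_sub_le n1 n2 n1' n2' (le_max_left ‖x - x'‖ ‖y - y'‖)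
      (le_max_right ‖x - x'‖ ‖y - y'‖) t (P - Wiener.X 0)
    have k2 := norm_eval_sub_le n1 n2 n1' n2' (le_max_left ‖x - x'‖ ‖y - y'‖)
      (le_max_right ‖x - x'‖ ‖y - y'‖) t (Q - Wiener.X 1)
    rw [hsub P 0 n1 n2, hsub P 0 n1' n2', h1, eval_X_zero, eval_X_zero, sub_sub_sub_cancel_left,
      norm_sub_rev] at k1
    rw [hsub Q 1 n1 n2, hsub Q 1 n1' n2', h2, eval_X_one, eval_X_one, sub_sub_sub_cancel_left,
      norm_sub_rev] at k2
    have hd : 0 ≤ max ‖x - x'‖ ‖y - y'‖ := le_max_of_le_left (norm_nonneg _)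
    have hm : max ‖x - x'‖ ‖y - y'‖ ≤ 1 / 2 * max ‖x - x'‖ ‖y - y'‖ := by
      refine max_le (k1.trans ?_) (k2.trans ?_) <;> nlinarith
    have h0 : max ‖x - x'‖ ‖y - y'‖ ≤ 0 := by linarith
    exact ⟨sub_eq_zero.1 (norm_le_zero_iff.1 ((le_max_left _ _).trans h0)),
      sub_eq_zero.1 (norm_le_zero_iff.1 ((le_max_right _ _).trans h0))⟩
  have hp : p = p' := by simpa [hr'] using key.1
  have hq : q = q' := by simpa [hr'] using key.2
  subst hp hq
  simpa using h3

theorem eval_saddle (hf : Converges f) {p q : ℂ} (hp : ‖p‖ < 1) (hq : ‖q‖ < 1) (t : ℝ) :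
    eval p q t (saddle f) = q * eval p q t (D 1 f) - p * eval p q t (D 0 f) := by
  rw [saddle, eval_sub hp hq t ((converges_X 1).mul (hf.D 1)) ((converges_X 0).mul (hf.D 0)),
    eval_mul hp hq t (converges_X 1) (hf.D 1), eval_mul hp hq t (converges_X 0) (hf.D 0),
    eval_X_zero, eval_X_one]

theorem eval_scalar_mul (hf : Converges f) {p q : ℂ} (hp : ‖p‖ < 1) (hq : ‖q‖ < 1) (t : ℝ)
    (c : ℂ) : eval p q t (scalar c * f) = c * eval p q t f := by
  rw [scalar, eval_mul hp hq t (converges_C _) hf, eval_C]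
  rfl

theorem TimeSeries.Converges.saddle (hf : Converges f) : Converges (TimeSeries.saddle f) :=
  ((converges_X 1).mul (hf.D 1)).sub ((converges_X 0).mul (hf.D 0))

/-- `{Q, P}` is the Jacobian. Since `P_η = 0` and `E_η = 1`, `{P, E} = P_t + P_q E_p - P_p E_q`;
inserting the derivatives of `E`, with `A` and `B` in the roles of `F_p` and `F_q` along the map,
and using `J = 1` leaves exactly the evolution equation of `P`. The same works for `Q`, and `E_t`
only occurs multiplied by zero. -/
theorem isCanonicalFamily_normalFormMap {P Q : Wiener (Fin 2) (ℝ →ᵇ ℂ)}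
    (hPX : ‖P - Wiener.X 0‖ ≤ 1 / 4) (hQX : ‖Q - Wiener.X 1‖ ≤ 1 / 4) (hr : 0 < r)
    (hG : Converges G) (hA : Converges A) (hB : Converges B)
    (hPt : HasTimeDeriv P.toSeries (-(scalar ω * saddle P.toSeries) - scalar ω * P.toSeries - B))
    (hQt : HasTimeDeriv Q.toSeries (-(scalar ω * saddle Q.toSeries) + scalar ω * Q.toSeries + A))
    (hjac : ∀ α t, 0 ≤ t → MvPowerSeries.coeff α (jac P.toSeries Q.toSeries) t
        = MvPowerSeries.coeff α (1 : TimeSeries) t)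
    (hGD : ∀ i, D i G = A * D i P.toSeries + B * D i Q.toSeries) :
    IsCanonicalFamily (normalFormMap ω r P.toSeries Q.toSeries G) (domain (r / 2)) := by
  have hinj := fun t => injOn_normalFormMap (ω := ω) (G := G) hPX hQX hr t
  have hPc := converges_toSeries P
  have hQc := converges_toSeries Q
  generalize P.toSeries = P₁ at *
  generalize Q.toSeries = Q₁ at *
  have hr' : (r : ℂ) ≠ 0 := Complex.ofReal_ne_zero.2 hr.ne'
  have hdp : ∀ {f : TimeSeries}, Converges f → ∀ z ∈ domain (r / 2), ∀ t,
      HasDerivAt (fun p => eval (p / r) (z.2.1 / r) t f)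
        (eval (z.1 / r) (z.2.1 / r) t (D 0 f) / r) z.1 := fun hf z hz t =>
    hasDerivAt_scaled_fst hf hr hz.1.1 hz.1.2 t
  have hdq : ∀ {f : TimeSeries}, Converges f → ∀ z ∈ domain (r / 2), ∀ t,
      HasDerivAt (fun q => eval (z.1 / r) (q / r) t f)
        (eval (z.1 / r) (z.2.1 / r) t (D 1 f) / r) z.2.1 := fun hf z hz t =>
    hasDerivAt_scaled_snd hf hr hz.1.1 hz.1.2 t
  have hx : ∀ z ∈ domain (r / 2), ‖z.1 / (r : ℂ)‖ < 1 := fun z hz =>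
    (norm_div_le_half hr hz.1.1).trans_lt (by norm_num)
  have hy : ∀ z ∈ domain (r / 2), ‖z.2.1 / (r : ℂ)‖ < 1 := fun z hz =>
    (norm_div_le_half hr hz.1.2).trans_lt (by norm_num)
  have hwP : Converges (scalar ω * saddle P₁) := (converges_C _).mul hPc.saddle
  have hwP' : Converges (scalar ω * P₁) := (converges_C _).mul hPc
  have hwQ : Converges (scalar ω * saddle Q₁) := (converges_C _).mul hQc.saddle
  have hwQ' : Converges (scalar ω * Q₁) := (converges_C _).mul hQc
  have hPtime : ∀ t, 0 ≤ t → ∀ z ∈ domain (r / 2), HasDerivWithinAt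
      (fun s => (normalFormMap ω r P₁ Q₁ G s z).1)
      (r * (-(ω * (z.2.1 / r * eval (z.1 / r) (z.2.1 / r) t (D 1 P₁)
        - z.1 / r * eval (z.1 / r) (z.2.1 / r) t (D 0 P₁)))
        - ω * eval (z.1 / r) (z.2.1 / r) t P₁ - eval (z.1 / r) (z.2.1 / r) t B)) (Ici 0) t :=
    fun t ht z hz => by
      have h := (hPt.eval hPc ((hwP.neg.sub hwP').sub hB) (hx z hz) (hy z hz) ht).const_mul (r : ℂ)
      rwa [eval_sub (hx z hz) (hy z hz) t (hwP.neg.sub hwP') hB,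
        eval_sub (hx z hz) (hy z hz) t hwP.neg hwP', eval_neg,
        eval_scalar_mul hPc.saddle (hx z hz) (hy z hz), eval_saddle hPc (hx z hz) (hy z hz),
        eval_scalar_mul hPc (hx z hz) (hy z hz)] at h
  have hQtime : ∀ t, 0 ≤ t → ∀ z ∈ domain (r / 2), HasDerivWithinAt
      (fun s => (normalFormMap ω r P₁ Q₁ G s z).2.1)
      (r * (-(ω * (z.2.1 / r * eval (z.1 / r) (z.2.1 / r) t (D 1 Q₁)
        - z.1 / r * eval (z.1 / r) (z.2.1 / r) t (D 0 Q₁)))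
        + ω * eval (z.1 / r) (z.2.1 / r) t Q₁ + eval (z.1 / r) (z.2.1 / r) t A)) (Ici 0) t :=
    fun t ht z hz => by
      have h := (hQt.eval hQc ((hwQ.neg.add hwQ').add hA) (hx z hz) (hy z hz) ht).const_mul (r : ℂ)
      rwa [eval_add (hx z hz) (hy z hz) t (hwQ.neg.add hwQ') hA,
        eval_add (hx z hz) (hy z hz) t hwQ.neg hwQ', eval_neg,
        eval_scalar_mul hQc.saddle (hx z hz) (hy z hz), eval_saddle hQc (hx z hz) (hy z hz),
        eval_scalar_mul hQc (hx z hz) (hy z hz)] at h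
  have hdpP : ∀ t, ∀ z ∈ domain (r / 2), dp (fun w s => (normalFormMap ω r P₁ Q₁ G s w).1) z t
      = eval (z.1 / r) (z.2.1 / r) t (D 0 P₁) := fun t z hz =>
    (((hdp hPc z hz t).const_mul (r : ℂ)).congr_deriv (mul_div_cancel₀ _ hr')).deriv
  have hdqP : ∀ t, ∀ z ∈ domain (r / 2), dq (fun w s => (normalFormMap ω r P₁ Q₁ G s w).1) z t
      = eval (z.1 / r) (z.2.1 / r) t (D 1 P₁) := fun t z hz =>
    (((hdq hPc z hz t).const_mul (r : ℂ)).congr_deriv (mul_div_cancel₀ _ hr')).deriv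
  have hdpQ : ∀ t, ∀ z ∈ domain (r / 2), dp (fun w s => (normalFormMap ω r P₁ Q₁ G s w).2.1) z t
      = eval (z.1 / r) (z.2.1 / r) t (D 0 Q₁) := fun t z hz =>
    (((hdp hQc z hz t).const_mul (r : ℂ)).congr_deriv (mul_div_cancel₀ _ hr')).deriv
  have hdqQ : ∀ t, ∀ z ∈ domain (r / 2), dq (fun w s => (normalFormMap ω r P₁ Q₁ G s w).2.1) z t
      = eval (z.1 / r) (z.2.1 / r) t (D 1 Q₁) := fun t z hz =>
    (((hdq hQc z hz t).const_mul (r : ℂ)).congr_deriv (mul_div_cancel₀ _ hr')).deriv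
  have hdetaP : ∀ t z, deta (fun w s => (normalFormMap ω r P₁ Q₁ G s w).1) z t = 0 :=
    fun t z => deriv_const z.2.2 (r * eval (z.1 / r) (z.2.1 / r) t P₁)
  have hdetaQ : ∀ t z, deta (fun w s => (normalFormMap ω r P₁ Q₁ G s w).2.1) z t = 0 :=
    fun t z => deriv_const z.2.2 (r * eval (z.1 / r) (z.2.1 / r) t Q₁)
  have hdetaE : ∀ t z, deta (fun w s => (normalFormMap ω r P₁ Q₁ G s w).2.2) z t = 1 :=
    fun t z => (((hasDerivAt_id z.2.2).add_const (ω * (z.1 * z.2.1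
      - (r * eval (z.1 / r) (z.2.1 / r) t P₁) * (r * eval (z.1 / r) (z.2.1 / r) t Q₁)))).sub_const
      (r ^ 2 * eval (z.1 / r) (z.2.1 / r) t G)).deriv
  have hdtP : ∀ t, 0 ≤ t → ∀ z ∈ domain (r / 2),
      dt (fun w s => (normalFormMap ω r P₁ Q₁ G s w).1) z t = _ := fun t ht z hz =>
    (hPtime t ht z hz).derivWithin (uniqueDiffOn_Ici 0 t ht)
  have hdtQ : ∀ t, 0 ≤ t → ∀ z ∈ domain (r / 2),
      dt (fun w s => (normalFormMap ω r P₁ Q₁ G s w).2.1) z t = _ := fun t ht z hz =>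
    (hQtime t ht z hz).derivWithin (uniqueDiffOn_Ici 0 t ht)
  have hdpT : ∀ t z, dp (fun _ s => (s : ℂ)) z t = 0 := fun t z => deriv_const _ _
  have hdqT : ∀ t z, dq (fun _ s => (s : ℂ)) z t = 0 := fun t z => deriv_const _ _
  have hdetaT : ∀ t z, deta (fun _ s => (s : ℂ)) z t = 0 := fun t z => deriv_const _ _
  have hdtT : ∀ t, 0 ≤ t → ∀ z, dt (fun _ s => (s : ℂ)) z t = 1 := fun t ht z =>
    ((hasDerivAt_id t).ofReal_comp.hasDerivWithinAt.derivWithin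
      (uniqueDiffOn_Ici 0 t ht)).trans Complex.ofReal_one
  have hGD' : ∀ i, ∀ t, ∀ z ∈ domain (r / 2), eval (z.1 / r) (z.2.1 / r) t (D i G)
      = eval (z.1 / r) (z.2.1 / r) t A * eval (z.1 / r) (z.2.1 / r) t (D i P₁)
        + eval (z.1 / r) (z.2.1 / r) t B * eval (z.1 / r) (z.2.1 / r) t (D i Q₁) :=
    fun i t z hz => by
      rw [hGD, eval_add (hx z hz) (hy z hz) t (hA.mul (hPc.D i)) (hB.mul (hQc.D i)),
        eval_mul (hx z hz) (hy z hz) t hA (hPc.D i), eval_mul (hx z hz) (hy z hz) t hB (hQc.D i)]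
  have hdpE : ∀ t, ∀ z ∈ domain (r / 2), dp (fun w s => (normalFormMap ω r P₁ Q₁ G s w).2.2) z t
      = ω * (z.2.1 - (eval (z.1 / r) (z.2.1 / r) t (D 0 P₁) * (r * eval (z.1 / r) (z.2.1 / r) t Q₁)
          + r * eval (z.1 / r) (z.2.1 / r) t P₁ * eval (z.1 / r) (z.2.1 / r) t (D 0 Q₁)))
        - r * eval (z.1 / r) (z.2.1 / r) t (D 0 G) := fun t z hz => by
    refine HasDerivAt.deriv (((((((hasDerivAt_id z.1).mul_const z.2.1).sub
      (((hdp hPc z hz t).const_mul (r : ℂ)).mul ((hdp hQc z hz t).const_mul (r : ℂ)))).const_mul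
      (ω : ℂ)).const_add z.2.2).sub ((hdp hG z hz t).const_mul ((r : ℂ) ^ 2))).congr_deriv ?_)
    field_simp
  have hdqE : ∀ t, ∀ z ∈ domain (r / 2), dq (fun w s => (normalFormMap ω r P₁ Q₁ G s w).2.2) z t
      = ω * (z.1 - (eval (z.1 / r) (z.2.1 / r) t (D 1 P₁) * (r * eval (z.1 / r) (z.2.1 / r) t Q₁)
          + r * eval (z.1 / r) (z.2.1 / r) t P₁ * eval (z.1 / r) (z.2.1 / r) t (D 1 Q₁)))
        - r * eval (z.1 / r) (z.2.1 / r) t (D 1 G) := fun t z hz => by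
    refine HasDerivAt.deriv (((((((hasDerivAt_id z.2.1).const_mul z.1).sub
      (((hdq hPc z hz t).const_mul (r : ℂ)).mul ((hdq hQc z hz t).const_mul (r : ℂ)))).const_mul
      (ω : ℂ)).const_add z.2.2).sub ((hdq hG z hz t).const_mul ((r : ℂ) ^ 2))).congr_deriv ?_)
    field_simp
  have hj : ∀ t, 0 ≤ t → ∀ z ∈ domain (r / 2),
      eval (z.1 / r) (z.2.1 / r) t (D 0 P₁) * eval (z.1 / r) (z.2.1 / r) t (D 1 Q₁)
        - eval (z.1 / r) (z.2.1 / r) t (D 1 P₁) * eval (z.1 / r) (z.2.1 / r) t (D 0 Q₁) = 1 :=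
    fun t ht z hz => by
      rw [← eval_mul (hx z hz) (hy z hz) t (hPc.D 0) (hQc.D 1),
        ← eval_mul (hx z hz) (hy z hz) t (hPc.D 1) (hQc.D 0),
        ← eval_sub (hx z hz) (hy z hz) t ((hPc.D 0).mul (hQc.D 1)) ((hPc.D 1).mul (hQc.D 0)),
        ← eval_one (z.1 / r) (z.2.1 / r) t]
      -- The Jacobian identity is known only for `t ≥ 0`, not as an identity of series over bounded
      -- functions on the whole line; evaluation sees only the coefficients at the single time `t`.
      exact tsum_congr fun α => congrArg (· * mono _ _ α) (hjac α t ht)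
  refine ⟨fun t _ => analyticOnNhd_normalFormMap hPc hQc hG hr t, fun t _ => hinj t,
    fun t ht z hz => (hPtime t ht z hz).differentiableWithinAt,
    fun t ht z hz => (hQtime t ht z hz).differentiableWithinAt, fun t ht z hz => ?_,
    fun t ht z hz => ?_, fun t ht z hz => ?_, fun t ht z hz => ?_, fun t ht z hz => ?_,
    fun t ht z hz => ?_⟩
  · rw [poisson, hdqQ t z hz, hdpP t z hz, hdpQ t z hz, hdqP t z hz, hdetaP, hdetaQ]
    linear_combination hj t ht z hz
  · rw [poisson, hdqT, hdpT, hdetaT, hdetaE, hdtT t ht]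
    ring
  · rw [poisson, hdqT, hdpT, hdetaT, hdetaP]
    ring
  · rw [poisson, hdqT, hdpT, hdetaT, hdetaQ]
    ring
  · rw [poisson, hdetaP, hdetaE, hdpP t z hz, hdqP t z hz, hdpE t z hz, hdqE t z hz,
      hdtP t ht z hz, hGD' 0 t z hz, hGD' 1 t z hz]
    have h := hj t ht z hz
    have e1 : (r : ℂ) * (z.1 / r) = z.1 := mul_div_cancel₀ _ hr'
    have e2 : (r : ℂ) * (z.2.1 / r) = z.2.1 := mul_div_cancel₀ _ hr'
    generalize eval (z.1 / r) (z.2.1 / r) t (D 0 P₁) = a₁ at *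
    generalize eval (z.1 / r) (z.2.1 / r) t (D 1 P₁) = a₂ at *
    generalize eval (z.1 / r) (z.2.1 / r) t (D 0 Q₁) = a₃ at *
    generalize eval (z.1 / r) (z.2.1 / r) t (D 1 Q₁) = a₄ at *
    generalize eval (z.1 / r) (z.2.1 / r) t P₁ = a₅ at *
    generalize eval (z.1 / r) (z.2.1 / r) t Q₁ = a₆ at *
    generalize eval (z.1 / r) (z.2.1 / r) t A = a₇ at *
    generalize eval (z.1 / r) (z.2.1 / r) t B = a₈ at *
    linear_combination (r * (ω * a₅ + a₈)) * h + ω * a₁ * e1 - ω * a₂ * e2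
  · rw [poisson, hdetaQ, hdetaE, hdpQ t z hz, hdqQ t z hz, hdpE t z hz, hdqE t z hz,
      hdtQ t ht z hz, hGD' 0 t z hz, hGD' 1 t z hz]
    have h := hj t ht z hz
    have e1 : (r : ℂ) * (z.1 / r) = z.1 := mul_div_cancel₀ _ hr'
    have e2 : (r : ℂ) * (z.2.1 / r) = z.2.1 := mul_div_cancel₀ _ hr'
    generalize eval (z.1 / r) (z.2.1 / r) t (D 0 P₁) = a₁ at *
    generalize eval (z.1 / r) (z.2.1 / r) t (D 1 P₁) = a₂ at *
    generalize eval (z.1 / r) (z.2.1 / r) t (D 0 Q₁) = a₃ at *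
    generalize eval (z.1 / r) (z.2.1 / r) t (D 1 Q₁) = a₄ at *
    generalize eval (z.1 / r) (z.2.1 / r) t P₁ = a₅ at *
    generalize eval (z.1 / r) (z.2.1 / r) t Q₁ = a₆ at *
    generalize eval (z.1 / r) (z.2.1 / r) t A = a₇ at *
    generalize eval (z.1 / r) (z.2.1 / r) t B = a₈ at *
    linear_combination -(r * (ω * a₆ + a₇)) * h + ω * a₃ * e1 - ω * a₄ * e2

end NormalForm

/-! ### Range, reality, and assembly of the normal form. -/

theorem norm_eval_le_of_near {P : Wiener (Fin 2) (ℝ →ᵇ ℂ)} {i : Fin 2}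
    (hP : ‖P - Wiener.X i‖ ≤ 1 / 4) {x y : ℂ} (hx : ‖x‖ ≤ 1 / 2) (hy : ‖y‖ ≤ 1 / 2) (t : ℝ) :
    ‖eval x y t P.toSeries‖ ≤ 3 / 4 := by
  have h1 := norm_eval_toSeries_le (by linarith) (by linarith : ‖y‖ ≤ 1) t (P - Wiener.X i) (p := x)
  rw [map_sub, Wiener.toSeries_X, eval_sub (by linarith) (by linarith) t
    (converges_toSeries P) (converges_X i)] at h1
  have h2 : ‖eval x y t (MvPowerSeries.X i)‖ ≤ 1 / 2 := by
    fin_cases i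
    · exact (congrArg norm (eval_X_zero x y t)).trans_le hx
    · exact (congrArg norm (eval_X_one x y t)).trans_le hy
  have h3 := norm_add_le (eval x y t P.toSeries - eval x y t (MvPowerSeries.X i))
    (eval x y t (MvPowerSeries.X i))
  rw [sub_add_cancel] at h3
  linarith

/-- The energy component moves by at most `r²/4 + r² + r²`, which is below `r/2` when `r ≤ 1/6`; the
other two components have modulus at most `3r/4`. -/
theorem mapsTo_normalFormMap {ω r : ℝ} (hω : 0 < ω) (hω1 : ω ≤ 1) (hr : 0 < r) (hr6 : r ≤ 1 / 6)
    {P Q G : Wiener (Fin 2) (ℝ →ᵇ ℂ)} (hP : ‖P - Wiener.X 0‖ ≤ 1 / 4)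
    (hQ : ‖Q - Wiener.X 1‖ ≤ 1 / 4) (hG : ‖G‖ ≤ 1) (t : ℝ) :
    MapsTo (normalFormMap ω r P.toSeries Q.toSeries G.toSeries t) (domain (r / 2)) (domain r) := by
  rintro z ⟨⟨h1, h2⟩, h3⟩
  have n1 := norm_div_le_half hr h1
  have n2 := norm_div_le_half hr h2
  have hp := norm_eval_le_of_near hP n1 n2 t
  have hq := norm_eval_le_of_near hQ n1 n2 t
  have hg := (norm_eval_toSeries_le (by linarith) (by linarith : ‖z.2.1 / (r : ℂ)‖ ≤ 1) t G
    (p := z.1 / (r : ℂ))).trans hG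
  have hrp : ‖(r : ℂ) * eval (z.1 / r) (z.2.1 / r) t P.toSeries‖ ≤ r := by
    rw [norm_mul, Complex.norm_real, Real.norm_eq_abs, abs_of_pos hr]
    nlinarith
  have hrq : ‖(r : ℂ) * eval (z.1 / r) (z.2.1 / r) t Q.toSeries‖ ≤ r := by
    rw [norm_mul, Complex.norm_real, Real.norm_eq_abs, abs_of_pos hr]
    nlinarith
  refine ⟨⟨hrp, hrq⟩, ?_⟩
  change |(z.2.2 + ω * (z.1 * z.2.1 - _) - r ^ 2 * _).im| ≤ r
  have ha : ‖(ω : ℂ) * (z.1 * z.2.1 - (r * eval (z.1 / r) (z.2.1 / r) t P.toSeries)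
      * (r * eval (z.1 / r) (z.2.1 / r) t Q.toSeries))‖ ≤ r / 2 * (r / 2) + r * r := by
    rw [norm_mul, Complex.norm_real, Real.norm_eq_abs, abs_of_pos hω]
    refine (mul_le_of_le_one_left (norm_nonneg _) hω1).trans ((norm_sub_le _ _).trans ?_)
    rw [norm_mul, norm_mul]
    gcongr
  have hb : ‖(r : ℂ) ^ 2 * eval (z.1 / r) (z.2.1 / r) t G.toSeries‖ ≤ r ^ 2 := by
    rw [norm_mul, norm_pow, Complex.norm_real, Real.norm_eq_abs, abs_of_pos hr]
    exact mul_le_of_le_one_right (by positivity) hg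
  rw [Complex.sub_im, Complex.add_im]
  have ha' := (Complex.abs_im_le_norm _).trans ha
  have hb' := (Complex.abs_im_le_norm _).trans hb
  have h4 := (abs_sub _ _).trans (add_le_add ((abs_add_le _ _).trans (add_le_add h3 ha')) hb')
  refine h4.trans ?_
  nlinarith

theorem isRealFamily_normalFormMap {ω r : ℝ} (hr : 0 < r)
    {P Q G : Wiener (Fin 2) (ℝ →ᵇ ℂ)} (hP : P ∈ realSubring (Fin 2)) (hQ : Q ∈ realSubring (Fin 2))
    (hG : G ∈ realSubring (Fin 2)) :
    IsRealFamily (normalFormMap ω r P.toSeries Q.toSeries G.toSeries) (domain (r / 2)) := by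
  rintro t - z ⟨⟨h1, h2⟩, -⟩ hz1 hz2 hz3
  have n1 := (norm_div_le_half hr h1).trans_lt (by norm_num : (1 / 2 : ℝ) < 1)
  have n2 := (norm_div_le_half hr h2).trans_lt (by norm_num : (1 / 2 : ℝ) < 1)
  have m1 : (z.1 / (r : ℂ)).im = 0 := by rw [Complex.div_ofReal_im, hz1, zero_div]
  have m2 : (z.2.1 / (r : ℂ)).im = 0 := by rw [Complex.div_ofReal_im, hz2, zero_div]
  have e1 := eval_im_eq_zero hP n1 n2 m1 m2 t
  have e2 := eval_im_eq_zero hQ n1 n2 m1 m2 t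
  have e3 := eval_im_eq_zero hG n1 n2 m1 m2 t
  have e4 : ((r : ℂ) ^ 2).im = 0 := by rw [← Complex.ofReal_pow, Complex.ofReal_im]
  refine ⟨?_, ?_, ?_⟩ <;>
    simp [normalFormMap, Complex.mul_im, e1, e2, e3, e4, hz1, hz2, hz3]

/-- Here `b` is a possibly weaker decay rate, lowered to at most `ω/2` to avoid resonances, and `r`
is the scaling radius. The last component contains `-F(P, Q, t)`, so the normal form identity is
algebraic; the substance lies in canonicity. -/
theorem exists_normalForm {ω R M a b r : ℝ} (hω : 0 < ω) (hω1 : ω ≤ 1) (hR : 0 < R) (hM : 1 ≤ M)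
    (hb : 0 < b) (hba : b ≤ a) (hbω : b ≤ ω / 2) (hr : 0 < r) (hr6 : r ≤ 1 / 6)
    (hrR : r / R ≤ 1 / 16) (hε : 4096 * M * r / R ^ 3 ≤ b / 8) {F : ℂ × ℂ → ℝ → ℂ}
    (hF : IsPerturbation R F) (hFd : SlowDecay R M a F) :
    ∃ Φ : ℝ → ℂ × ℂ × ℂ → ℂ × ℂ × ℂ, IsCanonicalFamily Φ (domain (r / 2)) ∧
      (∀ t, 0 ≤ t → MapsTo (Φ t) (domain (r / 2)) (domain r)) ∧
      (∀ t, 0 ≤ t → ∀ z ∈ domain (r / 2),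
        hamiltonian ω F (Φ t z) t = (ω : ℂ) * (z.1 * z.2.1) + z.2.2) ∧
      (IsRealPerturbation R F → IsRealFamily Φ (domain (r / 2))) := by
  obtain ⟨f, hf, hfF, hfr⟩ := exists_scaledCoeff hF hFd hR (by linarith) hb hba hr hrR
  have hε0 : 0 ≤ 4096 * M * r / R ^ 3 := by positivity
  obtain ⟨P, Q, ⟨hPX, hQX, hP2, hQ2⟩, hPt, hQt, hjac, hD, hreal⟩ :=
    exists_symplectic_conjugacy hb hbω hε0 hε hf
  have hG1 : ‖Wiener.const (σ := Fin 2) (decay b hb) * comp f P Q‖ ≤ 1 := by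
    refine (norm_const_mul_le (norm_decay_le hb) _).trans
      ((norm_comp_le hf (by norm_num) (by norm_num) hP2 hQ2).trans ?_)
    have : (1 - 2 * (1 / 16 : ℝ))⁻¹ * (1 - 2 * (1 / 16 : ℝ))⁻¹ ≤ 2 := by norm_num
    nlinarith
  refine ⟨normalFormMap ω r P.toSeries Q.toSeries
    (Wiener.const (decay b hb) * comp f P Q).toSeries, ?_, fun t _ => ?_, fun t ht z hz => ?_,
    fun h => ?_⟩
  · exact isCanonicalFamily_normalFormMap hPX hQX hr (converges_toSeries _) (converges_toSeries _)
      (converges_toSeries _) hPt hQt hjac hD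
  · exact mapsTo_normalFormMap hω hω1 hr hr6 hPX hQX hG1 t
  · have n1 := norm_div_le_half hr hz.1.1
    have n2 := norm_div_le_half hr hz.1.2
    have hp := norm_eval_le_of_near hPX n1 n2 t
    have hq := norm_eval_le_of_near hQX n1 n2 t
    have hs := eval_comp hf (by norm_num) (by norm_num) hP2 hQ2
      (n1.trans_lt (by norm_num)) (n2.trans_lt (by norm_num)) t
    have hG : eval (z.1 / r) (z.2.1 / r) t (Wiener.const (decay b hb) * comp f P Q).toSeries
        = decay b hb t * eval (z.1 / r) (z.2.1 / r) t (comp f P Q).toSeries := by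
      rw [map_mul, Wiener.toSeries_const, eval_mul (n1.trans_lt (by norm_num))
        (n2.trans_lt (by norm_num)) t (converges_C _) (converges_toSeries _), eval_C]
    have hrR' : r < R := by
      rw [div_le_iff₀ hR] at hrR
      linarith
    have hbd : ∀ {x : ℂ}, ‖x‖ ≤ 3 / 4 → ‖(r : ℂ) * x‖ < R := fun {x} hx => by
      rw [norm_mul, Complex.norm_real, Real.norm_eq_abs, abs_of_pos hr]
      nlinarith
    -- The image point lies in the open polydisc of radius `R`, so `F` there equals its Taylor
    -- series, which is then matched term by term with the composed scaled series.
    have hFs := hasSum_taylorCoeff hF hFd hR ht (hbd hp) (hbd hq)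
    have hFG : F (r * eval (z.1 / r) (z.2.1 / r) t P.toSeries,
        r * eval (z.1 / r) (z.2.1 / r) t Q.toSeries) t
        = r ^ 2 * eval (z.1 / r) (z.2.1 / r) t
          (Wiener.const (decay b hb) * comp f P Q).toSeries := by
      rw [hG, ← mul_assoc]
      refine hFs.unique ((hs.mul_left ((r : ℂ) ^ 2 * decay b hb t)).congr_fun fun β => ?_)
      rw [mul_pow, mul_pow]
      linear_combination (eval (z.1 / r) (z.2.1 / r) t P.toSeries ^ β.1
        * eval (z.1 / r) (z.2.1 / r) t Q.toSeries ^ β.2) * hfF β t ht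
    simp only [hamiltonian, normalFormMap, hFG]
    ring
  · obtain ⟨hPr, hQr⟩ := hreal (hfr h)
    exact isRealFamily_normalFormMap hr hPr hQr
      (mul_mem (monomial_mem_realSubring 0 (decay_im hb))
        (comp_mem_realSubring hf (by norm_num) (by norm_num) hP2 hQ2 (hfr h) hPr hQr))

end AperiodicMoser

theorem mainTheorem2 (ω R M : ℝ) (hω : 0 < ω) (hω1 : ω ≤ 1) (hR : 0 < R) (hR2 : R ≤ 1 / 2)
    (hM : 1 ≤ M) :
    ∃ R₀ Rs : ℝ → ℝ,
      (∃ c : ℝ, 0 < c ∧ Tendsto (fun a => R₀ a / a ^ 4) (𝓝[>] 0) (𝓝 c)) ∧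
      (∃ c : ℝ, 0 < c ∧ Tendsto (fun a => Rs a / a ^ 4) (𝓝[>] 0) (𝓝 c)) ∧
      ∀ a : ℝ, 0 < a →
        0 < Rs a ∧ Rs a < R₀ a ∧ R₀ a ≤ R ^ 4 ∧
        ∀ F : ℂ × ℂ → ℝ → ℂ,
          AperiodicMoser.IsPerturbation R F → AperiodicMoser.SlowDecay R M a F →
          ∃ Φ : ℝ → ℂ × ℂ × ℂ → ℂ × ℂ × ℂ,
            AperiodicMoser.IsCanonicalFamily Φ (AperiodicMoser.domain (Rs a)) ∧
            (∀ t, 0 ≤ t → MapsTo (Φ t) (AperiodicMoser.domain (Rs a))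
              (AperiodicMoser.domain (R₀ a))) ∧
            (∀ t, 0 ≤ t → ∀ z ∈ AperiodicMoser.domain (Rs a),
              AperiodicMoser.hamiltonian ω F (Φ t z) t = (ω : ℂ) * (z.1 * z.2.1) + z.2.2) ∧
            (AperiodicMoser.IsRealPerturbation R F →
              AperiodicMoser.IsRealFamily Φ (AperiodicMoser.domain (Rs a))) := by
  have hM0 : 0 < M := by linarith
  -- With `r = c b⁴` the scaled perturbation has size `2¹² M r / R³ = R b⁴ / 2⁸ ≤ b/8`, as the
  -- contraction demands. The contraction itself would allow `r` of order `b`; the fourth power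
  -- produces the prescribed asymptotics in `a`, and `R⁴` in `c` ensures `R₀ ≤ R⁴`.
  obtain ⟨c, hc⟩ : ∃ c, c = R ^ 4 / (2 ^ 20 * M) := ⟨_, rfl⟩
  have hc0 : 0 < c := by rw [hc]; positivity
  -- For `a < ω/2` the minimum is `a`, so the quotient is constant near zero.
  have hlim : Tendsto (fun a : ℝ => c * min a (ω / 2) ^ 4 / a ^ 4) (𝓝[>] 0) (𝓝 c) := by
    refine tendsto_const_nhds.congr' ?_
    filter_upwards [Ioo_mem_nhdsGT (by positivity : (0 : ℝ) < ω / 2)] with a ha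
    have ha0 : a ≠ 0 := ha.1.ne'
    rw [min_eq_left ha.2.le]
    field_simp
  refine ⟨fun a => c * min a (ω / 2) ^ 4, fun a => c * min a (ω / 2) ^ 4 / 2, ⟨c, hc0, hlim⟩,
    ⟨c / 2, by positivity, ?_⟩, fun a ha => ?_⟩
  · exact (hlim.div_const 2).congr fun a => by ring
  · beta_reduce
    have hb : 0 < min a (ω / 2) := lt_min ha (by positivity)
    have hba : min a (ω / 2) ≤ a := min_le_left _ _
    have hbω : min a (ω / 2) ≤ ω / 2 := min_le_right _ _
    generalize min a (ω / 2) = b at hb hba hbω ⊢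
    have hb1 : b ≤ 1 := by linarith
    have hb4 : b ^ 4 ≤ b := by
      simpa using pow_le_pow_of_le_one hb.le hb1 (by norm_num : 1 ≤ 4)
    have hb41 : b ^ 4 ≤ 1 := hb4.trans hb1
    have hr : 0 < c * b ^ 4 := by positivity
    have hR41 : R ^ 4 ≤ 1 / 16 := by
      calc R ^ 4 ≤ (1 / 2) ^ 4 := by gcongr
        _ = 1 / 16 := by norm_num
    have hcR : c ≤ R ^ 4 := by
      rw [hc]
      exact div_le_self (by positivity) (by nlinarith)
    have hrR4 : c * b ^ 4 ≤ R ^ 4 := (mul_le_of_le_one_right hc0.le hb41).trans hcR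
    refine ⟨by positivity, by linarith, hrR4, fun F hF hFd => ?_⟩
    refine AperiodicMoser.exists_normalForm hω hω1 hR hM hb hba hbω hr (by linarith) ?_ ?_ hF hFd
    · rw [div_le_iff₀ hR]
      have h1 : R ^ 4 ≤ 1 / 8 * R := by
        have h3 : R ^ 3 ≤ (1 / 2) ^ 3 := by gcongr
        nlinarith
      have h2 : c ≤ R ^ 4 / 2 := by
        rw [hc]
        gcongr
        nlinarith
      have h4 : c * b ^ 4 ≤ c := mul_le_of_le_one_right hc0.le hb41
      linarith
    · have e : 4096 * M * (c * b ^ 4) / R ^ 3 = R * b ^ 4 / 256 := by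
        rw [hc]
        field_simp
        norm_num
      rw [e]
      nlinarith
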